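/- **Loop expansion of heat kernel states.** *Graph.* Let $\Gamma$ be a finite oriented graph, given by a finite set $\mathcal S$ of seeds, a decomposition of $\mathcal S$ into nodes $n$ (write $i\sim j$ if $i,j$ lie in the same node), and a decomposition of $\mathcal S$ into links, i.e. ordered pairs $\ell=(s(\ell),t(\ell))$ such that every seed is an end of exactly one link. Put $\ell^{+1}=\ell$, and let $\ell^{-1}=(t(\ell),s(\ell))$. *Loops.* A loop $\alpha$ is a nonempty sequence $(\ell_1^{\epsilon_1},\dots,\ell_k^{\epsilon_k})$ of oriented links with $t(\ell_r^{\epsilon_r})\sim s(\ell_{r+1}^{\epsilon_{r+1}})$ ($r$ mod $k$), up to cyclic permutations and up to overall reversal of orientation; it is non-repeating if no proper cyclic permutation leaves the sequence invariant. The pairs $w=(t(\ell_r^{\epsilon_r}),s(\ell_{r+1}^{\epsilon_{r+1}}))$ are its wedges. A (non-repeating) multiloop $\Phi$ is a finite multiset of non-repeating loops. Fix, once and for all, an arbitrary orientation of every loop. For a multiloop $\Phi$, let $2j_\ell=2j_\ell(\Phi)$ be the number of times $\Phi$ traverses the link $\ell$ (in either direction, with multiplicity), and let $J_n=J_n(\Phi)=\sum_{i\in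 n}j_i\in\mathbb N$, where $j_{s(\ell)}=j_{t(\ell)}=j_\ell$. *Bosonic space.* Let $\mathcal H_{\mathcal S}$ be the bosonic Fock space with vacuum $|0\rangle$ of the oscillators $a_i^A$, $i\in\mathcal S$, $A\in\{0,1\}$, $[a_i^A,a_j^{B\dagger}]=\delta_{ij}\delta^{AB}$. Let $\epsilon_{01}=-\epsilon_{10}=1$, $\epsilon_{00}=\epsilon_{11}=0$. For a wedge $w=(i,j)$ put $F_w^\dagger=\epsilon_{AB}\,a_i^{A\dagger}a_j^{B\dagger}$, and let $F_\Phi^\dagger$ be the product of $F_w^\dagger$ over all wedges of all loops of $\Phi$, with multiplicity. Let $I_i=\tfrac12\sum_A a_i^{A\dagger}a_i^A$, $\vec J_i=\tfrac12\vec\sigma_{AB}\,a_i^{A\dagger}a_i^B$ with the Pauli matrices $\vec\sigma$, and let $P_\Gamma$ be the orthogonal projector of $\mathcal H_{\mathcal S}$ onto the subspace $\mathcal H_\Gamma$ of the states annihilated by $I_{s(\ell)}-I_{t(\ell)}$ for all links $\ell$ and by $\sum_{i\in n}\vec J_i$ for all nodes $n$. *Heat kernel states.* Let $H_\ell\in SL(2,\mathbb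 C)$ and $t_\ell>0$ for every link $\ell$, and let $$|H_\ell,t_\ell\rangle=\bigotimes_\ell\ \sum_{j_\ell\in\frac12\mathbb N_0}(2j_\ell+1)\,e^{-t_\ell j_\ell(j_\ell+1)}\sum_{m,n=-j_\ell}^{j_\ell}\big[D^{(j_\ell)}(H_\ell)\big]_{mn}\,|j_\ell,m,n\rangle .$$ Here $|j,m,n\rangle$ is the normalized state with occupation numbers $(j+m,\,j-m)$ of the oscillators $A=0,1$ at $t(\ell)$ and $(j+n,\,j-n)$ at $s(\ell)$, and $D^{(j)}(H)$ is the matrix, in the basis $(x^0)^{j+m}(x^1)^{j-m}/\sqrt{(j+m)!\,(j-m)!}$, of the representation $x^B\mapsto\sum_A H^{AB}x^A$ of $SL(2,\mathbb C)$ on homogeneous polynomials of degree $2j$. *Contraction.* In the product of the tensors $\epsilon_{AB}$ of all wedges of $\Phi$ there are, for each link $\ell$, $2j_\ell$ indices sitting at $t(\ell)$ and $2j_\ell$ indices sitting at $s(\ell)$. Let $(\epsilon\cdot H)$ be the contraction of this product with the symmetrized tensors $H_\ell^{\otimes 2j_\ell}$: the average, over the $\prod_\ell(2j_\ell)!$ ways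 of joining, for every link $\ell$, the indices at $t(\ell)$ with those at $s(\ell)$ in pairs, of the full contraction with one factor $H_\ell^{AB}$ for every joined pair, with $A$ at $t(\ell)$ and $B$ at $s(\ell)$. *Claim.* The state $|H_\ell,t_\ell\rangle$ has finite norm, and $$P_\Gamma|H_\ell,t_\ell\rangle=\sum_\Phi\frac{\Big[\prod_\ell(2j_\ell+1)\,e^{-t_\ell j_\ell(j_\ell+1)}\Big](\epsilon\cdot H)}{\prod_n(J_n+1)!}\;F_\Phi^\dagger|0\rangle ,$$ where $j_\ell=j_\ell(\Phi)$, $J_n=J_n(\Phi)$, the sum runs over all non-repeating multiloops $\Phi$ of $\Gamma$ (including the empty one), and it converges unconditionally in the norm of $\mathcal H_{\mathcal S}$. -/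

import Mathlib

open scoped BigOperators

noncomputable section

namespace LoopExpansion

/-! ### Graphs, loops and multiloops -/

/-- An oriented graph given by its seeds `S`, links `Λ` and nodes `N`: every seed is an end (source
or target) of exactly one link, and `node` is the decomposition of the seeds into nodes. -/
structure SeedGraph (S Λ N : Type*) where
  source : Λ → S
  target : Λ → S
  node : S → N
  bijective_ends : Function.Bijective (Sum.elim source target)

section Graph

variable {S Λ N : Type*}

/-- Starting seed of the oriented link `ℓ^{±1}`, coded as `(ℓ, true)` or `(ℓ, false)`. -/
def SeedGraph.start (G : SeedGraph S Λ N) (x : Λ × Bool) : S :=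
  if x.2 then G.source x.1 else G.target x.1

/-- Final seed of the oriented link `ℓ^{±1}`. -/
def SeedGraph.finish (G : SeedGraph S Λ N) (x : Λ × Bool) : S :=
  if x.2 then G.target x.1 else G.source x.1

/-- The cyclic sequence of oriented wedges `(t(ℓ_k^{ε_k}), s(ℓ_{k+1}^{ε_{k+1}}))` of a sequence of
oriented links, the last link being followed by the first one. -/
def SeedGraph.wedges (G : SeedGraph S Λ N) (l : List (Λ × Bool)) : List (S × S) :=
  List.zipWith (fun x y => (G.finish x, G.start y)) l (l.rotate 1)

/-- The same sequence of links traversed in the opposite direction. -/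
def reverseLinks (l : List (Λ × Bool)) : List (Λ × Bool) :=
  (l.map (fun x => (x.1, !x.2))).reverse

/-- A non-repeating oriented loop with a base point: a nonempty closed sequence of oriented links
that is not fixed by any proper cyclic permutation. -/
structure OrientedLoop (G : SeedGraph S Λ N) where
  links : List (Λ × Bool)
  ne_nil : links ≠ []
  closed : ∀ w ∈ G.wedges links, G.node w.1 = G.node w.2
  nonrepeating : ∀ k, 0 < k → k < links.length → links.rotate k ≠ links

theorem reverseLinks_reverseLinks (l : List (Λ × Bool)) :
    reverseLinks (reverseLinks l) = l := by
  simp [reverseLinks, Function.comp_def]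

theorem reverseLinks_isRotated {l l' : List (Λ × Bool)} (h : l ~r l') :
    reverseLinks l ~r reverseLinks l' :=
  (h.map _).reverse

/-- Sequences are identified up to cyclic permutations and an overall change of orientation. -/
instance loopSetoid (G : SeedGraph S Λ N) : Setoid (OrientedLoop G) where
  r p q := p.links ~r q.links ∨ p.links ~r reverseLinks q.links
  iseqv :=
    { refl := fun p => Or.inl (List.IsRotated.refl p.links)
      symm := by
        rintro p q (h | h)
        · exact Or.inl h.symm
        · right
          have h' := reverseLinks_isRotated h.symm
          rwa [reverseLinks_reverseLinks] at h'
      trans := by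
        rintro p q r (h | h) (h' | h')
        · exact Or.inl (h.trans h')
        · exact Or.inr (h.trans h')
        · exact Or.inr (h.trans (reverseLinks_isRotated h'))
        · left
          have h'' := reverseLinks_isRotated h'
          rw [reverseLinks_reverseLinks] at h''
          exact h.trans h'' }

/-- (Unoriented) non-repeating loops. -/
def Loop (G : SeedGraph S Λ N) : Type _ := Quotient (loopSetoid G)

/-- The loop underlying an oriented loop. -/
def OrientedLoop.toLoop {G : SeedGraph S Λ N} (p : OrientedLoop G) : Loop G :=
  Quotient.mk (loopSetoid G) p

/-- A non-repeating multiloop: a finite multiset of non-repeating loops. -/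
abbrev Multiloop (G : SeedGraph S Λ N) := Multiset (Loop G)

/-- A multiloop with a choice of orientation (and base point) for its loops. -/
abbrev OrientedMultiloop (G : SeedGraph S Λ N) := Multiset (OrientedLoop G)

/-- `2 j_ℓ(Φ)`: how many times `Φ` traverses the link `ℓ`, in either direction. -/
def twiceSpin [DecidableEq Λ] {G : SeedGraph S Λ N} (Φ : OrientedMultiloop G) (ℓ : Λ) : ℕ :=
  (Φ.map (fun p => (p.links.map Prod.fst).count ℓ)).sum

/-- `2 J_n(Φ) = ∑_{i ∈ n} 2 j_i`, where both ends of `ℓ` carry the spin `j_ℓ`. -/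
def twiceNodeSpin [Fintype Λ] [DecidableEq Λ] [DecidableEq N] (G : SeedGraph S Λ N)
    (Φ : OrientedMultiloop G) (n : N) : ℕ :=
  ∑ ℓ, ((if G.node (G.source ℓ) = n then twiceSpin Φ ℓ else 0) +
    (if G.node (G.target ℓ) = n then twiceSpin Φ ℓ else 0))

/-- `J_n(Φ) = ∑_{i ∈ n} j_i`. The division is exact, see `two_mul_nodeSpin`. -/
def nodeSpin [Fintype Λ] [DecidableEq Λ] [DecidableEq N] (G : SeedGraph S Λ N)
    (Φ : OrientedMultiloop G) (n : N) : ℕ :=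
  twiceNodeSpin G Φ n / 2

theorem map_node_finish (G : SeedGraph S Λ N) (p : OrientedLoop G) :
    p.links.map (fun x => G.node (G.finish x)) =
      (p.links.rotate 1).map (fun x => G.node (G.start x)) := by
  refine List.ext_getElem (by simp) fun k h1 h2 => ?_
  have hk : k < (G.wedges p.links).length := by
    simpa [SeedGraph.wedges] using h1
  have h := p.closed _ (List.getElem_mem hk)
  simpa [SeedGraph.wedges] using h

theorem sum_ends_eq_count [Fintype Λ] [DecidableEq Λ] [DecidableEq N] (G : SeedGraph S Λ N)
    (l : List (Λ × Bool)) (n : N) :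
    ∑ ℓ, ((if G.node (G.source ℓ) = n then (l.map Prod.fst).count ℓ else 0) +
      (if G.node (G.target ℓ) = n then (l.map Prod.fst).count ℓ else 0)) =
    (l.map (fun x => G.node (G.start x))).count n +
      (l.map (fun x => G.node (G.finish x))).count n := by
  induction l with
  | nil => simp
  | cons x l ih =>
    have h : ∀ P : Λ → Prop, [DecidablePred P] →
        ∑ ℓ, (if P ℓ then ((x :: l).map Prod.fst).count ℓ else 0) =
          ∑ ℓ, (if P ℓ then (l.map Prod.fst).count ℓ else 0) + if P x.1 then 1 else 0 := by
      intro P _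
      have : ∀ ℓ, (if P ℓ then ((x :: l).map Prod.fst).count ℓ else 0) =
          (if P ℓ then (l.map Prod.fst).count ℓ else 0) +
            if ℓ = x.1 then (if P x.1 then 1 else 0) else 0 := by
        intro ℓ
        rw [List.map_cons, List.count_cons]
        by_cases hx : ℓ = x.1
        · subst hx
          by_cases hP : P x.1 <;> simp [hP]
        · have hx' : ¬ x.1 = ℓ := fun e => hx e.symm
          simp [hx, hx']
      simp only [this, Finset.sum_add_distrib, Finset.sum_ite_eq', Finset.mem_univ, if_true]
    rw [Finset.sum_add_distrib] at ih ⊢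
    rw [h, h]
    simp only [List.map_cons, List.count_cons]
    obtain ⟨ℓ, b⟩ := x
    simp only [SeedGraph.start, SeedGraph.finish] at ih ⊢
    cases b <;> simp <;> omega

theorem even_twiceNodeSpin [Fintype Λ] [DecidableEq Λ] [DecidableEq N] (G : SeedGraph S Λ N)
    (Φ : OrientedMultiloop G) (n : N) : Even (twiceNodeSpin G Φ n) := by
  induction Φ using Multiset.induction_on with
  | empty => simp [twiceNodeSpin, twiceSpin]
  | cons p Φ ih =>
    have h : twiceNodeSpin G (p ::ₘ Φ) n =
        ∑ ℓ, ((if G.node (G.source ℓ) = n then (p.links.map Prod.fst).count ℓ else 0) +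
          (if G.node (G.target ℓ) = n then (p.links.map Prod.fst).count ℓ else 0)) +
        twiceNodeSpin G Φ n := by
      rw [twiceNodeSpin, twiceNodeSpin, ← Finset.sum_add_distrib]
      refine Finset.sum_congr rfl fun ℓ _ => ?_
      simp only [twiceSpin, Multiset.map_cons, Multiset.sum_cons]
      split_ifs <;> omega
    rw [h, sum_ends_eq_count, map_node_finish, ((p.links.rotate_perm 1).map _).count_eq n]
    exact (Even.add_self _).add ih

theorem two_mul_nodeSpin [Fintype Λ] [DecidableEq Λ] [DecidableEq N] (G : SeedGraph S Λ N)
    (Φ : OrientedMultiloop G) (n : N) : 2 * nodeSpin G Φ n = twiceNodeSpin G Φ n :=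
  Nat.two_mul_div_two_of_even (even_twiceNodeSpin G Φ n)

/-- All oriented wedges of an oriented multiloop, with multiplicities (in some order). -/
def multiloopWedges (G : SeedGraph S Λ N) (Φ : OrientedMultiloop G) : List (S × S) :=
  (Φ.toList.map (fun p => G.wedges p.links)).flatten

end Graph

/-! ### The bosonic Fock space -/

/-- Occupation numbers of the oscillators `(i, A)`, for seeds `i` and `A = 0, 1`. -/
abbrev Occ (S : Type*) := S × Fin 2 → ℕ

/-- Amplitudes in the orthonormal basis of occupation number states
`∏ (a_i^A†)^{ν(i,A)} / √ν(i,A)! |0⟩`, without condition at infinity. -/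
abbrev Amp (S : Type*) := Occ S → ℂ

/-- The bosonic Hilbert space: square summable amplitudes. -/
abbrev Fock (S : Type*) := lp (fun _ : Occ S => ℂ) 2

theorem continuous_coord {S : Type*} (ν : Occ S) : Continuous fun ψ : Fock S => (ψ : Amp S) ν :=
  (continuous_apply ν).comp (lp.uniformContinuous_coe (E := fun _ : Occ S => ℂ) (p := 2)).continuous

section FockSpace

variable {S : Type*} [DecidableEq S]

/-- The vacuum `|0⟩`. -/
def vacuum [Fintype S] : Amp S := fun ν => if ν = 0 then 1 else 0

/-- The creation operator `a_k†` : `|ν⟩ ↦ √(ν_k + 1) |ν + e_k⟩`. -/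
def creation (k : S × Fin 2) : Amp S →ₗ[ℂ] Amp S where
  toFun ψ ν := (Real.sqrt (ν k) : ℂ) * ψ (ν - Pi.single k 1)
  map_add' ψ φ := by ext ν; simp [mul_add]
  map_smul' c ψ := by ext ν; simp [mul_left_comm]

/-- The annihilation operator `a_k` : `|ν⟩ ↦ √ν_k |ν - e_k⟩`. -/
def annihilation (k : S × Fin 2) : Amp S →ₗ[ℂ] Amp S where
  toFun ψ ν := (Real.sqrt (ν k + 1) : ℂ) * ψ (ν + Pi.single k 1)
  map_add' ψ φ := by ext ν; simp [mul_add]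
  map_smul' c ψ := by ext ν; simp [mul_left_comm]

/-- The Pauli matrices. -/
def pauli : Fin 3 → Matrix (Fin 2) (Fin 2) ℂ :=
  ![!![0, 1; 1, 0], !![0, -Complex.I; Complex.I, 0], !![1, 0; 0, -1]]

/-- `I_i = (1/2) δ_{AB} a_i^A† a_i^B`. -/
def seedSpin (i : S) : Amp S →ₗ[ℂ] Amp S :=
  (1 / 2 : ℂ) • ∑ A : Fin 2, creation (i, A) ∘ₗ annihilation (i, A)

/-- `J_i^a = (1/2) σ^a_{AB} a_i^A† a_i^B`. -/
def seedJ (a : Fin 3) (i : S) : Amp S →ₗ[ℂ] Amp S :=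
  (1 / 2 : ℂ) • ∑ A : Fin 2, ∑ B : Fin 2,
    pauli a A B • (creation (i, A) ∘ₗ annihilation (i, B))

theorem continuous_bilinear (k l : S × Fin 2) (ν : Occ S) :
    Continuous fun ψ : Fock S => creation k (annihilation l (ψ : Amp S)) ν := by
  simp only [creation, annihilation, LinearMap.coe_mk, AddHom.coe_mk]
  exact continuous_const.mul (continuous_const.mul (continuous_coord _))

theorem continuous_seedSpin (i : S) (ν : Occ S) :
    Continuous fun ψ : Fock S => seedSpin i (ψ : Amp S) ν := by
  simp only [seedSpin, LinearMap.smul_apply, LinearMap.sum_apply, LinearMap.comp_apply,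
    Pi.smul_apply, Finset.sum_apply, smul_eq_mul]
  exact continuous_const.mul (continuous_finsetSum _ fun A _ =>
    continuous_bilinear (i, A) (i, A) ν)

theorem continuous_seedJ (a : Fin 3) (i : S) (ν : Occ S) :
    Continuous fun ψ : Fock S => seedJ a i (ψ : Amp S) ν := by
  simp only [seedJ, LinearMap.smul_apply, LinearMap.sum_apply, LinearMap.comp_apply,
    Pi.smul_apply, Finset.sum_apply, smul_eq_mul]
  exact continuous_const.mul (continuous_finsetSum _ fun A _ => continuous_finsetSum _ fun B _ =>
    continuous_const.mul (continuous_bilinear (i, A) (i, B) ν))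

theorem finite_support_creation (k : S × Fin 2) {ψ : Amp S} (h : ψ.support.Finite) :
    (creation k ψ).support.Finite := by
  refine (h.image fun ν => ν + Pi.single k 1).subset fun ν hν => ?_
  simp only [creation, LinearMap.coe_mk, AddHom.coe_mk, Function.mem_support, ne_eq,
    mul_eq_zero, not_or] at hν
  refine ⟨ν - Pi.single k 1, hν.2, ?_⟩
  have hk : ν k ≠ 0 := by
    intro h0
    simp [h0] at hν
  funext x
  by_cases hx : x = k
  · subst hx
    simp only [Pi.add_apply, Pi.sub_apply, Pi.single_eq_same]
    omega
  · simp [hx]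

end FockSpace

/-! ### The physical space and its projector -/

section Physical

variable {S Λ N : Type*} [Fintype S] [DecidableEq S] [DecidableEq N]

/-- The link constraint `C_ℓ = I_{s(ℓ)} - I_{t(ℓ)}`. -/
def linkConstraint (G : SeedGraph S Λ N) (ℓ : Λ) : Amp S →ₗ[ℂ] Amp S :=
  seedSpin (G.source ℓ) - seedSpin (G.target ℓ)

/-- The components of the node (Gauss) constraint `G_n = ∑_{i ∈ n} J_i`. -/
def nodeConstraint (G : SeedGraph S Λ N) (n : N) (a : Fin 3) : Amp S →ₗ[ℂ] Amp S :=
  ∑ i with G.node i = n, seedJ a i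

/-- `H_Γ`: the states of the bosonic Hilbert space that solve all link and node constraints. -/
def physicalSpace (G : SeedGraph S Λ N) : Submodule ℂ (Fock S) where
  carrier := {ψ | (∀ ℓ, linkConstraint G ℓ (ψ : Amp S) = 0) ∧
    ∀ n a, nodeConstraint G n a (ψ : Amp S) = 0}
  zero_mem' := by
    refine ⟨fun ℓ => ?_, fun n a => ?_⟩
    · rw [lp.coeFn_zero, map_zero]
    · rw [lp.coeFn_zero, map_zero]
  add_mem' := by
    rintro ψ φ ⟨h1, h2⟩ ⟨h3, h4⟩
    refine ⟨fun ℓ => ?_, fun n a => ?_⟩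
    · rw [lp.coeFn_add, map_add, h1, h3, add_zero]
    · rw [lp.coeFn_add, map_add, h2, h4, add_zero]
  smul_mem' := by
    rintro c ψ ⟨h1, h2⟩
    refine ⟨fun ℓ => ?_, fun n a => ?_⟩
    · rw [lp.coeFn_smul, map_smul, h1, smul_zero]
    · rw [lp.coeFn_smul, map_smul, h2, smul_zero]

theorem isClosed_physicalSpace (G : SeedGraph S Λ N) :
    IsClosed (physicalSpace G : Set (Fock S)) := by
  have h : (physicalSpace G : Set (Fock S)) =
      (⋂ ℓ, ⋂ ν, {ψ : Fock S | linkConstraint G ℓ (ψ : Amp S) ν = 0}) ∩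
      ⋂ n, ⋂ a, ⋂ ν, {ψ : Fock S | nodeConstraint G n a (ψ : Amp S) ν = 0} := by
    ext ψ
    simp [physicalSpace, funext_iff]
  rw [h]
  refine IsClosed.inter (isClosed_iInter fun ℓ => isClosed_iInter fun ν => ?_)
    (isClosed_iInter fun n => isClosed_iInter fun a => isClosed_iInter fun ν => ?_)
  · refine isClosed_eq ?_ continuous_const
    simp only [linkConstraint, LinearMap.sub_apply, Pi.sub_apply]
    exact (continuous_seedSpin _ _).sub (continuous_seedSpin _ _)
  · refine isClosed_eq ?_ continuous_const
    simp only [nodeConstraint, LinearMap.sum_apply, Finset.sum_apply]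
    exact continuous_finsetSum _ fun i _ => continuous_seedJ _ _ _

instance completeSpace_physicalSpace (G : SeedGraph S Λ N) : CompleteSpace (physicalSpace G) :=
  (isClosed_physicalSpace G).completeSpace_coe

/-- The orthogonal projector `P_Γ` of the bosonic Hilbert space onto `H_Γ`. -/
def projector (G : SeedGraph S Λ N) : Fock S →L[ℂ] Fock S :=
  (physicalSpace G).starProjection

end Physical

/-! ### Multiloop states -/

section MultiloopStates

variable {S Λ N : Type*} [Fintype S] [DecidableEq S] [DecidableEq N]

/-- The wedge creation operator `F_{ij}† = ε_{AB} a_i^A† a_j^B†`, zero if `i`, `j` are seeds of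
distinct nodes. -/
def wedgeCreation (G : SeedGraph S Λ N) (w : S × S) : Module.End ℂ (Amp S) :=
  if G.node w.1 = G.node w.2 then
    creation (w.1, 0) ∘ₗ creation (w.2, 1) - creation (w.1, 1) ∘ₗ creation (w.2, 0)
  else 0

/-- `F_Φ†`, the product of the wedge creation operators (which commute) over the wedges of all the
loops of `Φ`. -/
def multiloopCreation (G : SeedGraph S Λ N) (Φ : OrientedMultiloop G) : Module.End ℂ (Amp S) :=
  ((multiloopWedges G Φ).map (wedgeCreation G)).prod

theorem finite_support_wedgeCreation (G : SeedGraph S Λ N) (w : S × S) {ψ : Amp S}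
    (h : ψ.support.Finite) : (wedgeCreation G w ψ).support.Finite := by
  unfold wedgeCreation
  split_ifs
  · exact ((finite_support_creation _ (finite_support_creation _ h)).union
      (finite_support_creation _ (finite_support_creation _ h))).subset
        (Function.support_sub _ _)
  · simp

theorem finite_support_multiloop (G : SeedGraph S Λ N) (Φ : OrientedMultiloop G) :
    (multiloopCreation G Φ vacuum).support.Finite := by
  unfold multiloopCreation
  induction multiloopWedges G Φ with
  | nil =>
    refine (Set.finite_singleton (0 : Occ S)).subset fun ν hν => ?_
    by_contra h
    exact hν (if_neg h)
  | cons w l ih =>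
    simp only [List.map_cons, List.prod_cons, Module.End.mul_apply]
    exact finite_support_wedgeCreation G w ih

/-- The multiloop state `|Φ⟩ = F_Φ† |0⟩` as a vector of the bosonic Hilbert space. -/
def multiloopState (G : SeedGraph S Λ N) (Φ : OrientedMultiloop G) : Fock S :=
  ⟨multiloopCreation G Φ vacuum,
    (memℓp_zero (finite_support_multiloop G Φ)).of_exponent_ge zero_le⟩

end MultiloopStates

/-! ### Heat kernel states -/

/-- The matrix element `D^{(j)}_{mn}(H)`, with `d = 2j`, `k = j + m`, `l = j + n`, of the spin `j`
representation of `SL(2, ℂ)` on the homogeneous polynomials of degree `2j` in `x^0, x^1` (on which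
`x^B ↦ ∑_A H_{AB} x^A`), in the standard basis
`e_m = (x^0)^{j+m} (x^1)^{j-m} / √((j+m)! (j-m)!)`. Polynomials are dehomogenized by `x^1 = 1`. -/
def wignerD (d : ℕ) (H : Matrix (Fin 2) (Fin 2) ℂ) (k l : ℕ) : ℂ :=
  ((Real.sqrt (k.factorial * (d - k).factorial) /
      Real.sqrt (l.factorial * (d - l).factorial) : ℝ) : ℂ) *
    ((Polynomial.C (H 0 0) * Polynomial.X + Polynomial.C (H 1 0)) ^ l *
      (Polynomial.C (H 0 1) * Polynomial.X + Polynomial.C (H 1 1)) ^ (d - l)).coeff k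

/-- The weight `(2j+1) e^{-t j(j+1)}`, with `d = 2j`. -/
def heatWeight (t : ℝ) (d : ℕ) : ℝ :=
  (d + 1) * Real.exp (-t * ((d / 2 : ℝ) * (d / 2 + 1)))

/-- Amplitudes of `∑_j (2j+1) e^{-t j(j+1)} ∑_{m,n} D^{(j)}_{mn}(H) |j,m,n⟩` for a link, where
`|j,m,n⟩` has the occupation numbers `(j+m, j-m) = (p₀, p₁)` at the target of the link and
`(j+n, j-n) = (q₀, q₁)` at its source. -/
def linkAmplitude (t : ℝ) (H : Matrix (Fin 2) (Fin 2) ℂ) (p q : Fin 2 → ℕ) : ℂ :=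
  if p 0 + p 1 = q 0 + q 1 then
    (heatWeight t (p 0 + p 1) : ℂ) * wignerD (p 0 + p 1) H (p 0) (q 0)
  else 0

/-- The heat kernel state `|H_ℓ, t_ℓ⟩`, the tensor product over the links. -/
def heatKernelAmplitude {S Λ N : Type*} [Fintype Λ] (G : SeedGraph S Λ N)
    (H : Λ → Matrix.SpecialLinearGroup (Fin 2) ℂ) (t : Λ → ℝ) : Amp S := fun ν =>
  ∏ ℓ, linkAmplitude (t ℓ) (H ℓ : Matrix (Fin 2) (Fin 2) ℂ)
    (fun A => ν (G.target ℓ, A)) (fun A => ν (G.source ℓ, A))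

/-! ### The contraction `ε · H` -/

section Contraction

variable {S Λ N : Type*} [Fintype Λ] [DecidableEq S] [DecidableEq Λ]

/-- The antisymmetric tensor with `ε_{01} = 1`. -/
def eps : Matrix (Fin 2) (Fin 2) ℂ := !![0, 1; -1, 0]

/-- The spinor indices of `∏_w ε_{AB}` for a list of wedges: `(r, 0)` and `(r, 1)` are the two
indices of the `ε` tensor of the `r`-th wedge. -/
abbrev Slot (W : List (S × S)) := Fin W.length × Fin 2

/-- The seed at which an index sits. -/
def slotSeed (W : List (S × S)) (x : Slot W) : S :=
  if x.2 = 0 then (W.get x.1).1 else (W.get x.1).2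

/-- The ways of joining the indices at the source of each link in pairs with the indices at its
target, as involutions. For the wedges of a multiloop there are `∏_ℓ (2j_ℓ)!` of them, related
by permutations of the strands of the links. -/
def strandings (G : SeedGraph S Λ N) (W : List (S × S)) : Finset (Equiv.Perm (Slot W)) :=
  {σ | (∀ x, σ (σ x) = x) ∧
    ∀ x ℓ, slotSeed W x = G.source ℓ ↔ slotSeed W (σ x) = G.target ℓ}

/-- Contraction of the `ε` tensors of the wedges with one factor `H_ℓ^{AB}` for every joined pair
of indices, `A` at the target and `B` at the source of `ℓ`. -/
def contractAlong (G : SeedGraph S Λ N) (H : Λ → Matrix.SpecialLinearGroup (Fin 2) ℂ)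
    (W : List (S × S)) (σ : Equiv.Perm (Slot W)) : ℂ :=
  ∑ A : Slot W → Fin 2,
    (∏ r : Fin W.length, eps (A (r, 0)) (A (r, 1))) *
      ∏ ℓ, ∏ x with slotSeed W x = G.source ℓ,
        (H ℓ : Matrix (Fin 2) (Fin 2) ℂ) (A (σ x)) (A x)

/-- `ε · H`: the contraction of the `ε` tensors of the wedges of `Φ` with the tensors
`H_ℓ^{⊗ 2j_ℓ}`, symmetrized over the `2j_ℓ` bosonic strands of each link (so that `H_ℓ^{⊗ 2j_ℓ}`
acts on the spin `j_ℓ` space). -/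
def epsDotH (G : SeedGraph S Λ N) (H : Λ → Matrix.SpecialLinearGroup (Fin 2) ℂ)
    (Φ : OrientedMultiloop G) : ℂ :=
  (∏ ℓ, ((twiceSpin Φ ℓ).factorial : ℂ))⁻¹ *
    ∑ σ ∈ strandings G (multiloopWedges G Φ), contractAlong G H (multiloopWedges G Φ) σ

end Contraction

end LoopExpansion

end

/-! A vector of $\mathcal H_\Gamma$ with the same inner products against all of $\mathcal H_\Gamma$
as the heat kernel state $\psi$ is $P_\Gamma\psi$. Every term of the series lies in $\mathcal
H_\Gamma$ and the series converges absolutely, so only the pairings with $\varphi\in\mathcal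
H_\Gamma$ have to be compared. This is done level by level, matching $2M$ quanta with multiloops of
total length $M$.

Node invariance. At a node, the sum of $F_{ij}^\dagger F_{ij}$ over ordered pairs of its seeds is a
combination of $U(2)$ generators; on an invariant amplitude with $N_n$ quanta at the node it equals
$N_n(N_n/2+1)$ (`sum_wedge_apply`). Dividing by $N_n/2+1$, summing over the nodes and iterating
gives, at level $2M$ (`eq_sumLists_of_isInvariant`), $$\varphi=\frac1{2^M
M!}\sum_{W}\frac{(F_W\varphi)(0)}{\prod_n(J_n+1)!}\,F_W^\dagger|0\rangle ,$$ with $W$ running over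
all sequences of $M$ wedges.

From wedges to loops. The link constraint allows $W$ to be weighted by its $\prod_\ell(2j_\ell)!$
strandings, this factor being divided out again. Stranded wedges close up into walks. Following the
strand through a marked wedge end gives a recursion (`wedgeSum_recursion`). The sum over multiloops
obeys the same recursion (`two_mul_multiloopSum`): it is the logarithmic derivative of
$\prod_\alpha(1-\alpha)^{-1}$, combined with the unique factorization of a closed walk as a power of
a primitive one. A reduced loop has exactly $2|\alpha|$ based oriented representatives; walks that
are not reduced drop out, since they contain a factor $F_{ii}=0$ or a wedge across two nodes. Hence
`multiloopSum_eq_wedgeSum`. The arbitrary orientations are harmless, because the two factors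
$F_W\varphi$ and $F_W\psi$ change sign together.

Coefficients. In the basis $\prod(a_k^\dagger)^{\nu_k}/\nu_k!\,|0\rangle$ the annihilators are
shifts, and the matrix elements of $D^{(j)}$ become permanents of $H$, that is, sums over the ways
of joining strands. So $(F_W\psi)(0)$ is the product of the heat weights with the sum of the
contractions over all strandings (`wedgesAnnihilation_heatKernel`).

Convergence. The Gaussian decay of the heat weights in $j$ beats the factorials coming from
$D^{(j)}$, from $F_W\psi$ and from $\|F_W^\dagger|0\rangle\|$, while the number of multiloops grows
only exponentially with their length. -/

noncomputable section

namespace LoopExpansion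

/-! ### Canonical commutation relations and transposition of operators -/

section FockAlgebra

variable {S : Type*} [DecidableEq S]

theorem creation_apply (k : S × Fin 2) (ψ : Amp S) (ν : Occ S) :
    creation k ψ ν = (Real.sqrt (ν k) : ℂ) * ψ (ν - Pi.single k 1) := rfl

theorem annihilation_apply (k : S × Fin 2) (ψ : Amp S) (ν : Occ S) :
    annihilation k ψ ν = (Real.sqrt (ν k + 1) : ℂ) * ψ (ν + Pi.single k 1) := rfl

theorem sub_single_add_single (ν : Occ S) (k : S × Fin 2) (h : ν k ≠ 0) :
    ν - Pi.single k 1 + Pi.single k 1 = ν := by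
  funext x
  by_cases hx : x = k
  · subst hx
    simp only [Pi.add_apply, Pi.sub_apply, Pi.single_eq_same]
    omega
  · simp [hx]

theorem annihilation_commute (k l : S × Fin 2) :
    Commute (annihilation k : Module.End ℂ (Amp S)) (annihilation l) := by
  refine LinearMap.ext fun ψ => funext fun ν => ?_
  simp only [Module.End.mul_apply, annihilation_apply, Pi.add_apply]
  by_cases h : k = l
  · subst h; rfl
  · rw [Pi.single_eq_of_ne h, Pi.single_eq_of_ne (Ne.symm h), add_right_comm ν]
    simp only [add_zero]
    ring

theorem creation_commute (k l : S × Fin 2) :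
    Commute (creation k : Module.End ℂ (Amp S)) (creation l) := by
  refine LinearMap.ext fun ψ => funext fun ν => ?_
  simp only [Module.End.mul_apply, creation_apply, Pi.sub_apply]
  by_cases h : k = l
  · subst h; rfl
  · rw [Pi.single_eq_of_ne h, Pi.single_eq_of_ne (Ne.symm h), tsub_right_comm]
    simp only [tsub_zero]
    ring

theorem annihilation_mul_creation (k l : S × Fin 2) :
    (annihilation k * creation l : Module.End ℂ (Amp S)) =
      creation l * annihilation k + if k = l then 1 else 0 := by
  refine LinearMap.ext fun ψ => funext fun ν => ?_
  simp only [LinearMap.add_apply, Module.End.mul_apply, creation_apply, annihilation_apply,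
    Pi.add_apply, Pi.sub_apply]
  by_cases h : k = l
  · subst h
    have h1 : (Real.sqrt ((ν k : ℝ) + 1) : ℂ) * Real.sqrt ((ν k : ℝ) + 1) = ν k + 1 := by
      rw [← Complex.ofReal_mul, Real.mul_self_sqrt (by positivity)]; push_cast; rfl
    simp only [Pi.single_eq_same, if_true, Module.End.one_apply, add_tsub_cancel_right]
    push_cast
    rw [← mul_assoc, h1]
    -- Subtraction of occupation numbers is truncated at zero; there the factor $\sqrt{\nu_k}$
    -- vanishes, so the truncated value does not matter.
    rcases Nat.eq_zero_or_pos (ν k) with h0 | h0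
    · simp [h0]
    · rw [sub_single_add_single ν k h0.ne']
      have h3 : (Real.sqrt (ν k) : ℂ) * Real.sqrt (((ν k - 1 : ℕ) : ℝ) + 1) = ν k := by
        rw [← Complex.ofReal_mul, Nat.cast_sub h0]
        simp
      rw [← mul_assoc, h3]
      ring
  · have h' : ¬ l = k := fun e => h e.symm
    rw [Pi.single_eq_of_ne h, Pi.single_eq_of_ne h']
    simp only [h, if_false, LinearMap.zero_apply, Pi.zero_apply, add_zero, tsub_zero]
    have : ν + Pi.single k 1 - Pi.single l 1 = ν - Pi.single l 1 + Pi.single k 1 := by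
      funext x
      by_cases hx : x = k
      · subst hx; simp [h]
      · simp [hx]
    rw [this]
    ring

theorem creation_mul_annihilation_apply (k : S × Fin 2) (ψ : Amp S) (ν : Occ S) :
    (creation k * annihilation k : Module.End ℂ (Amp S)) ψ ν = ν k * ψ ν := by
  simp only [Module.End.mul_apply, creation_apply, annihilation_apply, Pi.sub_apply,
    Pi.single_eq_same]
  rcases Nat.eq_zero_or_pos (ν k) with h0 | h0
  · simp [h0]
  · rw [sub_single_add_single ν k h0.ne']
    have h3 : (Real.sqrt (ν k) : ℂ) * Real.sqrt (((ν k - 1 : ℕ) : ℝ) + 1) = ν k := by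
      rw [← Complex.ofReal_mul, Nat.cast_sub h0]
      simp
    rw [← mul_assoc, h3]

/-- Creation and annihilation operators are adjoint for the bilinear pairing of amplitudes. -/
theorem hasSum_creation_mul (k : S × Fin 2) (ξ χ : Amp S) {x : ℂ}
    (h : HasSum (fun ν => ξ ν * annihilation k χ ν) x) :
    HasSum (fun ν => creation k ξ ν * χ ν) x := by
  have hinj : Function.Injective (fun ν : Occ S => ν + Pi.single k 1) := add_left_injective _
  rw [← hinj.hasSum_iff]
  · convert h using 2 with ν
    simp only [Function.comp_apply, creation_apply, annihilation_apply, Pi.add_apply,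
      Pi.single_eq_same, add_tsub_cancel_right]
    push_cast
    ring
  -- An occupation outside the range of the shift has $\nu_k=0$ and is killed by $\sqrt{\nu_k}$.
  · intro ν hν
    have : ν k = 0 := by
      by_contra h0
      exact hν ⟨ν - Pi.single k 1, sub_single_add_single ν k h0⟩
    simp [creation_apply, this]

theorem tsum_creation_mul (k : S × Fin 2) {ξ : Amp S} (hξ : ξ.support.Finite) (χ : Amp S) :
    ∑' ν, creation k ξ ν * χ ν = ∑' ν, ξ ν * annihilation k χ ν :=
  (hasSum_creation_mul k ξ χ (summable_of_hasFiniteSupport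
    (hξ.subset fun ν hν h => hν (by simp [h]))).hasSum).tsum_eq

theorem summable_mul_of_finite_support {ξ : Amp S} (hξ : ξ.support.Finite) (χ : Amp S) :
    Summable fun ν => ξ ν * χ ν :=
  summable_of_hasFiniteSupport (hξ.subset fun ν hν h => hν (by simp [h]))

end FockAlgebra

/-! ### Wedge operators, and pairing with the states they create -/

section WedgeAlgebra

variable {S Λ N : Type*} [DecidableEq S] [DecidableEq N]

/-- The wedge annihilation operator, zero if the seeds belong to distinct nodes. -/
def wedgeAnnihilation (G : SeedGraph S Λ N) (w : S × S) : Module.End ℂ (Amp S) :=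
  if G.node w.1 = G.node w.2 then
    annihilation (w.1, 0) * annihilation (w.2, 1) - annihilation (w.1, 1) * annihilation (w.2, 0)
  else 0

/-- The product of the wedge creation operators of a list of wedges. -/
def wedgesCreation (G : SeedGraph S Λ N) (W : List (S × S)) : Module.End ℂ (Amp S) :=
  (W.map (wedgeCreation G)).prod

/-- The product of the wedge annihilation operators of a list of wedges. -/
def wedgesAnnihilation (G : SeedGraph S Λ N) (W : List (S × S)) : Module.End ℂ (Amp S) :=
  (W.map (wedgeAnnihilation G)).prod

theorem wedgeCreation_eq (G : SeedGraph S Λ N) (w : S × S) : wedgeCreation G w =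
    if G.node w.1 = G.node w.2 then
    creation (w.1, 0) * creation (w.2, 1) - creation (w.1, 1) * creation (w.2, 0)
  else 0 := rfl

theorem wedgeAnnihilation_commute (G : SeedGraph S Λ N) (v w : S × S) :
    Commute (wedgeAnnihilation G v) (wedgeAnnihilation G w) := by
  have h := @annihilation_commute S _
  have h2 : ∀ a b c d : S × Fin 2, Commute (annihilation a * annihilation b : Module.End ℂ (Amp S))
      (annihilation c * annihilation d) := fun a b c d =>
    ((h a c).mul_left (h b c)).mul_right ((h a d).mul_left (h b d))
  unfold wedgeAnnihilation
  split_ifs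
  · exact ((h2 _ _ _ _).sub_left (h2 _ _ _ _)).sub_right ((h2 _ _ _ _).sub_left (h2 _ _ _ _))
  · exact Commute.zero_right _
  · exact Commute.zero_left _
  · exact Commute.zero_left _

theorem wedgeAnnihilation_swap (G : SeedGraph S Λ N) (i j : S) :
    wedgeAnnihilation G (j, i) = - wedgeAnnihilation G (i, j) := by
  have h := fun k l => (@annihilation_commute S _ k l).eq
  unfold wedgeAnnihilation
  simp only [eq_comm (a := G.node j)]
  split_ifs
  · rw [h (j, 0), h (j, 1), neg_sub]
  · simp

theorem wedgeAnnihilation_self (G : SeedGraph S Λ N) (i : S) :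
    wedgeAnnihilation G (i, i) = 0 := by
  have h := fun k l => (@annihilation_commute S _ k l).eq
  simp [wedgeAnnihilation, h (i, 0)]

theorem wedgesAnnihilation_nil (G : SeedGraph S Λ N) : wedgesAnnihilation G [] = 1 := rfl

theorem wedgesCreation_nil (G : SeedGraph S Λ N) : wedgesCreation G [] = 1 := rfl

theorem wedgesAnnihilation_cons (G : SeedGraph S Λ N) (w : S × S) (W : List (S × S)) :
    wedgesAnnihilation G (w :: W) = wedgeAnnihilation G w * wedgesAnnihilation G W := by
  simp [wedgesAnnihilation]

theorem wedgesCreation_cons (G : SeedGraph S Λ N) (w : S × S) (W : List (S × S)) :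
    wedgesCreation G (w :: W) = wedgeCreation G w * wedgesCreation G W := by
  simp [wedgesCreation]

theorem wedgeAnnihilation_commute_wedges (G : SeedGraph S Λ N) (w : S × S) (W : List (S × S)) :
    Commute (wedgeAnnihilation G w) (wedgesAnnihilation G W) := by
  induction W with
  | nil => exact Commute.one_right _
  | cons v W ih =>
    rw [wedgesAnnihilation_cons]
    exact (wedgeAnnihilation_commute G w v).mul_right ih

theorem wedgesAnnihilation_perm (G : SeedGraph S Λ N) {V W : List (S × S)} (h : V.Perm W) :
    wedgesAnnihilation G V = wedgesAnnihilation G W := by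
  induction h with
  | nil => rfl
  | cons x _ ih => rw [wedgesAnnihilation_cons, ih, wedgesAnnihilation_cons]
  | swap x y l =>
    simp only [wedgesAnnihilation_cons, ← mul_assoc, (wedgeAnnihilation_commute G y x).eq]
  | trans _ _ ih1 ih2 => rw [ih1, ih2]

theorem tsum_wedgeCreation_mul (G : SeedGraph S Λ N) (w : S × S) {ξ : Amp S}
    (hξ : ξ.support.Finite) (χ : Amp S) :
    ∑' ν, wedgeCreation G w ξ ν * χ ν = ∑' ν, ξ ν * wedgeAnnihilation G w χ ν := by
  have hc := fun k => finite_support_creation (S := S) k hξ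
  have hcc := fun k l => finite_support_creation (S := S) k (hc l)
  have key : ∀ k l, ∑' ν, creation k (creation l ξ) ν * χ ν =
      ∑' ν, ξ ν * annihilation k (annihilation l χ) ν := by
    intro k l
    rw [tsum_creation_mul k (hc l), tsum_creation_mul l hξ]
    have := LinearMap.congr_fun (annihilation_commute l k).eq χ
    simp only [Module.End.mul_apply] at this
    rw [this]
  rw [wedgeCreation_eq, wedgeAnnihilation]
  split_ifs
  · simp only [LinearMap.sub_apply, Module.End.mul_apply, Pi.sub_apply, sub_mul, mul_sub]
    rw [Summable.tsum_sub (summable_mul_of_finite_support (hcc _ _) _)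
      (summable_mul_of_finite_support (hcc _ _) _), key, key,
      Summable.tsum_sub (summable_mul_of_finite_support hξ _)
      (summable_mul_of_finite_support hξ _)]
  · simp

theorem finite_support_wedgesCreation [Fintype S] (G : SeedGraph S Λ N) (W : List (S × S)) :
    (wedgesCreation G W vacuum).support.Finite := by
  induction W with
  | nil =>
    refine (Set.finite_singleton (0 : Occ S)).subset fun ν hν => ?_
    by_contra h
    exact hν (if_neg h)
  | cons w l ih =>
    rw [wedgesCreation_cons, Module.End.mul_apply]
    exact finite_support_wedgeCreation G w ih

/-- Moving the wedge operators one by one across the bilinear pairing leaves the pairing with the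
vacuum. The finite support of created states makes this legitimate for an arbitrary $\chi$. -/
theorem tsum_wedgesCreation_mul [Fintype S] (G : SeedGraph S Λ N) (W : List (S × S))
    (χ : Amp S) :
    ∑' ν, wedgesCreation G W vacuum ν * χ ν = wedgesAnnihilation G W χ 0 := by
  induction W generalizing χ with
  | nil =>
    rw [tsum_eq_single 0]
    · simp [wedgesCreation_nil, wedgesAnnihilation_nil, vacuum]
    · intro ν hν
      simp [wedgesCreation_nil, vacuum, hν]
  | cons w W ih =>
    rw [wedgesCreation_cons, Module.End.mul_apply,
      tsum_wedgeCreation_mul G w (finite_support_wedgesCreation G W), ih, wedgesAnnihilation_cons,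
      (wedgeAnnihilation_commute_wedges G w W).eq, Module.End.mul_apply]

end WedgeAlgebra

/-! ### Invariance at the nodes and the Casimir identity -/

section Invariants

variable {S Λ N : Type*} [Fintype S] [DecidableEq S] [DecidableEq N]

/-- The generators `∑_{i ∈ n} a_i^A† a_i^B` of `U(2)` at a node. -/
def nodeGenerator (G : SeedGraph S Λ N) (n : N) (A B : Fin 2) : Module.End ℂ (Amp S) :=
  ∑ i with G.node i = n, creation (i, A) * annihilation (i, B)

/-- Amplitudes annihilated by all node constraints. -/
def IsInvariant (G : SeedGraph S Λ N) (φ : Amp S) : Prop :=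
  ∀ n, nodeGenerator G n 0 1 φ = 0 ∧ nodeGenerator G n 1 0 φ = 0 ∧
    nodeGenerator G n 0 0 φ = nodeGenerator G n 1 1 φ

theorem nodeConstraint_eq (G : SeedGraph S Λ N) (n : N) (a : Fin 3) :
    nodeConstraint G n a = (1 / 2 : ℂ) • ∑ A : Fin 2, ∑ B : Fin 2,
      pauli a A B • nodeGenerator G n A B := by
  simp only [nodeConstraint, seedJ, nodeGenerator, Finset.smul_sum, Module.End.mul_eq_comp]
  rw [Finset.sum_comm]
  refine Finset.sum_congr rfl fun A _ => ?_
  rw [Finset.sum_comm]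

/-- The combinations $J^1\pm iJ^2$ are the off-diagonal generators, and $J^3$ is half the difference
of the diagonal ones. -/
theorem isInvariant_iff (G : SeedGraph S Λ N) (φ : Amp S) :
    IsInvariant G φ ↔ ∀ n a, nodeConstraint G n a φ = 0 := by
  refine forall_congr' fun n => ?_
  simp only [nodeConstraint_eq, LinearMap.smul_apply, Fin.sum_univ_two, LinearMap.add_apply,
    Fin.forall_fin_succ, pauli]
  simp
  generalize nodeGenerator G n 0 1 φ = x
  generalize nodeGenerator G n 1 0 φ = y
  generalize nodeGenerator G n 0 0 φ = z
  generalize nodeGenerator G n 1 1 φ = w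
  rw [← smul_add, ← smul_neg, ← smul_add, ← smul_neg, ← smul_add,
    neg_add_eq_sub]
  simp only [smul_eq_zero, Complex.I_ne_zero, false_or, sub_eq_zero, ← sub_eq_add_neg,
    inv_eq_zero, OfNat.ofNat_ne_zero]
  constructor
  · rintro ⟨rfl, rfl, rfl⟩
    simp
  · rintro ⟨h1, h2, h3⟩
    subst h2
    have : (2 : ℂ) • y = 0 := by rw [two_smul]; exact h1
    have hy : y = 0 := (smul_eq_zero.mp this).resolve_left two_ne_zero
    exact ⟨hy, hy, smul_right_injective _ (inv_ne_zero two_ne_zero) h3⟩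

/-- The number of quanta at a node. -/
def nodeNumber (G : SeedGraph S Λ N) (n : N) (ν : Occ S) : ℕ :=
  ∑ i with G.node i = n, (ν (i, 0) + ν (i, 1))

theorem nodeGenerator_diag_apply (G : SeedGraph S Λ N) (n : N) (A : Fin 2) (φ : Amp S)
    (ν : Occ S) :
    nodeGenerator G n A A φ ν = (∑ i with G.node i = n, ν (i, A) : ℕ) * φ ν := by
  simp only [nodeGenerator, LinearMap.sum_apply, Finset.sum_apply,
    creation_mul_annihilation_apply]
  rw [← Finset.sum_mul]
  push_cast
  rfl

/-- Contracting the two $\epsilon$ tensors of $F_{ij}^\dagger F_{ij}$ leaves products of two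
generators; the last bracket is the normal ordering correction from the terms $i=j$. -/
theorem sum_wedgeCreation_mul_wedgeAnnihilation (G : SeedGraph S Λ N) (n : N) :
    ∑ i with G.node i = n, ∑ j with G.node j = n,
      wedgeCreation G (i, j) * wedgeAnnihilation G (i, j) =
    nodeGenerator G n 0 0 * nodeGenerator G n 1 1 + nodeGenerator G n 1 1 * nodeGenerator G n 0 0
      - nodeGenerator G n 0 1 * nodeGenerator G n 1 0
      - nodeGenerator G n 1 0 * nodeGenerator G n 0 1
      + (nodeGenerator G n 0 0 + nodeGenerator G n 1 1) := by
  have hδ : ∀ A B, nodeGenerator G n A B = ∑ i with G.node i = n, ∑ j with G.node j = n,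
      (if i = j then creation (i, A) * annihilation (j, B) else 0 : Module.End ℂ (Amp S)) := by
    intro A B
    refine Finset.sum_congr rfl fun i hi => ?_
    rw [Finset.sum_ite_eq, if_pos hi]
  have hprod : ∀ A B C D, nodeGenerator G n A B * nodeGenerator G n C D =
      ∑ i with G.node i = n, ∑ j with G.node j = n,
      ((creation (i, A) * annihilation (i, B)) * (creation (j, C) * annihilation (j, D)) :
        Module.End ℂ (Amp S)) := by
    intro A B C D
    rw [nodeGenerator, nodeGenerator, Finset.sum_mul_sum]
  rw [hprod, hprod, hprod, hprod, hδ 0 0, hδ 1 1]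
  simp only [← Finset.sum_add_distrib, ← Finset.sum_sub_distrib]
  refine Finset.sum_congr rfl fun i hi => Finset.sum_congr rfl fun j hj => ?_
  simp only [Finset.mem_filter, Finset.mem_univ, true_and] at hi hj
  rw [wedgeCreation_eq, wedgeAnnihilation, if_pos (by simp [hi, hj]), if_pos (by simp [hi, hj])]
  -- Normal ordering a product of two bilinears costs one commutator, present only when the inner
  -- operators belong to the same oscillator.
  have key : ∀ A B C D : Fin 2, ((creation (i, A) * annihilation (i, B)) *
      (creation (j, C) * annihilation (j, D)) : Module.End ℂ (Amp S)) =
      creation (i, A) * creation (j, C) * (annihilation (i, B) * annihilation (j, D)) +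
      if i = j ∧ B = C then creation (i, A) * annihilation (j, D) else 0 := by
    intro A B C D
    rw [mul_assoc, ← mul_assoc (annihilation _), annihilation_mul_creation]
    simp only [Prod.mk.injEq]
    split_ifs <;> simp [mul_add, add_mul, mul_assoc]
  rw [key, key, key, key]
  by_cases h : i = j
  · subst h
    simp [sub_mul, mul_sub]
    abel
  · simp [h, sub_mul, mul_sub]
    abel

/-- The off-diagonal generators annihilate $\varphi$. Where $\varphi$ does not vanish, the two
diagonal ones agree and so each has the value $N_n/2$, giving $2(N_n/2)^2+N_n$. -/
theorem sum_wedge_apply (G : SeedGraph S Λ N) (n : N) {φ : Amp S} (hφ : IsInvariant G φ)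
    (ν : Occ S) :
    ∑ i with G.node i = n, ∑ j with G.node j = n,
      wedgeCreation G (i, j) (wedgeAnnihilation G (i, j) φ) ν =
    (nodeNumber G n ν : ℂ) * ((nodeNumber G n ν : ℂ) / 2 + 1) * φ ν := by
  have h := congrFun (LinearMap.congr_fun (sum_wedgeCreation_mul_wedgeAnnihilation G n) φ) ν
  obtain ⟨h01, h10, hd⟩ := hφ n
  simp only [LinearMap.sum_apply, Finset.sum_apply, Module.End.mul_apply, LinearMap.add_apply,
    LinearMap.sub_apply, h01, h10, map_zero, sub_zero, Pi.add_apply] at h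
  rw [h]
  have hd' := congrFun hd ν
  simp only [nodeGenerator_diag_apply] at hd' ⊢
  have hN : (nodeNumber G n ν : ℂ) = (∑ i with G.node i = n, ν (i, 0) : ℕ) +
      (∑ i with G.node i = n, ν (i, 1) : ℕ) := by
    rw [nodeNumber, Finset.sum_add_distrib, Nat.cast_add]
  rw [hN]
  generalize ((∑ i with G.node i = n, ν (i, 0) : ℕ) : ℂ) = x at *
  generalize ((∑ i with G.node i = n, ν (i, 1) : ℕ) : ℂ) = y at *
  rcases eq_or_ne (φ ν) 0 with h0 | h0
  · simp [h0]
  · have : x = y := mul_right_cancel₀ h0 hd'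
    subst this
    ring

theorem nodeGenerator_mul_annihilation (G : SeedGraph S Λ N) (n : N) (A B C : Fin 2) (i : S) :
    nodeGenerator G n A B * annihilation (i, C) = annihilation (i, C) * nodeGenerator G n A B -
      if G.node i = n ∧ A = C then annihilation (i, B) else 0 := by
  have : ∀ j, (creation (j, A) * annihilation (j, B) * annihilation (i, C) :
      Module.End ℂ (Amp S)) = annihilation (i, C) * (creation (j, A) * annihilation (j, B)) -
      if i = j then (if C = A then annihilation (j, B) else 0) else 0 := by
    intro j
    rw [← mul_assoc, annihilation_mul_creation, mul_assoc, (annihilation_commute (j, B) (i, C)).eq]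
    simp only [Prod.mk.injEq]
    by_cases h : i = j <;> by_cases h' : C = A <;> simp [h, h', add_mul, mul_assoc]
  rw [nodeGenerator, Finset.sum_mul, Finset.mul_sum, Finset.sum_congr rfl fun j _ => this j,
    Finset.sum_sub_distrib, Finset.sum_ite_eq]
  simp only [Finset.mem_filter, Finset.mem_univ, true_and, ite_and, eq_comm (a := C)]

theorem nodeGenerator_mul_creation (G : SeedGraph S Λ N) (n : N) (A B C : Fin 2) (i : S) :
    nodeGenerator G n A B * creation (i, C) = creation (i, C) * nodeGenerator G n A B +
      if G.node i = n ∧ B = C then creation (i, A) else 0 := by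
  have : ∀ j, (creation (j, A) * annihilation (j, B) * creation (i, C) :
      Module.End ℂ (Amp S)) = creation (i, C) * (creation (j, A) * annihilation (j, B)) +
      if i = j then (if C = B then creation (j, A) else 0) else 0 := by
    intro j
    rw [mul_assoc, annihilation_mul_creation, mul_add, ← mul_assoc, ← mul_assoc,
      (creation_commute (j, A) (i, C)).eq]
    simp only [Prod.mk.injEq]
    by_cases h : i = j <;> by_cases h' : C = B <;> simp [h, h', eq_comm (a := B), eq_comm (a := j)]
  rw [nodeGenerator, Finset.sum_mul, Finset.mul_sum, Finset.sum_congr rfl fun j _ => this j,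
    Finset.sum_add_distrib, Finset.sum_ite_eq]
  simp only [Finset.mem_filter, Finset.mem_univ, true_and, ite_and, eq_comm (a := C)]

/-- Both seeds lie in one node and $\epsilon$ is an $SL(2)$ invariant, so a wedge transforms by a
character of $U(2)$: only the diagonal generators are shifted, both by the same amount. -/
theorem nodeGenerator_mul_wedgeAnnihilation (G : SeedGraph S Λ N) (n : N) (A B : Fin 2)
    (w : S × S) :
    nodeGenerator G n A B * wedgeAnnihilation G w = wedgeAnnihilation G w * nodeGenerator G n A B -
      if A = B ∧ G.node w.1 = n then wedgeAnnihilation G w else 0 := by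
  by_cases hw : G.node w.1 = G.node w.2
  · have key : ∀ C D, nodeGenerator G n A B * (annihilation (w.1, C) * annihilation (w.2, D)) =
        annihilation (w.1, C) * annihilation (w.2, D) * nodeGenerator G n A B
        - (if G.node w.1 = n ∧ A = C then annihilation (w.1, B) * annihilation (w.2, D) else 0)
        - (if G.node w.1 = n ∧ A = D then annihilation (w.1, C) * annihilation (w.2, B) else 0) := by
      intro C D
      rw [← mul_assoc, nodeGenerator_mul_annihilation, sub_mul, mul_assoc,
        nodeGenerator_mul_annihilation, ← hw]
      split_ifs <;> simp only [mul_sub, zero_mul, mul_zero, mul_assoc, sub_zero] <;> abel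
    rw [wedgeAnnihilation, if_pos hw, mul_sub, key, key]
    by_cases hn : G.node w.1 = n <;> fin_cases A <;> fin_cases B <;> simp [hn, sub_mul] <;> abel
  · simp [wedgeAnnihilation, hw]

theorem nodeGenerator_mul_wedgeCreation (G : SeedGraph S Λ N) (n : N) (A B : Fin 2)
    (w : S × S) :
    nodeGenerator G n A B * wedgeCreation G w = wedgeCreation G w * nodeGenerator G n A B +
      if A = B ∧ G.node w.1 = n then wedgeCreation G w else 0 := by
  by_cases hw : G.node w.1 = G.node w.2
  · have key : ∀ C D, nodeGenerator G n A B * (creation (w.1, C) * creation (w.2, D)) =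
        creation (w.1, C) * creation (w.2, D) * nodeGenerator G n A B
        + (if G.node w.1 = n ∧ B = C then creation (w.1, A) * creation (w.2, D) else 0)
        + (if G.node w.1 = n ∧ B = D then creation (w.1, C) * creation (w.2, A) else 0) := by
      intro C D
      rw [← mul_assoc, nodeGenerator_mul_creation, add_mul, mul_assoc,
        nodeGenerator_mul_creation, ← hw]
      split_ifs <;> simp only [mul_add, zero_mul, mul_zero, mul_assoc, add_zero] <;> abel
    rw [wedgeCreation_eq, if_pos hw, mul_sub, key, key]
    by_cases hn : G.node w.1 = n <;> fin_cases A <;> fin_cases B <;> simp [hn, sub_mul] <;> abel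
  · simp [wedgeCreation_eq, hw]

/-- Invariance involves only the difference of the diagonal generators, so a common shift $c_n$ of
the two is invisible. -/
theorem IsInvariant.of_mul {G : SeedGraph S Λ N} {T : Module.End ℂ (Amp S)} {φ : Amp S}
    (c : N → Module.End ℂ (Amp S))
    (hT : ∀ n A B, nodeGenerator G n A B * T =
      T * nodeGenerator G n A B + if A = B then c n else 0)
    (hφ : IsInvariant G φ) : IsInvariant G (T φ) := by
  have h := fun n A B => LinearMap.congr_fun (hT n A B) φ
  simp only [Module.End.mul_apply, LinearMap.add_apply] at h
  intro n
  obtain ⟨h1, h2, h3⟩ := hφ n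
  refine ⟨?_, ?_, ?_⟩
  · simp [h, h1]
  · simp [h, h2]
  · simp [h, h3]

theorem IsInvariant.wedgeAnnihilation {G : SeedGraph S Λ N} {φ : Amp S} (hφ : IsInvariant G φ)
    (w : S × S) : IsInvariant G (wedgeAnnihilation G w φ) := by
  refine hφ.of_mul (fun n => if G.node w.1 = n then -LoopExpansion.wedgeAnnihilation G w else 0)
    fun n A B => ?_
  rw [nodeGenerator_mul_wedgeAnnihilation]
  by_cases h : A = B <;> by_cases h' : G.node w.1 = n <;> simp [h, h', sub_eq_add_neg]

theorem IsInvariant.wedgeCreation {G : SeedGraph S Λ N} {φ : Amp S} (hφ : IsInvariant G φ)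
    (w : S × S) : IsInvariant G (wedgeCreation G w φ) := by
  refine hφ.of_mul (fun n => if G.node w.1 = n then LoopExpansion.wedgeCreation G w else 0)
    fun n A B => ?_
  rw [nodeGenerator_mul_wedgeCreation]
  by_cases h : A = B <;> by_cases h' : G.node w.1 = n <;> simp [h, h']

theorem annihilation_vacuum (k : S × Fin 2) : annihilation k (vacuum : Amp S) = 0 := by
  funext ν
  have : ν + Pi.single k 1 ≠ 0 := fun h => by simpa using congrFun h k
  simp [annihilation_apply, vacuum, this]

theorem isInvariant_wedgesCreation (G : SeedGraph S Λ N) (W : List (S × S)) :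
    IsInvariant G (wedgesCreation G W vacuum) := by
  induction W with
  | nil =>
    intro n
    simp [wedgesCreation_nil, nodeGenerator, annihilation_vacuum]
  | cons w W ih =>
    rw [wedgesCreation_cons, Module.End.mul_apply]
    exact ih.wedgeCreation w

end Invariants

/-! ### Sums over lists of fixed length -/

section SumLists

variable {α M : Type*} [Fintype α] [AddCommMonoid M]

/-- The sum of `h` over all lists of length `n`. -/
def sumLists : ℕ → (List α → M) → M
  | 0, h => h []
  | n + 1, h => ∑ a, sumLists n fun l => h (a :: l)

theorem sumLists_zero (h : List α → M) : sumLists 0 h = h [] := rfl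

theorem sumLists_succ (n : ℕ) (h : List α → M) :
    sumLists (n + 1) h = ∑ a, sumLists n fun l => h (a :: l) := rfl

theorem sumLists_congr {n : ℕ} {h h' : List α → M} (hh : ∀ l, l.length = n → h l = h' l) :
    sumLists n h = sumLists n h' := by
  induction n generalizing h h' with
  | zero => exact hh [] rfl
  | succ n ih =>
    exact Finset.sum_congr rfl fun a _ => ih fun l hl => hh _ (by simp [hl])

theorem sumLists_add (n : ℕ) (h h' : List α → M) :
    sumLists n (fun l => h l + h' l) = sumLists n h + sumLists n h' := by
  induction n generalizing h h' with
  | zero => rfl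
  | succ n ih => simp only [sumLists_succ, ih, Finset.sum_add_distrib]

theorem map_sumLists {M' F : Type*} [AddCommMonoid M'] [FunLike F M M'] [AddMonoidHomClass F M M']
    (f : F) (n : ℕ) (h : List α → M) :
    f (sumLists n h) = sumLists n fun l => f (h l) := by
  induction n generalizing h with
  | zero => rfl
  | succ n ih => simp only [sumLists_succ, map_sum, ih]

theorem sumLists_sum {ι : Type*} (s : Finset ι) (n : ℕ) (h : ι → List α → M) :
    sumLists n (fun l => ∑ i ∈ s, h i l) = ∑ i ∈ s, sumLists n (h i) := by
  induction n generalizing h with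
  | zero => rfl
  | succ n ih => simp only [sumLists_succ, ih]; exact Finset.sum_comm

theorem mul_sumLists {R : Type*} [NonUnitalNonAssocSemiring R] (c : R) (n : ℕ) (h : List α → R) :
    c * sumLists n h = sumLists n fun l => c * h l :=
  map_sumLists (AddMonoidHom.mulLeft c) n h

theorem sumLists_apply {ι : Type*} (n : ℕ) (h : List α → ι → M) (i : ι) :
    sumLists n h i = sumLists n fun l => h l i :=
  map_sumLists (Pi.evalAddMonoidHom (fun _ : ι => M) i) n h

end SumLists

/-! ### Degrees of wedge collections and the wedge expansion of invariants -/

section Degrees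

variable {S Λ N : Type*} [DecidableEq S] [DecidableEq N]

/-- The number of ends of wedges sitting at each seed. -/
def seedDegree (W : Multiset (S × S)) : S → ℕ :=
  (W.map fun w => Pi.single w.1 1 + Pi.single w.2 1).sum

theorem seedDegree_cons (w : S × S) (W : Multiset (S × S)) :
    seedDegree (w ::ₘ W) = Pi.single w.1 1 + Pi.single w.2 1 + seedDegree W := by
  simp [seedDegree]

theorem seedDegree_zero : seedDegree (0 : Multiset (S × S)) = 0 := rfl

/-- The number of wedges at a node. -/
def nodeWedgeCount (G : SeedGraph S Λ N) (W : Multiset (S × S)) (n : N) : ℕ :=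
  (W.map fun w => G.node w.1).count n

theorem nodeWedgeCount_cons (G : SeedGraph S Λ N) (w : S × S) (W : Multiset (S × S)) (n : N) :
    nodeWedgeCount G (w ::ₘ W) n = nodeWedgeCount G W n + if n = G.node w.1 then 1 else 0 := by
  simp [nodeWedgeCount, Multiset.count_cons]

theorem exists_of_creation_ne_zero {k : S × Fin 2} {ξ : Amp S} {ν : Occ S}
    (h : creation k ξ ν ≠ 0) : ∃ ν', ξ ν' ≠ 0 ∧ ν = ν' + Pi.single k 1 := by
  rw [creation_apply] at h
  refine ⟨ν - Pi.single k 1, right_ne_zero_of_mul h, (sub_single_add_single ν k ?_).symm⟩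
  intro h0
  simp [h0] at h

theorem exists_of_wedgeCreation_ne_zero {G : SeedGraph S Λ N} {w : S × S} {ξ : Amp S} {ν : Occ S}
    (h : wedgeCreation G w ξ ν ≠ 0) : G.node w.1 = G.node w.2 ∧ ∃ A B ν', ξ ν' ≠ 0 ∧
      ν = ν' + Pi.single (w.2, B) 1 + Pi.single (w.1, A) 1 := by
  rw [wedgeCreation_eq] at h
  split_ifs at h with hw
  · refine ⟨hw, ?_⟩
    have : creation (w.1, 0) (creation (w.2, 1) ξ) ν ≠ 0 ∨
        creation (w.1, 1) (creation (w.2, 0) ξ) ν ≠ 0 := by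
      by_contra hc
      push Not at hc
      exact h (by simp [hc.1, hc.2])
    rcases this with h | h
    · obtain ⟨ν1, h1, rfl⟩ := exists_of_creation_ne_zero h
      obtain ⟨ν2, h2, rfl⟩ := exists_of_creation_ne_zero h1
      exact ⟨0, 1, ν2, h2, rfl⟩
    · obtain ⟨ν1, h1, rfl⟩ := exists_of_creation_ne_zero h
      obtain ⟨ν2, h2, rfl⟩ := exists_of_creation_ne_zero h1
      exact ⟨1, 0, ν2, h2, rfl⟩
  · simp at h

theorem occ_add_single (ν : Occ S) (i j : S) (A : Fin 2) :
    (ν + Pi.single (i, A) 1 : Occ S) (j, 0) + (ν + Pi.single (i, A) 1 : Occ S) (j, 1) =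
      ν (j, 0) + ν (j, 1) + if i = j then 1 else 0 := by
  simp only [Pi.add_apply, Pi.single_apply, Prod.mk.injEq, eq_comm (a := j)]
  by_cases h : i = j
  · fin_cases A <;> simp [h] <;> omega
  · simp [h]

variable [Fintype S]

theorem seedDegree_of_wedgesCreation_ne_zero {G : SeedGraph S Λ N} {W : List (S × S)} {ν : Occ S}
    (h : wedgesCreation G W vacuum ν ≠ 0) (i : S) : ν (i, 0) + ν (i, 1) = seedDegree W i := by
  induction W generalizing ν with
  | nil =>
    have : ν = 0 := by
      by_contra h0
      exact h (if_neg h0)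
    simp [this, seedDegree_zero]
  | cons w W ih =>
    rw [wedgesCreation_cons, Module.End.mul_apply] at h
    obtain ⟨-, A, B, ν', h', rfl⟩ := exists_of_wedgeCreation_ne_zero h
    rw [occ_add_single, occ_add_single, ih h', ← Multiset.cons_coe, seedDegree_cons]
    simp only [Pi.add_apply, Pi.single_apply, eq_comm (a := i)]
    ring

theorem nodeNumber_add_single (G : SeedGraph S Λ N) (n : N) (ν : Occ S) (i : S) (A : Fin 2) :
    nodeNumber G n (ν + Pi.single (i, A) 1) = nodeNumber G n ν + if n = G.node i then 1 else 0 := by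
  simp only [nodeNumber, occ_add_single]
  rw [Finset.sum_add_distrib, Finset.sum_ite_eq]
  simp [eq_comm]

theorem nodeNumber_of_wedgesCreation_ne_zero {G : SeedGraph S Λ N} {W : List (S × S)} {ν : Occ S}
    (h : wedgesCreation G W vacuum ν ≠ 0) (n : N) :
    nodeNumber G n ν = 2 * nodeWedgeCount G W n := by
  induction W generalizing ν with
  | nil =>
    have : ν = 0 := by
      by_contra h0
      exact h (if_neg h0)
    simp [this, nodeNumber, nodeWedgeCount]
  | cons w W ih =>
    rw [wedgesCreation_cons, Module.End.mul_apply] at h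
    obtain ⟨hw, A, B, ν', h', rfl⟩ := exists_of_wedgeCreation_ne_zero h
    rw [nodeNumber_add_single, nodeNumber_add_single, ih h', ← Multiset.cons_coe,
      nodeWedgeCount_cons, ← hw]
    ring

theorem sum_nodeNumber [Fintype N] (G : SeedGraph S Λ N) (ν : Occ S) :
    ∑ n, nodeNumber G n ν = ∑ k, ν k := by
  simp only [nodeNumber]
  rw [Finset.sum_fiberwise_of_maps_to (fun _ _ => Finset.mem_univ _), Fintype.sum_prod_type]
  simp

/-- Only the node of $w$ changes its count, and $(J_n+1)!$ gains the factor $J_n+1$. This is the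
Casimir factor $N_n/2+1$, so iterating the Casimir identity builds up the factorials. -/
theorem prod_factorial_nodeWedgeCount_cons [Fintype N] (G : SeedGraph S Λ N) (w : S × S)
    (W : Multiset (S × S)) :
    ∏ n, ((nodeWedgeCount G (w ::ₘ W) n + 1).factorial : ℂ) =
      (nodeWedgeCount G (w ::ₘ W) (G.node w.1) + 1) *
        ∏ n, ((nodeWedgeCount G W n + 1).factorial : ℂ) := by
  have : ∀ n, ((nodeWedgeCount G (w ::ₘ W) n + 1).factorial : ℂ) =
      (if n = G.node w.1 then (nodeWedgeCount G (w ::ₘ W) (G.node w.1) + 1 : ℂ) else 1) *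
        ((nodeWedgeCount G W n + 1).factorial : ℂ) := by
    intro n
    rw [nodeWedgeCount_cons, nodeWedgeCount_cons]
    split_ifs with h
    · subst h
      rw [Nat.factorial_succ]
      push_cast
      ring
    · simp at *
    · simp
  simp only [this, Finset.prod_mul_distrib, Finset.prod_ite_eq', Finset.mem_univ, if_true]

/-- A wedge creates exactly two quanta. Hence an identity known at one level only, such as an
induction hypothesis, may be used under $F_w^\dagger$. -/
theorem wedgeCreation_congr (G : SeedGraph S Λ N) (w : S × S) {m : ℕ} {ξ ξ' : Amp S}
    (h : ∀ ν : Occ S, ∑ k, ν k = m → ξ ν = ξ' ν) {ν : Occ S} (hν : ∑ k, ν k = m + 2) :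
    wedgeCreation G w ξ ν = wedgeCreation G w ξ' ν := by
  by_contra hc
  have : wedgeCreation G w (ξ - ξ') ν ≠ 0 := by
    rw [map_sub]
    exact sub_ne_zero.mpr hc
  obtain ⟨-, A, B, ν', h', rfl⟩ := exists_of_wedgeCreation_ne_zero this
  refine h' (sub_eq_zero.mpr (h ν' ?_))
  simp only [Pi.add_apply, Finset.sum_add_distrib] at hν
  simp at hν
  omega

/-- The expansion of an invariant amplitude in products of wedge creation operators. -/
theorem eq_sumLists_of_isInvariant [Fintype N] {G : SeedGraph S Λ N} (M : ℕ) {φ : Amp S}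
    (hφ : IsInvariant G φ) {ν : Occ S} (hν : ∑ k, ν k = 2 * M) :
    φ ν = ((2 ^ M * M.factorial : ℂ)⁻¹ • sumLists M fun W =>
      (wedgesAnnihilation G W φ 0 / ∏ n, ((nodeWedgeCount G W n + 1).factorial : ℂ)) •
        wedgesCreation G W vacuum) ν := by
  induction M generalizing φ ν with
  | zero =>
    have : ν = 0 := by
      funext k
      exact (Finset.sum_eq_zero_iff.mp hν) k (Finset.mem_univ k)
    subst this
    simp [sumLists_zero, wedgesAnnihilation_nil, wedgesCreation_nil, vacuum, nodeWedgeCount]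
  | succ M ih =>
    -- The total number $2(M+1)$ is split into the node numbers $N_n$, and each $N_n\varphi$ is
    -- rewritten by the Casimir identity divided by $N_n/2+1$. Pairs across two nodes may be added,
    -- as their wedge operators vanish.
    have h1 : (2 * (M + 1) : ℂ) * φ ν = ∑ w : S × S,
        ((nodeNumber G (G.node w.1) ν : ℂ) / 2 + 1)⁻¹ *
          wedgeCreation G w (wedgeAnnihilation G w φ) ν := by
      have hs : (2 * (M + 1) : ℂ) = ∑ n, (nodeNumber G n ν : ℂ) := by
        rw [← Nat.cast_sum, sum_nodeNumber, hν]; push_cast; ring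
      rw [hs, Finset.sum_mul, Fintype.sum_prod_type,
        ← Finset.sum_fiberwise_of_maps_to (fun _ _ => Finset.mem_univ _) (g := G.node)]
      refine Finset.sum_congr rfl fun n _ => ?_
      have hne : ((nodeNumber G n ν : ℂ) / 2 + 1) ≠ 0 := by
        have : ((nodeNumber G n ν + 2 : ℕ) : ℂ) ≠ 0 := Nat.cast_ne_zero.mpr (by omega)
        intro h0
        apply this
        push_cast
        linear_combination 2 * h0
      have h2 := sum_wedge_apply G n hφ ν
      have h3 : (nodeNumber G n ν : ℂ) * φ ν = ((nodeNumber G n ν : ℂ) / 2 + 1)⁻¹ *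
          ∑ i with G.node i = n, ∑ j with G.node j = n,
          wedgeCreation G (i, j) (wedgeAnnihilation G (i, j) φ) ν := by
        rw [h2, eq_inv_mul_iff_mul_eq₀ hne]; ring
      rw [h3, Finset.mul_sum]
      refine Finset.sum_congr rfl fun i hi => ?_
      simp only [Finset.mem_filter, Finset.mem_univ, true_and] at hi
      rw [Finset.mul_sum, Finset.sum_filter]
      refine Finset.sum_congr rfl fun j _ => ?_
      rw [hi]
      split_ifs with hj
      · rfl
      · rw [wedgeCreation_eq, if_neg (fun h => hj (by rw [← hi]; exact h.symm))]
        simp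
    have h4 : ∀ w : S × S, ((nodeNumber G (G.node w.1) ν : ℂ) / 2 + 1)⁻¹ *
          wedgeCreation G w (wedgeAnnihilation G w φ) ν =
        (2 ^ M * M.factorial : ℂ)⁻¹ * sumLists M fun W =>
          (wedgesAnnihilation G (w :: W) φ 0 /
            ∏ n, ((nodeWedgeCount G ↑(w :: W) n + 1).factorial : ℂ)) *
            wedgesCreation G (w :: W) vacuum ν := by
      intro w
      -- The induction hypothesis is applied to $F_w\varphi$, which is again invariant, at the level
      -- two quanta lower.
      rw [wedgeCreation_congr G w (fun ν' hν' => ih (hφ.wedgeAnnihilation w) hν')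
        (by rw [hν]; ring), map_smul, map_sumLists, Pi.smul_apply, smul_eq_mul, mul_left_comm,
        sumLists_apply, mul_sumLists]
      congr 1
      refine sumLists_congr fun W _ => ?_
      rw [map_smul, Pi.smul_apply, smul_eq_mul, ← Module.End.mul_apply (wedgesAnnihilation G W),
        ← (wedgeAnnihilation_commute_wedges G w W).eq, ← wedgesAnnihilation_cons,
        ← Module.End.mul_apply (wedgeCreation G w), ← wedgesCreation_cons]
      -- On the support of the created state $N_n$ is twice the number of wedges at $n$, so the
      -- prefactor depends on the wedges alone.
      rcases eq_or_ne (wedgesCreation G (w :: W) vacuum ν) 0 with h0 | h0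
      · simp [h0]
      · rw [nodeNumber_of_wedgesCreation_ne_zero h0, ← Multiset.cons_coe,
          prod_factorial_nodeWedgeCount_cons]
        push_cast
        rw [mul_div_cancel_left₀ _ (two_ne_zero' ℂ)]
        simp only [div_eq_mul_inv, mul_inv]
        ring
    have h5 : (2 * (M + 1) : ℂ) ≠ 0 := mul_ne_zero two_ne_zero (Nat.cast_add_one_ne_zero M)
    apply mul_left_cancel₀ h5
    rw [h1, Finset.sum_congr rfl fun w _ => h4 w, ← Finset.mul_sum, Pi.smul_apply, smul_eq_mul,
      sumLists_succ, Finset.sum_apply, Nat.factorial_succ, pow_succ, ← mul_assoc]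
    congr 1
    · push_cast
      have : (M.factorial : ℂ) ≠ 0 := Nat.cast_ne_zero.mpr M.factorial_ne_zero
      have := Nat.cast_add_one_ne_zero M (R := ℂ)
      field_simp
    · refine Finset.sum_congr rfl fun w _ => ?_
      rw [sumLists_apply]
      rfl

end Degrees

/-- Each of the $n+1$ positions of the list contributes equally, since $g$ does not see the order;
the marked letter may be moved to the front. -/
theorem sumLists_sum_map_mul {α : Type*} [Fintype α] (n : ℕ) (κ : α → ℂ) (g : Multiset α → ℂ) :
    sumLists (n + 1) (fun l : List α => (l.map κ).sum * g l) =
      (n + 1) * ∑ a, κ a * sumLists n fun l : List α => g (a ::ₘ l) := by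
  induction n generalizing g with
  | zero => simp [sumLists_succ, sumLists_zero]
  | succ n ih =>
    rw [sumLists_succ]
    have : ∀ a, sumLists (n + 1) (fun l : List α => ((a :: l).map κ).sum * g ↑(a :: l)) =
        κ a * sumLists (n + 1) (fun l : List α => g (a ::ₘ l)) +
          (n + 1) * ∑ b, κ b * sumLists n fun l : List α => g (a ::ₘ b ::ₘ l) := by
      intro a
      rw [← ih fun W => g (a ::ₘ W), mul_sumLists, ← sumLists_add]
      refine sumLists_congr fun l _ => ?_
      simp [add_mul]
    rw [Finset.sum_congr rfl fun a _ => this a, Finset.sum_add_distrib, ← Finset.mul_sum,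
      Finset.sum_comm]
    have h2 : ∀ b, ∑ a, κ b * sumLists n (fun l : List α => g (a ::ₘ b ::ₘ l)) =
        κ b * sumLists (n + 1) fun l : List α => g (b ::ₘ l) := by
      intro b
      rw [sumLists_succ, Finset.mul_sum]
      refine Finset.sum_congr rfl fun a _ => ?_
      simp only [← Multiset.cons_coe, Multiset.cons_swap a b]
    rw [Finset.sum_congr rfl fun b _ => h2 b]
    push_cast
    ring

/-! ### Counting strandings, and the recursion obtained by following a strand -/

section Strands

variable {S Λ N : Type*}

theorem SeedGraph.finish_injective (G : SeedGraph S Λ N) : Function.Injective G.finish := by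
  have h := G.bijective_ends.1
  rintro ⟨ℓ, b⟩ ⟨m, c⟩ hx
  cases b <;> cases c <;> simp only [SeedGraph.finish, Bool.false_eq_true, if_false, if_true] at hx
  · exact Prod.ext (Sum.inl_injective (h (a₁ := Sum.inl ℓ) (a₂ := Sum.inl m) hx)) rfl
  · exact absurd (h (a₁ := Sum.inl ℓ) (a₂ := Sum.inr m) hx) (by simp)
  · exact absurd (h (a₁ := Sum.inr ℓ) (a₂ := Sum.inl m) hx) (by simp)
  · exact Prod.ext (Sum.inr_injective (h (a₁ := Sum.inr ℓ) (a₂ := Sum.inr m) hx)) rfl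

theorem SeedGraph.finish_bijective (G : SeedGraph S Λ N) : Function.Bijective G.finish := by
  refine ⟨G.finish_injective, fun i => ?_⟩
  obtain ⟨ℓ | ℓ, rfl⟩ := G.bijective_ends.2 i
  · exact ⟨(ℓ, false), rfl⟩
  · exact ⟨(ℓ, true), rfl⟩

theorem SeedGraph.start_eq_finish (G : SeedGraph S Λ N) (x : Λ × Bool) :
    G.start x = G.finish (x.1, !x.2) := by
  obtain ⟨ℓ, b⟩ := x
  cases b <;> rfl

theorem SeedGraph.start_bijective (G : SeedGraph S Λ N) : Function.Bijective G.start := by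
  have : G.start = G.finish ∘ fun x => (x.1, !x.2) := funext G.start_eq_finish
  rw [this]
  refine G.finish_bijective.comp (Function.Involutive.bijective fun x => ?_)
  simp

theorem SeedGraph.source_injective (G : SeedGraph S Λ N) : Function.Injective G.source :=
  fun _ _ h => Sum.inl_injective (G.bijective_ends.1 h)

theorem SeedGraph.target_injective (G : SeedGraph S Λ N) : Function.Injective G.target :=
  fun _ _ h => Sum.inr_injective (G.bijective_ends.1 h)

theorem SeedGraph.source_ne_target (G : SeedGraph S Λ N) (ℓ m : Λ) :
    G.source ℓ ≠ G.target m :=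
  fun h => Sum.inl_ne_inr (G.bijective_ends.1 (a₁ := Sum.inl ℓ) (a₂ := Sum.inr m) h)

variable [DecidableEq S] [Fintype Λ]

/-- The number of ways of joining the strands of all links, when `δ` is the number of strands at
each seed. -/
def strandingCount (G : SeedGraph S Λ N) (δ : S → ℕ) : ℂ :=
  open Classical in
  if ∀ ℓ, δ (G.source ℓ) = δ (G.target ℓ) then ∏ ℓ, ((δ (G.source ℓ)).factorial : ℂ) else 0

theorem strandingCount_of_balanced (G : SeedGraph S Λ N) {δ : S → ℕ}
    (h : ∀ ℓ, δ (G.source ℓ) = δ (G.target ℓ)) :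
    strandingCount G δ = ∏ ℓ, ((δ (G.source ℓ)).factorial : ℂ) := if_pos h

theorem strandingCount_of_not_balanced (G : SeedGraph S Λ N) {δ : S → ℕ}
    (h : ¬ ∀ ℓ, δ (G.source ℓ) = δ (G.target ℓ)) : strandingCount G δ = 0 := if_neg h

theorem SeedGraph.single_start_add_single_finish (G : SeedGraph S Λ N) (x : Λ × Bool) :
    (Pi.single (G.start x) 1 + Pi.single (G.finish x) 1 : S → ℕ) =
      Pi.single (G.source x.1) 1 + Pi.single (G.target x.1) 1 := by
  obtain ⟨ℓ, b⟩ := x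
  cases b
  · exact add_comm _ _
  · rfl

/-- A new strand on a link with $k$ strands turns $k!$ into $(k+1)!$: its end can be joined to $k+1$
partners. Balance of the links is unaffected. -/
theorem strandingCount_add (G : SeedGraph S Λ N) (δ : S → ℕ) (x : Λ × Bool) :
    strandingCount G (δ + (Pi.single (G.start x) 1 + Pi.single (G.finish x) 1)) =
      (δ (G.finish x) + 1) * strandingCount G δ := by
  classical
  rw [G.single_start_add_single_finish]
  have hs : ∀ ℓ, (δ + (Pi.single (G.source x.1) 1 + Pi.single (G.target x.1) 1) : S → ℕ) (G.source ℓ) =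
      δ (G.source ℓ) + if ℓ = x.1 then 1 else 0 := by
    intro ℓ
    simp [Pi.single_apply, G.source_injective.eq_iff, G.source_ne_target]
  have ht : ∀ ℓ, (δ + (Pi.single (G.source x.1) 1 + Pi.single (G.target x.1) 1) : S → ℕ) (G.target ℓ) =
      δ (G.target ℓ) + if ℓ = x.1 then 1 else 0 := by
    intro ℓ
    simp [Pi.single_apply, G.target_injective.eq_iff, (G.source_ne_target _ _).symm]
  by_cases h : ∀ ℓ, δ (G.source ℓ) = δ (G.target ℓ)
  · rw [strandingCount_of_balanced G h, strandingCount_of_balanced G fun ℓ => by rw [hs, ht, h]]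
    have hx : δ (G.finish x) = δ (G.source x.1) := by
      obtain ⟨ℓ, b⟩ := x
      cases b
      · rfl
      · exact (h ℓ).symm
    have : ∀ ℓ, (((δ + (Pi.single (G.source x.1) 1 + Pi.single (G.target x.1) 1) : S → ℕ)
        (G.source ℓ)).factorial : ℂ) =
        (if ℓ = x.1 then (δ (G.source x.1) + 1 : ℂ) else 1) * ((δ (G.source ℓ)).factorial : ℂ) := by
      intro ℓ
      rw [hs]
      split_ifs with hl
      · rw [hl, Nat.factorial_succ]; push_cast; rfl
      · simp
    rw [Finset.prod_congr rfl fun ℓ _ => this ℓ, Finset.prod_mul_distrib, Finset.prod_ite_eq',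
      if_pos (Finset.mem_univ _), hx]
  · rw [strandingCount_of_not_balanced G h, strandingCount_of_not_balanced G, mul_zero]
    intro h'
    refine h fun ℓ => ?_
    have := h' ℓ
    rw [hs, ht] at this
    omega

/-- A strand entering a link with nothing at its other end cannot be joined. -/
theorem strandingCount_add_start_eq_zero (G : SeedGraph S Λ N) (δ : S → ℕ) (x : Λ × Bool)
    (hx : δ (G.finish x) = 0) : strandingCount G (δ + Pi.single (G.start x) 1) = 0 := by
  refine strandingCount_of_not_balanced G fun h => ?_
  obtain ⟨ℓ, b⟩ := x
  have := h ℓ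
  cases b
  · simp only [SeedGraph.finish, SeedGraph.start, Bool.false_eq_true, if_false] at hx this
    simp [Pi.single_apply, G.source_ne_target, hx] at this
  · simp only [SeedGraph.finish, SeedGraph.start, if_true] at hx this
    simp [Pi.single_apply, (G.source_ne_target _ _).symm, hx] at this

/-- Functions of a multiset of wedges that do not see the orientations of the wedges. -/
def FlipInvariant (g : Multiset (S × S) → ℂ) : Prop :=
  ∀ i j W, g ((i, j) ::ₘ W) = g ((j, i) ::ₘ W)

omit [DecidableEq S] in
theorem FlipInvariant.add_left {g : Multiset (S × S) → ℂ} (hg : FlipInvariant g)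
    (V : Multiset (S × S)) : FlipInvariant fun W => g (V + W) := by
  intro i j W
  simp only [Multiset.add_cons]
  exact hg i j _

variable [Fintype S]

/-- The sum of `g` over sequences of wedges weighted by the number of their strandings. -/
def wedgeSum (G : SeedGraph S Λ N) (n : ℕ) (g : Multiset (S × S) → ℂ) : ℂ :=
  (2 ^ n * n.factorial : ℂ)⁻¹ *
    sumLists n fun W : List (S × S) => strandingCount G (seedDegree W) * g W

/-- The analogue of `wedgeSum` with two additional strands ending at `i` and `j`. -/
def openWedgeSum (G : SeedGraph S Λ N) (i j : S) (n : ℕ) (g : Multiset (S × S) → ℂ) : ℂ :=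
  (2 ^ n * n.factorial : ℂ)⁻¹ * sumLists n fun W : List (S × S) =>
    strandingCount G (Pi.single i 1 + Pi.single j 1 + seedDegree W) * g W

/-- The first wedge of the sequence is singled out and its two ends are kept as open strands; the
prefactor is the ratio of the two normalizations. -/
theorem two_mul_wedgeSum_succ (G : SeedGraph S Λ N) (n : ℕ) (g : Multiset (S × S) → ℂ) :
    (2 * (n + 1)) * wedgeSum G (n + 1) g =
      ∑ i, ∑ j, openWedgeSum G i j n fun W => g ((i, j) ::ₘ W) := by
  simp only [wedgeSum, openWedgeSum, ← Finset.mul_sum]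
  rw [sumLists_succ, Fintype.sum_prod_type, Nat.factorial_succ, pow_succ, ← mul_assoc]
  congr 1
  push_cast
  have : (n.factorial : ℂ) ≠ 0 := Nat.cast_ne_zero.mpr n.factorial_ne_zero
  have := Nat.cast_add_one_ne_zero n (R := ℂ)
  field_simp

/-- Follow the strand that ends at the start of `y` through its link. -/
theorem strandingCount_open (G : SeedGraph S Λ N) (i : S) (y : Λ × Bool) (W : Multiset (S × S)) :
    strandingCount G (Pi.single i 1 + Pi.single (G.start y) 1 + seedDegree W) =
      ((if i = G.finish y then 1 else 0) +
        (W.map fun w => (if w.1 = G.finish y then 1 else 0) +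
          (if w.2 = G.finish y then 1 else 0 : ℂ)).sum) *
      strandingCount G (Pi.single i 1 + seedDegree W - Pi.single (G.finish y) 1) := by
  set δ : S → ℕ := Pi.single i 1 + seedDegree W with hδ
  have hd : (((if i = G.finish y then 1 else 0) +
        (W.map fun w => (if w.1 = G.finish y then 1 else 0) +
          (if w.2 = G.finish y then 1 else 0 : ℂ)).sum)) = δ (G.finish y) := by
    rw [hδ, Pi.add_apply, Pi.single_apply, Nat.cast_add]
    congr 1
    · simp [eq_comm]
    · induction W using Multiset.induction_on with
      | empty => simp [seedDegree_zero]
      | cons w W ih =>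
        rw [Multiset.map_cons, Multiset.sum_cons, ih rfl, seedDegree_cons]
        simp [Pi.single_apply, eq_comm]
  rw [hd, add_right_comm]
  rcases Nat.eq_zero_or_pos (δ (G.finish y)) with h0 | h0
  · rw [strandingCount_add_start_eq_zero G _ _ h0, h0]
    simp
  · have : δ = δ - Pi.single (G.finish y) 1 + Pi.single (G.finish y) 1 := by
      funext k
      by_cases hk : k = G.finish y
      · subst hk
        simp only [Pi.add_apply, Pi.sub_apply, Pi.single_eq_same]
        omega
      · simp [hk]
    have h2 : δ + Pi.single (G.start y) 1 = (δ - Pi.single (G.finish y) 1) +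
        (Pi.single (G.start y) 1 + Pi.single (G.finish y) 1) := by
      conv_lhs => rw [this]
      rw [add_right_comm, add_assoc]
    rw [h2, strandingCount_add]
    congr 1
    simp only [Pi.sub_apply, Pi.single_eq_same]
    rw [Nat.cast_sub h0]
    simp

theorem openWedgeSum_zero (G : SeedGraph S Λ N) (i : S) (y : Λ × Bool)
    (g : Multiset (S × S) → ℂ) :
    openWedgeSum G i (G.start y) 0 g = if i = G.finish y then wedgeSum G 0 g else 0 := by
  simp only [openWedgeSum, wedgeSum, sumLists_zero, Multiset.coe_nil]
  rw [strandingCount_open]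
  split_ifs with h
  · simp [h]
  · simp

/-- A strand entering the link at the start of $y$ leaves at the finish of $y$. It meets there
either the other open end $i$, and closes, or an end of some remaining wedge, whose opposite end $k$
becomes the new open end. -/
theorem openWedgeSum_succ (G : SeedGraph S Λ N) (i : S) (y : Λ × Bool) (n : ℕ)
    {g : Multiset (S × S) → ℂ} (hg : FlipInvariant g) :
    openWedgeSum G i (G.start y) (n + 1) g =
      (if i = G.finish y then wedgeSum G (n + 1) g else 0) +
        ∑ k, openWedgeSum G i k n fun W => g ((G.finish y, k) ::ₘ W) := by
  set τ : Multiset (S × S) → ℂ := fun W =>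
    strandingCount G (Pi.single i 1 + seedDegree W - Pi.single (G.finish y) 1) * g W with hτ
  have hτf : FlipInvariant τ := by
    intro a b W
    simp only [hτ, seedDegree_cons, hg a b, add_comm (Pi.single a 1 : S → ℕ)]
  have h1 : openWedgeSum G i (G.start y) (n + 1) g = (2 ^ (n + 1) * (n + 1).factorial : ℂ)⁻¹ *
      ((if i = G.finish y then 1 else 0) * sumLists (n + 1) (fun W : List (S × S) => τ W) +
        sumLists (n + 1) fun W : List (S × S) => (W.map fun w => (if w.1 = G.finish y then 1 else 0)
          + (if w.2 = G.finish y then 1 else 0 : ℂ)).sum * τ W) := by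
    rw [openWedgeSum, mul_sumLists (_ : ℂ) (n + 1) (fun W : List (S × S) => τ W), ← sumLists_add]
    congr 1
    refine sumLists_congr fun W _ => ?_
    rw [strandingCount_open, ← add_mul, mul_assoc, Multiset.map_coe, Multiset.sum_coe]
  rw [h1, sumLists_sum_map_mul, mul_add]
  congr 1
  · split_ifs with h
    · subst h
      simp only [hτ, wedgeSum, one_mul, add_tsub_cancel_left]
    · simp
  · have h2 : ∑ w : S × S, ((if w.1 = G.finish y then 1 else 0)
          + (if w.2 = G.finish y then 1 else 0 : ℂ)) *
          sumLists n (fun l : List (S × S) => τ (w ::ₘ l)) =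
        2 * ∑ k, sumLists n fun l : List (S × S) => τ ((G.finish y, k) ::ₘ l) := by
      simp only [add_mul, Finset.sum_add_distrib]
      rw [Fintype.sum_prod_type, Fintype.sum_prod_type_right, two_mul]
      congr 1
      · rw [Finset.sum_eq_single (G.finish y)]
        · simp
        · intro b _ hb; simp [hb]
        · simp
      · rw [Finset.sum_eq_single (G.finish y)]
        · simp only [if_true, one_mul]
          exact Finset.sum_congr rfl fun k _ => sumLists_congr fun l _ => hτf _ _ _
        · intro b _ hb; simp [hb]
        · simp
    rw [h2]
    simp only [openWedgeSum, ← Finset.mul_sum]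
    have h3 : ∀ k, sumLists n (fun l : List (S × S) => τ ((G.finish y, k) ::ₘ l)) =
        sumLists n fun W : List (S × S) =>
          strandingCount G (Pi.single i 1 + Pi.single k 1 + seedDegree W) *
            g ((G.finish y, k) ::ₘ W) := by
      intro k
      refine sumLists_congr fun W _ => ?_
      simp only [hτ, seedDegree_cons]
      rw [show (Pi.single i 1 + (Pi.single (G.finish y) 1 + Pi.single k 1 + seedDegree ↑W) -
        Pi.single (G.finish y) 1 : S → ℕ) = Pi.single i 1 + Pi.single k 1 + seedDegree ↑W from
        by
          rw [show (Pi.single i 1 + (Pi.single (G.finish y) 1 + Pi.single k 1 + seedDegree ↑W) :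
            S → ℕ) = Pi.single i 1 + Pi.single k 1 + seedDegree ↑W + Pi.single (G.finish y) 1 by
              abel]
          exact add_tsub_cancel_right _ _]
    rw [Finset.sum_congr rfl fun k _ => h3 k, ← mul_assoc, ← mul_assoc, Nat.factorial_succ,
      pow_succ]
    congr 1
    push_cast
    have : (n.factorial : ℂ) ≠ 0 := Nat.cast_ne_zero.mpr n.factorial_ne_zero
    have := Nat.cast_add_one_ne_zero n (R := ℂ)
    field_simp

omit [DecidableEq S] [Fintype Λ] [Fintype S] in
/-- The wedges along a path of links from `a` to `b`. -/
def SeedGraph.pathWedges (G : SeedGraph S Λ N) (a : S) (l : List (Λ × Bool)) (b : S) :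
    List (S × S) :=
  match l with
  | [] => [(a, b)]
  | y :: l => (a, G.start y) :: G.pathWedges (G.finish y) l b

omit [DecidableEq S] [Fintype Λ] [Fintype S] in
theorem SeedGraph.wedges_cons (G : SeedGraph S Λ N) (x : Λ × Bool) (l : List (Λ × Bool)) :
    G.wedges (x :: l) = G.pathWedges (G.finish x) l (G.start x) := by
  have : ∀ (l : List (Λ × Bool)) (x z : Λ × Bool),
      List.zipWith (fun x y => (G.finish x, G.start y)) (x :: l) (l ++ [z]) =
        G.pathWedges (G.finish x) l (G.start z) := by
    intro l
    induction l with
    | nil => intro x z; rfl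
    | cons y l ih => intro x z; simp [pathWedges, ih]
  simpa [SeedGraph.wedges] using this l x x

/-- Iteration of `openWedgeSum_succ`: the strand crosses the $m$ links of $l$ and then closes
through $x$, the only oriented link that finishes at the open end. -/
theorem sum_openWedgeSum (G : SeedGraph S Λ N) (x : Λ × Bool) (n : ℕ) (a : S)
    {g : Multiset (S × S) → ℂ} (hg : FlipInvariant g) :
    ∑ j, openWedgeSum G (G.finish x) j n (fun W => g ((a, j) ::ₘ W)) =
      ∑ m ∈ Finset.range (n + 1), sumLists m fun l : List (Λ × Bool) =>
        wedgeSum G (n - m) fun W => g (G.pathWedges a l (G.start x) + W) := by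
  have hite : ∀ f : Λ × Bool → ℂ, ∑ y, (if G.finish x = G.finish y then f y else 0) = f x := by
    classical
    intro f
    simp [G.finish_injective.eq_iff]
  induction n generalizing a g with
  | zero =>
    rw [← G.start_bijective.sum_comp]
    simp only [openWedgeSum_zero, hite]
    simp [sumLists_zero, SeedGraph.pathWedges]
  | succ n ih =>
    rw [← G.start_bijective.sum_comp]
    have h1 : ∀ y, FlipInvariant fun W => g ((a, G.start y) ::ₘ W) :=
      fun y => hg.add_left {(a, G.start y)}
    simp only [fun y => openWedgeSum_succ G (G.finish x) y n (h1 y), Finset.sum_add_distrib, hite]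
    -- The $m=0$ term is the strand that closes at once; the others come from the induction
    -- hypothesis with one more link in front.
    rw [Finset.sum_range_succ', add_comm]
    congr 1
    · simp only [fun y => ih (G.finish y) (h1 y), sumLists_succ]
      rw [Finset.sum_comm]
      simp [SeedGraph.pathWedges, ← Multiset.cons_coe]

/-- The strand through the marked end traces a closed walk $x\,l$ of $m+1$ links, and the other
$n-m$ wedges remain stranded among themselves. -/
theorem wedgeSum_recursion (G : SeedGraph S Λ N) (n : ℕ) {g : Multiset (S × S) → ℂ}
    (hg : FlipInvariant g) :
    (2 * (n + 1)) * wedgeSum G (n + 1) g =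
      ∑ m ∈ Finset.range (n + 1), sumLists (m + 1) fun l : List (Λ × Bool) =>
        wedgeSum G (n - m) fun W => g (G.wedges l + W) := by
  rw [two_mul_wedgeSum_succ, ← G.finish_bijective.sum_comp]
  simp only [sum_openWedgeSum G _ n _ hg, sumLists_succ, SeedGraph.wedges_cons]
  exact Finset.sum_comm

end Strands

/-! ### Primitive words and powers -/

section ListPowers

variable {α : Type*}

/-- The `k`-fold repetition of a list. -/
def listPow (u : List α) (k : ℕ) : List α := (List.replicate k u).flatten

theorem listPow_zero (u : List α) : listPow u 0 = [] := rfl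

theorem listPow_succ (u : List α) (k : ℕ) : listPow u (k + 1) = u ++ listPow u k := by
  simp [listPow, List.replicate_succ]

theorem length_listPow (u : List α) (k : ℕ) : (listPow u k).length = k * u.length := by
  induction k with
  | zero => simp [listPow_zero]
  | succ k ih => rw [listPow_succ, List.length_append, ih]; ring

theorem append_listPow_append (a b : List α) (k : ℕ) :
    a ++ listPow (b ++ a) k = listPow (a ++ b) k ++ a := by
  induction k with
  | zero => simp [listPow_zero]
  | succ k ih => rw [listPow_succ, listPow_succ, List.append_assoc, ih]; simp

theorem rotate_listPow (u : List α) (k r : ℕ) (hr : r ≤ u.length) :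
    (listPow u k).rotate r = listPow (u.rotate r) k := by
  rcases k with _ | k
  · simp [listPow_zero]
  · rw [List.rotate_eq_drop_append_take hr]
    obtain ⟨a, b, rfl, rfl⟩ : ∃ a b, u = a ++ b ∧ r = a.length :=
      ⟨u.take r, u.drop r, (List.take_append_drop r u).symm, by simp [hr]⟩
    simp only [List.drop_left, List.take_left]
    rw [listPow_succ, List.append_assoc, List.rotate_append_length_eq, List.append_assoc,
      ← append_listPow_append, listPow_succ, List.append_assoc]

/-- From $uv=vu$ and $|u|\le|v|$, the word $u$ is a prefix of $v$; cancelling it leaves a shorter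
word that still commutes with $u$. -/
theorem eq_listPow_of_append_comm {u v : List α} {k : ℕ} (h : u ++ v = v ++ u)
    (hl : v.length = k * u.length) : v = listPow u k := by
  induction k generalizing v with
  | zero => simpa [listPow_zero] using hl
  | succ k ih =>
    have hle : u.length ≤ v.length := by rw [hl]; nlinarith
    obtain ⟨v', rfl⟩ : u <+: v := by
      refine List.prefix_of_prefix_length_le (l₃ := v ++ u) ?_ (List.prefix_append _ _) hle
      rw [← h]
      exact List.prefix_append _ _
    rw [List.append_assoc, List.append_cancel_left_eq] at h
    rw [listPow_succ, ← ih h]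
    rw [List.length_append] at hl
    linarith

theorem eq_listPow_take {l : List α} {d k : ℕ} (h : l.rotate d = l)
    (hl : l.length = (k + 1) * d) : l = listPow (l.take d) (k + 1) := by
  have hd : d ≤ l.length := by rw [hl]; nlinarith
  rw [List.rotate_eq_drop_append_take hd] at h
  have h2 : l.take d ++ l.drop d = l.drop d ++ l.take d := by rw [h, List.take_append_drop]
  have h3 := eq_listPow_of_append_comm (k := k) h2 (by
    rw [List.length_drop, List.length_take, min_eq_left hd, hl]
    rw [add_mul, one_mul, add_tsub_cancel_right])
  rw [listPow_succ, ← h3, List.take_append_drop]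

/-- A list that is not invariant under a proper cyclic permutation. -/
def IsPrimitive (u : List α) : Prop :=
  u ≠ [] ∧ ∀ k, 0 < k → k < u.length → u.rotate k ≠ u

theorem IsPrimitive.rotate {u : List α} (hu : IsPrimitive u) (r : ℕ) :
    IsPrimitive (u.rotate r) := by
  refine ⟨by simpa using hu.1, fun k hk hk' h => ?_⟩
  rw [List.length_rotate] at hk'
  refine hu.2 k hk hk' ?_
  rw [List.rotate_rotate, add_comm, ← List.rotate_rotate] at h
  exact List.rotate_injective r h

theorem IsPrimitive.rotate_inj {u : List α} (hu : IsPrimitive u) {r s : ℕ} (hr : r < u.length)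
    (hs : s < u.length) (h : u.rotate r = u.rotate s) : r = s := by
  wlog hrs : r ≤ s generalizing r s
  · exact (this hs hr h.symm (le_of_not_ge hrs)).symm
  by_contra hne
  refine hu.2 (s - r) (by omega) (by omega) ?_
  have : (u.rotate (s - r)).rotate r = u.rotate r := by
    rw [List.rotate_rotate, Nat.sub_add_cancel hrs, h]
  exact List.rotate_injective r this

/-- The minimal period $d$ of $l$ under rotation by one step divides its length, and the first $d$
letters form the root. A smaller period of the root would be one of $l$. -/
theorem exists_primitive_root {l : List α} (hl : l ≠ []) :
    ∃ u k, IsPrimitive u ∧ l = listPow u (k + 1) := by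
  classical
  have hlen : 0 < l.length := List.length_pos_of_ne_nil hl
  set f : List α → List α := fun l => l.rotate 1 with hf
  have hit : ∀ k, f^[k] l = l.rotate k := by
    intro k
    induction k with
    | zero => simp
    | succ k ih => rw [Function.iterate_succ_apply', ih]; exact List.rotate_rotate _ _ _
  have hper : Function.IsPeriodicPt f l.length l := by
    rw [Function.IsPeriodicPt, Function.IsFixedPt, hit, List.rotate_length]
  set d := Function.minimalPeriod f l with hd
  have hd0 : 0 < d := hper.minimalPeriod_pos hlen
  have hrot : l.rotate d = l := by rw [← hit]; exact Function.isPeriodicPt_minimalPeriod f l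
  obtain ⟨k, hk⟩ := hper.minimalPeriod_dvd
  obtain ⟨k, rfl⟩ : ∃ j, k = j + 1 := ⟨k - 1, by
    rcases k with _ | k
    · simp at hk; exact absurd hk hl
    · simp⟩
  have hlk : l.length = (k + 1) * d := by rw [hk]; ring
  have hdl : d ≤ l.length := by rw [hlk]; nlinarith
  have hl' := eq_listPow_take hrot hlk
  have htl : (l.take d).length = d := by simp [hdl]
  refine ⟨l.take d, k, ⟨?_, ?_⟩, hl'⟩
  · rw [← List.length_pos_iff_ne_nil, htl]; exact hd0
  · intro r hr hr' h
    rw [htl] at hr'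
    have : l.rotate r = l := by
      conv_lhs => rw [hl']
      rw [rotate_listPow _ _ _ (by rw [htl]; exact hr'.le), h, ← hl']
    rw [← hit] at this
    exact absurd (Function.IsPeriodicPt.minimalPeriod_le hr this) (not_le.mpr hr')

theorem take_listPow_succ (u : List α) (k : ℕ) : (listPow u (k + 1)).take u.length = u := by
  rw [listPow_succ, List.take_left]

/-- Rotation by $|v|$ fixes the common word, hence its first block $u$; primitivity excludes
$0<|v|<|u|$. -/
theorem listPow_inj_aux {u v : List α} {j k : ℕ} (hu : IsPrimitive u)
    (hv : IsPrimitive v) (h : listPow u (j + 1) = listPow v (k + 1)) (hle : v.length ≤ u.length) :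
    u.length ∣ v.length := by
  have h1 : u.rotate v.length = u := by
    have h2 : (listPow u (j + 1)).rotate v.length = listPow u (j + 1) := by
      rw [h, rotate_listPow _ _ _ le_rfl, List.rotate_length]
    rw [rotate_listPow _ _ _ hle] at h2
    have h3 := congrArg (List.take u.length) h2
    rw [take_listPow_succ] at h3
    rwa [← List.length_rotate (l := u) (n := v.length), take_listPow_succ] at h3
  by_contra hnd
  have hv0 : 0 < v.length := List.length_pos_of_ne_nil hv.1
  have : v.length < u.length := lt_of_le_of_ne hle fun e => hnd (by rw [e])
  exact hu.2 _ hv0 this h1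

theorem listPow_inj {u v : List α} {j k : ℕ} (hu : IsPrimitive u)
    (hv : IsPrimitive v) (h : listPow u (j + 1) = listPow v (k + 1)) : u = v ∧ j = k := by
  have hu0 : 0 < u.length := List.length_pos_of_ne_nil hu.1
  have hv0 : 0 < v.length := List.length_pos_of_ne_nil hv.1
  have hlen : u.length = v.length := by
    rcases le_total v.length u.length with hle | hle
    · exact le_antisymm (Nat.le_of_dvd hv0 (listPow_inj_aux hu hv h hle)) hle
    · exact le_antisymm hle (Nat.le_of_dvd hu0 (listPow_inj_aux hv hu h.symm hle))
  have h1 := congrArg (List.take u.length) h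
  rw [take_listPow_succ] at h1
  rw [hlen, take_listPow_succ] at h1
  refine ⟨h1, ?_⟩
  have h2 := congrArg List.length h
  rw [length_listPow, length_listPow, hlen] at h2
  have := Nat.eq_of_mul_eq_mul_right hv0 h2
  omega

theorem sumLists_eq_sum {M : Type*} [Fintype α] [AddCommMonoid M] (n : ℕ) (h : List α → M) :
    sumLists n h = ∑ l ∈ (List.finite_length_eq α n).toFinset, h l := by
  induction n generalizing h with
  | zero =>
    have : (List.finite_length_eq α 0).toFinset = {[]} := by
      ext l; simp
    rw [this, Finset.sum_singleton, sumLists_zero]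
  | succ n ih =>
    simp only [sumLists_succ, ih]
    rw [← Finset.sum_product' (f := fun a l => h (a :: l))]
    refine Finset.sum_bij (fun p _ => p.1 :: p.2) ?_ ?_ ?_ ?_
    · rintro ⟨a, l⟩ hp
      simpa using hp
    · rintro ⟨a, l⟩ _ ⟨a', l'⟩ _ hp
      simpa using hp
    · intro l hl
      rcases l with _ | ⟨a, l⟩
      · simp at hl
      · exact ⟨(a, l), by simpa using hl, rfl⟩
    · intro _ _
      rfl

end ListPowers

/-! ### Wedges of rotated, repeated and reversed walks -/

section WedgeLists

variable {S Λ N : Type*}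

theorem SeedGraph.pathWedges_append (G : SeedGraph S Λ N) (a b : S) (l l' : List (Λ × Bool))
    (y : Λ × Bool) : G.pathWedges a (l ++ y :: l') b =
      G.pathWedges a l (G.start y) ++ G.pathWedges (G.finish y) l' b := by
  induction l generalizing a with
  | nil => rfl
  | cons x l ih => simp [pathWedges, ih]

theorem SeedGraph.length_wedges (G : SeedGraph S Λ N) (l : List (Λ × Bool)) :
    (G.wedges l).length = l.length := by
  simp [SeedGraph.wedges]

theorem SeedGraph.wedges_rotate (G : SeedGraph S Λ N) (l : List (Λ × Bool)) (r : ℕ) :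
    G.wedges (l.rotate r) = (G.wedges l).rotate r := by
  rw [SeedGraph.wedges, SeedGraph.wedges, List.zipWith_rotate_distrib _ _ _ _ (by simp),
    List.rotate_rotate, List.rotate_rotate, add_comm]

theorem SeedGraph.wedges_listPow (G : SeedGraph S Λ N) (u : List (Λ × Bool)) (k : ℕ) :
    G.wedges (listPow u k) = listPow (G.wedges u) k := by
  rcases u with _ | ⟨x, l⟩
  · simp [listPow, SeedGraph.wedges]
  induction k with
  | zero => rfl
  | succ k ih =>
    rw [listPow_succ, listPow_succ, ← ih]
    rcases k with _ | k
    · simp [listPow_zero, SeedGraph.wedges]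
    · rw [listPow_succ, List.cons_append, List.cons_append, G.wedges_cons, G.pathWedges_append,
        G.wedges_cons, G.wedges_cons]

theorem SeedGraph.reverse_pathWedges (G : SeedGraph S Λ N) (a b : S) (l : List (Λ × Bool)) :
    G.pathWedges b (reverseLinks l) a = ((G.pathWedges a l b).map Prod.swap).reverse := by
  induction l generalizing a with
  | nil => rfl
  | cons y l ih =>
    have : reverseLinks (y :: l) = reverseLinks l ++ (y.1, !y.2) :: [] := by simp [reverseLinks]
    rw [this, G.pathWedges_append, ← G.start_eq_finish, G.start_eq_finish, Bool.not_not, ih]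
    simp [pathWedges]

theorem SeedGraph.wedges_reverseLinks_perm (G : SeedGraph S Λ N) (l : List (Λ × Bool)) :
    (G.wedges (reverseLinks l)).Perm ((G.wedges l).map Prod.swap) := by
  rcases l with _ | ⟨x, l⟩
  · exact List.Perm.refl _
  -- Reversal puts the base link last; up to one rotation it can be kept in front.
  have h1 : reverseLinks (x :: l) = ((x.1, !x.2) :: reverseLinks l).rotate 1 := by
    simp [reverseLinks]
  rw [h1, G.wedges_rotate, G.wedges_cons, G.wedges_cons, ← G.start_eq_finish x,
    G.start_eq_finish (x.1, !x.2), Bool.not_not, G.reverse_pathWedges]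
  exact (List.rotate_perm _ _).trans (List.reverse_perm _)

/-- A backtracking-free closed sequence of links. -/
def SeedGraph.IsReduced (G : SeedGraph S Λ N) (l : List (Λ × Bool)) : Prop :=
  ∀ w ∈ G.wedges l, G.node w.1 = G.node w.2 ∧ w.1 ≠ w.2

/-- A walk that is a rotation of its reversal has a reflection symmetry. A reflection centre on a
link would make it its own inverse; one between two links would make them mutually inverse, a
backtracking. So the two orientations of a reduced loop are always distinct. -/
theorem SeedGraph.IsReduced.not_isRotated {G : SeedGraph S Λ N} {l : List (Λ × Bool)}
    (hl : G.IsReduced l) (hne : l ≠ []) : ¬ l ~r reverseLinks l := by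
  intro h
  have hk : 0 < l.length := List.length_pos_of_ne_nil hne
  obtain ⟨c, hc, hrot⟩ : ∃ c < l.length, l.rotate c = reverseLinks l := by
    obtain ⟨c, hc⟩ := h
    exact ⟨c % l.length, Nat.mod_lt _ hk, by rw [List.rotate_mod, hc]⟩
  -- $C=c-1$ modulo the length: the symmetry exchanges the positions $s$ and $C-s$ and inverts the
  -- links.
  obtain ⟨C, hC, hCc⟩ : ∃ C < l.length, (c = 0 ∧ C = l.length - 1) ∨ c = C + 1 := by
    rcases c with _ | c
    · exact ⟨l.length - 1, by omega, Or.inl ⟨rfl, rfl⟩⟩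
    · exact ⟨c, by omega, Or.inr rfl⟩
  have key : ∀ s (hs : s ≤ C), l[C - s]'(by omega) =
      ((l[s]'(by omega)).1, !(l[s]'(by omega)).2) := by
    intro s hs
    have h1 : (l.rotate c)[l.length - 1 - s]'(by simp; omega) =
        (reverseLinks l)[l.length - 1 - s]'(by simp [reverseLinks]; omega) := by
      simp only [hrot]
    rw [List.getElem_rotate] at h1
    have h2 : (l.length - 1 - s + c) % l.length = C - s := by
      rcases hCc with ⟨rfl, rfl⟩ | rfl
      · rw [add_zero, Nat.mod_eq_of_lt (by omega)]
      · rw [show l.length - 1 - s + (C + 1) = l.length + (C - s) by omega, Nat.add_mod_left,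
          Nat.mod_eq_of_lt (by omega)]
    simp only [h2] at h1
    rw [h1]
    simp only [reverseLinks, List.getElem_reverse, List.getElem_map, List.length_map]
    have h3 : l.length - 1 - (l.length - 1 - s) = s := by omega
    simp only [h3]
  rcases Nat.even_or_odd' C with ⟨s, rfl | rfl⟩
  · have := key s (by omega)
    rw [Prod.ext_iff] at this
    have h4 : 2 * s - s = s := by omega
    simp only [h4] at this
    simp at this
  · have := key s (by omega)
    have h4 : 2 * s + 1 - s = s + 1 := by omega
    simp only [h4] at this
    have hw : (G.finish l[s], G.start l[s + 1]) ∈ G.wedges l := by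
      rw [SeedGraph.wedges, List.mem_iff_getElem]
      refine ⟨s, by simp; omega, ?_⟩
      rw [List.getElem_zipWith, List.getElem_rotate]
      simp only [Nat.mod_eq_of_lt (show s + 1 < l.length by omega)]
    refine (hl _ hw).2 ?_
    simp only [this, G.start_eq_finish, Bool.not_not]

theorem SeedGraph.isReduced_of_perm {G : SeedGraph S Λ N} {l l' : List (Λ × Bool)}
    (h : (G.wedges l).Perm (G.wedges l')) (hl : G.IsReduced l) : G.IsReduced l' :=
  fun w hw => hl w (h.mem_iff.mpr hw)

theorem SeedGraph.IsReduced.rotate {G : SeedGraph S Λ N} {l : List (Λ × Bool)}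
    (hl : G.IsReduced l) (r : ℕ) : G.IsReduced (l.rotate r) := by
  refine isReduced_of_perm ?_ hl
  rw [G.wedges_rotate]
  exact (List.rotate_perm _ _).symm

theorem SeedGraph.IsReduced.reverse {G : SeedGraph S Λ N} {l : List (Λ × Bool)}
    (hl : G.IsReduced l) : G.IsReduced (reverseLinks l) := by
  intro w hw
  rw [(G.wedges_reverseLinks_perm l).mem_iff, List.mem_map] at hw
  obtain ⟨v, hv, rfl⟩ := hw
  exact ⟨(hl v hv).1.symm, (hl v hv).2.symm⟩

theorem SeedGraph.IsReduced.of_isRotated {G : SeedGraph S Λ N} {l l' : List (Λ × Bool)}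
    (hl : G.IsReduced l) (h : l ~r l') : G.IsReduced l' := by
  obtain ⟨r, rfl⟩ := h
  exact hl.rotate r

theorem isReduced_listPow_succ {G : SeedGraph S Λ N} {u : List (Λ × Bool)} {k : ℕ} :
    G.IsReduced (listPow u (k + 1)) ↔ G.IsReduced u := by
  have : ∀ w, w ∈ G.wedges (listPow u (k + 1)) ↔ w ∈ G.wedges u := by
    intro w
    rw [G.wedges_listPow, listPow, List.mem_flatten]
    simp
  simp only [SeedGraph.IsReduced, this]

theorem coe_listPow {β : Type*} (u : List β) (k : ℕ) :
    ((listPow u k : List β) : Multiset β) = k • (u : Multiset β) := by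
  induction k with
  | zero => simp [listPow_zero]
  | succ k ih => rw [listPow_succ, ← Multiset.coe_add, ih, succ_nsmul, add_comm]

theorem IsPrimitive.reverseLinks {l : List (Λ × Bool)} (hl : IsPrimitive l) :
    IsPrimitive (reverseLinks l) := by
  refine ⟨fun h => hl.1 ?_, fun k hk hk' h => ?_⟩
  · rw [← reverseLinks_reverseLinks l, h]; rfl
  · have hlen : (LoopExpansion.reverseLinks l).length = l.length := by
      simp [LoopExpansion.reverseLinks]
    rw [hlen] at hk'
    have h2 : l.rotate (l.length - k) = l := by
      rw [LoopExpansion.reverseLinks, List.rotate_reverse, ← List.map_rotate] at h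
      have h3 := List.reverse_injective h
      have hinj : Function.Injective fun x : Λ × Bool => (x.1, !x.2) :=
        Function.Involutive.injective fun x => by simp
      have h4 := List.map_injective_iff.mpr hinj h3
      rwa [List.length_map, Nat.mod_eq_of_lt hk'] at h4
    exact hl.2 _ (by omega) (by omega) h2

end WedgeLists

/-! ### Concatenating words without losing their boundaries -/

section MarkLast

variable {β : Type*}

/-- Mark the last element of a list. -/
def markLast : List β → List (β × Bool)
  | [] => []
  | [a] => [(a, true)]
  | a :: b :: l => (a, false) :: markLast (b :: l)

/-- Split a list after each marked element. -/
def splitMarked : List (β × Bool) → List (List β)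
  | [] => []
  | (a, true) :: r => [a] :: splitMarked r
  | (a, false) :: r => match splitMarked r with
    | [] => [[a]]
    | l :: L => (a :: l) :: L

theorem length_markLast (l : List β) : (markLast l).length = l.length := by
  induction l with
  | nil => rfl
  | cons a l ih =>
    rcases l with _ | ⟨b, l⟩
    · rfl
    · simp only [markLast, List.length_cons] at ih ⊢
      rw [ih]

theorem splitMarked_append {l : List β} (hl : l ≠ []) (r : List (β × Bool)) :
    splitMarked (markLast l ++ r) = l :: splitMarked r := by
  induction l with
  | nil => exact absurd rfl hl
  | cons a l ih =>
    rcases l with _ | ⟨b, l⟩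
    · rfl
    · simp only [markLast, List.cons_append, splitMarked, ih (List.cons_ne_nil b l)]

theorem splitMarked_flatMap {L : List (List β)} (hL : ∀ l ∈ L, l ≠ []) :
    splitMarked (L.flatMap markLast) = L := by
  induction L with
  | nil => rfl
  | cons l L ih =>
    rw [List.flatMap_cons, splitMarked_append (hL l (by simp)), ih fun l' h => hL l' (by simp [h])]

end MarkLast

/-! ### Sums over multiloops of given length -/

section LoopSums

variable {S Λ N : Type*} {G : SeedGraph S Λ N}

theorem OrientedLoop.ext_links {p q : OrientedLoop G} (h : p.links = q.links) : p = q := by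
  cases p; cases q; cases h; rfl

theorem OrientedLoop.isPrimitive (p : OrientedLoop G) : IsPrimitive p.links :=
  ⟨p.ne_nil, p.nonrepeating⟩

theorem injective_of_section {o : Loop G → OrientedLoop G} (ho : ∀ α, (o α).toLoop = α) :
    Function.Injective o := fun α β h => by rw [← ho α, ← ho β, h]

/-- The number of links of a loop. -/
def loopLength (o : Loop G → OrientedLoop G) (α : Loop G) : ℕ := (o α).links.length

theorem loopLength_pos (o : Loop G → OrientedLoop G) (α : Loop G) : 0 < loopLength o α :=
  List.length_pos_of_ne_nil (o α).ne_nil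

/-- The wedges of a loop. -/
def loopWedges (o : Loop G → OrientedLoop G) (α : Loop G) : Multiset (S × S) :=
  (G.wedges (o α).links : Multiset (S × S))

theorem links_injective {o : Loop G → OrientedLoop G} (ho : ∀ α, (o α).toLoop = α) :
    Function.Injective fun α => (o α).links :=
  fun _ _ h => injective_of_section ho (OrientedLoop.ext_links h)

/-- The list of the links of all loops of a multiloop, with the last link of each loop marked. -/
def multiloopCode (o : Loop G → OrientedLoop G) (Φ : Multiloop G) : List ((Λ × Bool) × Bool) :=
  (Φ.toList.map fun α => (o α).links).flatMap markLast

/-- The marks recover the loops from the concatenated word. With $4|\Lambda|$ letters, this bounds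
the number of multiloops of length $n$ by $(4|\Lambda|)^n$; it serves both finiteness at each length
and summability. -/
theorem multiloopCode_injective {o : Loop G → OrientedLoop G} (ho : ∀ α, (o α).toLoop = α) :
    Function.Injective (multiloopCode o) := by
  intro Φ Ψ h
  have h2 := congrArg splitMarked h
  have hne : ∀ Φ : Multiloop G, ∀ l ∈ Φ.toList.map (fun α => (o α).links), l ≠ [] := by
    intro Φ l hl
    rw [List.mem_map] at hl
    obtain ⟨α, -, rfl⟩ := hl
    exact (o α).ne_nil
  rw [multiloopCode, multiloopCode, splitMarked_flatMap (hne Φ), splitMarked_flatMap (hne Ψ)] at h2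
  have h3 := List.map_injective_iff.mpr (links_injective ho) h2
  rw [← Multiset.coe_toList Φ, h3, Multiset.coe_toList]

theorem length_multiloopCode (o : Loop G → OrientedLoop G) (Φ : Multiloop G) :
    (multiloopCode o Φ).length = (Φ.map (loopLength o)).sum := by
  have : (Φ.map (loopLength o)).sum = ((Φ.toList.map (loopLength o))).sum := by
    rw [← Multiset.sum_coe, ← Multiset.map_coe, Multiset.coe_toList]
  rw [this, multiloopCode, List.length_flatMap, List.map_map]
  congr 1
  refine List.map_congr_left fun α _ => ?_
  simp [length_markLast, loopLength]

variable [Fintype Λ]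

theorem finite_multiloops {o : Loop G → OrientedLoop G} (ho : ∀ α, (o α).toLoop = α) (n : ℕ) :
    {Φ : Multiloop G | (Φ.map (loopLength o)).sum = n}.Finite := by
  refine ((List.finite_length_eq ((Λ × Bool) × Bool) n).preimage
    (multiloopCode_injective ho).injOn).subset fun Φ hΦ => ?_
  simpa [length_multiloopCode] using hΦ

/-- The multiloops of total length `n`. -/
def multiloopsOfLength {o : Loop G → OrientedLoop G} (ho : ∀ α, (o α).toLoop = α) (n : ℕ) :
    Finset (Multiloop G) := (finite_multiloops ho n).toFinset

theorem mem_multiloopsOfLength {o : Loop G → OrientedLoop G} {ho : ∀ α, (o α).toLoop = α} {n : ℕ}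
    {Φ : Multiloop G} : Φ ∈ multiloopsOfLength ho n ↔ (Φ.map (loopLength o)).sum = n := by
  simp [multiloopsOfLength]

theorem finite_loops {o : Loop G → OrientedLoop G} (ho : ∀ α, (o α).toLoop = α) (n : ℕ) :
    {α : Loop G | loopLength o α ≤ n}.Finite :=
  (List.finite_length_le (Λ × Bool) n).preimage (links_injective ho).injOn

/-- The loops of length at most `n`. -/
def loopsOfLengthLE {o : Loop G → OrientedLoop G} (ho : ∀ α, (o α).toLoop = α) (n : ℕ) :
    Finset (Loop G) := (finite_loops ho n).toFinset

theorem mem_loopsOfLengthLE {o : Loop G → OrientedLoop G} {ho : ∀ α, (o α).toLoop = α} {n : ℕ}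
    {α : Loop G} : α ∈ loopsOfLengthLE ho n ↔ loopLength o α ≤ n := by
  simp [loopsOfLengthLE]

/-- The sum of `g` over the wedges of all multiloops of total length `n`. -/
def multiloopSum {o : Loop G → OrientedLoop G} (ho : ∀ α, (o α).toLoop = α) (n : ℕ)
    (g : Multiset (S × S) → ℂ) : ℂ :=
  ∑ Φ ∈ multiloopsOfLength ho n, g (Φ.map (loopWedges o)).sum

theorem multiloopSum_zero {o : Loop G → OrientedLoop G} (ho : ∀ α, (o α).toLoop = α)
    (g : Multiset (S × S) → ℂ) : multiloopSum ho 0 g = g 0 := by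
  have : multiloopsOfLength ho 0 = {0} := by
    ext Φ
    rw [mem_multiloopsOfLength, Finset.mem_singleton]
    refine ⟨fun h => ?_, fun h => by simp [h]⟩
    by_contra hne
    obtain ⟨α, hα⟩ := Multiset.exists_mem_of_ne_zero hne
    have := Multiset.sum_eq_zero_iff.mp h _ (Multiset.mem_map_of_mem _ hα)
    exact (loopLength_pos o α).ne' this
  rw [multiloopSum, this, Finset.sum_singleton]
  simp

/-- Removing $k$ copies of $\alpha$ is a bijection onto all multiloops of the remaining length. -/
theorem sum_multiloops_containing {o : Loop G → OrientedLoop G} (ho : ∀ α, (o α).toLoop = α)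
    [DecidableEq (Loop G)] (n k : ℕ) (α : Loop G) (g : Multiset (S × S) → ℂ) :
    ∑ Φ ∈ multiloopsOfLength ho n with k ≤ Φ.count α, g (Φ.map (loopWedges o)).sum =
      if k * loopLength o α ≤ n then
        multiloopSum ho (n - k * loopLength o α) fun W => g (k • loopWedges o α + W) else 0 := by
  have hlen : ∀ Φ : Multiloop G, k ≤ Φ.count α → (Φ.map (loopLength o)).sum =
      k * loopLength o α + ((Φ - Multiset.replicate k α).map (loopLength o)).sum := by
    intro Φ hk
    conv_lhs => rw [← Multiset.add_sub_cancel (Multiset.le_count_iff_replicate_le.mp hk)]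
    simp [add_comm]
  split_ifs with hn
  · rw [multiloopSum]
    refine Finset.sum_bij' (fun Φ _ => Φ - Multiset.replicate k α)
      (fun Ψ _ => Multiset.replicate k α + Ψ) ?_ ?_ ?_ ?_ ?_
    · intro Φ hΦ
      rw [Finset.mem_filter, mem_multiloopsOfLength] at hΦ
      have := hlen Φ hΦ.2
      rw [mem_multiloopsOfLength]
      omega
    · intro Ψ hΨ
      rw [mem_multiloopsOfLength] at hΨ
      rw [Finset.mem_filter, mem_multiloopsOfLength]
      simp [hΨ]
      omega
    · intro Φ hΦ
      rw [Finset.mem_filter] at hΦ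
      exact add_tsub_cancel_of_le (Multiset.le_count_iff_replicate_le.mp hΦ.2)
    · intro Ψ _
      exact add_tsub_cancel_left _ _
    · intro Φ hΦ
      rw [Finset.mem_filter] at hΦ
      conv_lhs => rw [← Multiset.add_sub_cancel (Multiset.le_count_iff_replicate_le.mp hΦ.2)]
      simp [add_comm]
  · refine Finset.sum_eq_zero fun Φ hΦ => ?_
    rw [Finset.mem_filter, mem_multiloopsOfLength] at hΦ
    have := hlen Φ hΦ.2
    omega

/-- Logarithmic derivative of $\prod_\alpha(1-\alpha)^{-1}$: the length of $\Phi$ is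
$\sum_\alpha|\alpha|$ times the multiplicity of $\alpha$, and a multiplicity is the number of
$k\ge1$ not exceeding it. -/
theorem multiloopSum_recursion {o : Loop G → OrientedLoop G} (ho : ∀ α, (o α).toLoop = α)
    (n : ℕ) (g : Multiset (S × S) → ℂ) :
    n * multiloopSum ho n g = ∑ α ∈ loopsOfLengthLE ho n, ∑ k ∈ Finset.Icc 1 n,
      if k * loopLength o α ≤ n then loopLength o α *
        multiloopSum ho (n - k * loopLength o α) (fun W => g (k • loopWedges o α + W)) else 0 := by
  classical
  have h1 : ∀ Φ ∈ multiloopsOfLength ho n, (n : ℂ) = ∑ α ∈ loopsOfLengthLE ho n,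
      ∑ k ∈ Finset.Icc 1 n, if k ≤ Φ.count α then (loopLength o α : ℂ) else 0 := by
    intro Φ hΦ
    rw [mem_multiloopsOfLength] at hΦ
    have hcount : ∀ α, Φ.count α * loopLength o α ≤ n := by
      intro α
      have := Multiset.le_count_iff_replicate_le.mp (le_refl (Φ.count α))
      rw [← hΦ, ← Multiset.add_sub_cancel this]
      simp
    have h2 : ∀ α, ∑ k ∈ Finset.Icc 1 n, (if k ≤ Φ.count α then (loopLength o α : ℂ) else 0) =
        (Φ.count α * loopLength o α : ℕ) := by
      intro α
      have hle : Φ.count α ≤ n := (Nat.le_mul_of_pos_right _ (loopLength_pos o α)).trans (hcount α)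
      rw [← Finset.sum_filter, Finset.sum_const]
      have : {k ∈ Finset.Icc 1 n | k ≤ Φ.count α} = Finset.Icc 1 (Φ.count α) := by
        ext k; simp; omega
      rw [this]
      simp
    rw [Finset.sum_congr rfl fun α _ => h2 α, ← Nat.cast_sum]
    congr 1
    refine hΦ.symm.trans ?_
    rw [Finset.sum_multiset_map_count]
    refine Finset.sum_subset_zero_on_sdiff (fun α hα => ?_) (fun α hα => ?_) fun α _ => rfl
    · rw [Multiset.mem_toFinset, ← Multiset.one_le_count_iff_mem] at hα
      rw [mem_loopsOfLengthLE]
      exact (Nat.le_mul_of_pos_left _ hα).trans (hcount α)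
    · rw [Finset.mem_sdiff, Multiset.mem_toFinset] at hα
      rw [Multiset.count_eq_zero.mpr hα.2, zero_mul]
  rw [multiloopSum, Finset.mul_sum]
  rw [Finset.sum_congr rfl fun Φ hΦ => by rw [h1 Φ hΦ, Finset.sum_mul]]
  rw [Finset.sum_comm]
  refine Finset.sum_congr rfl fun α _ => ?_
  simp only [Finset.sum_mul]
  rw [Finset.sum_comm]
  refine Finset.sum_congr rfl fun k _ => ?_
  have h3 := sum_multiloops_containing ho n k α g
  simp only [ite_mul, zero_mul]
  rw [← Finset.sum_filter, ← Finset.mul_sum, h3, mul_ite, mul_zero]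

end LoopSums

/-! ### Closed walks as powers of loops; multiloop sums equal wedge sums -/

section ClosedWalks

variable {S Λ N : Type*} {G : SeedGraph S Λ N}

/-- `g` is insensitive to the orientations of the wedges and vanishes on wedges joining a seed to
itself and on wedges joining seeds of distinct nodes. -/
structure IsAdmissible (G : SeedGraph S Λ N) (g : Multiset (S × S) → ℂ) : Prop where
  flip : FlipInvariant g
  self : ∀ i W, g ((i, i) ::ₘ W) = 0
  node : ∀ i j W, G.node i ≠ G.node j → g ((i, j) ::ₘ W) = 0

theorem IsAdmissible.add_left {g : Multiset (S × S) → ℂ} (hg : IsAdmissible G g)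
    (V : Multiset (S × S)) : IsAdmissible G fun W => g (V + W) where
  flip := hg.flip.add_left V
  self i W := by simp only [Multiset.add_cons]; exact hg.self i _
  node i j W h := by simp only [Multiset.add_cons]; exact hg.node i j _ h

theorem FlipInvariant.map_swap {g : Multiset (S × S) → ℂ} (hg : FlipInvariant g)
    (W : Multiset (S × S)) : g (W.map Prod.swap) = g W := by
  induction W using Multiset.induction_on generalizing g with
  | empty => rfl
  | cons w W ih =>
    rw [Multiset.map_cons, ← Multiset.singleton_add, ih (hg.add_left {w.swap}),
      Multiset.singleton_add]
    exact hg _ _ _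

theorem FlipInvariant.nsmul_map_swap {g : Multiset (S × S) → ℂ} (hg : FlipInvariant g) (k : ℕ)
    (W : Multiset (S × S)) : g (k • W.map Prod.swap) = g (k • W) := by
  rw [← Multiset.map_nsmul, hg.map_swap]

theorem IsAdmissible.eq_zero_of_not_isReduced {g : Multiset (S × S) → ℂ} (hg : IsAdmissible G g)
    {l : List (Λ × Bool)} (hl : ¬ G.IsReduced l) {k : ℕ} (hk : 0 < k) :
    g (k • (G.wedges l : Multiset (S × S))) = 0 := by
  simp only [SeedGraph.IsReduced, not_forall] at hl
  obtain ⟨⟨i, j⟩, hw, h⟩ := hl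
  have hmem : (i, j) ∈ k • (G.wedges l : Multiset (S × S)) := by
    rw [Multiset.mem_nsmul]
    exact ⟨hk.ne', hw⟩
  obtain ⟨W, hW⟩ := Multiset.exists_cons_of_mem hmem
  rw [hW]
  by_cases hn : G.node i = G.node j
  · have : i = j := by
      by_contra hne
      exact h ⟨hn, hne⟩
    subst this
    exact hg.self i W
  · exact hg.node i j W hn

/-- The representatives `(ℓ_1, …, ℓ_k)` of an unoriented loop: the choices of an orientation and
a base point. -/
def basedLoop (o : Loop G → OrientedLoop G) (α : Loop G) (b : Bool) (r : ℕ) : List (Λ × Bool) :=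
  (if b then (o α).links else reverseLinks (o α).links).rotate r

theorem length_basedLoop (o : Loop G → OrientedLoop G) (α : Loop G) (b : Bool) (r : ℕ) :
    (basedLoop o α b r).length = loopLength o α := by
  cases b <;> simp [basedLoop, loopLength, reverseLinks]

theorem isPrimitive_basedLoop (o : Loop G → OrientedLoop G) (α : Loop G) (b : Bool) (r : ℕ) :
    IsPrimitive (basedLoop o α b r) := by
  cases b
  · exact (o α).isPrimitive.reverseLinks.rotate r
  · exact (o α).isPrimitive.rotate r

theorem isReduced_basedLoop {o : Loop G → OrientedLoop G} {α : Loop G} (b : Bool) (r : ℕ) :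
    G.IsReduced (basedLoop o α b r) ↔ G.IsReduced (o α).links := by
  constructor
  · intro h
    have h2 := h.of_isRotated (List.IsRotated.forall _ r)
    cases b
    · have := h2.reverse
      simpa [reverseLinks_reverseLinks] using this
    · exact h2
  · intro h
    cases b
    · exact h.reverse.rotate r
    · exact h.rotate r

theorem FlipInvariant.nsmul_wedges_basedLoop {g : Multiset (S × S) → ℂ} (hg : FlipInvariant g)
    (k : ℕ) (o : Loop G → OrientedLoop G) (α : Loop G) (b : Bool) (r : ℕ) :
    g (k • (G.wedges (basedLoop o α b r) : Multiset (S × S))) = g (k • loopWedges o α) := by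
  rw [basedLoop, G.wedges_rotate, Multiset.coe_eq_coe.mpr (List.rotate_perm _ r)]
  cases b
  · simp only [Bool.false_eq_true, if_false]
    rw [Multiset.coe_eq_coe.mpr (G.wedges_reverseLinks_perm (o α).links), ← Multiset.map_coe,
      hg.nsmul_map_swap]
    rfl
  · rfl

theorem exists_basedLoop {o : Loop G → OrientedLoop G} (ho : ∀ α, (o α).toLoop = α)
    (p : OrientedLoop G) :
    ∃ b, ∃ r < loopLength o p.toLoop, p.links = basedLoop o p.toLoop b r := by
  have h : o p.toLoop ≈ p := Quotient.exact (ho p.toLoop)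
  have hpos := loopLength_pos o p.toLoop
  rcases h with h | h
  · obtain ⟨r, hr⟩ := h
    refine ⟨true, r % loopLength o p.toLoop, Nat.mod_lt _ hpos, ?_⟩
    rw [basedLoop, if_pos rfl, loopLength, List.rotate_mod, hr]
  · have h2 := reverseLinks_isRotated h
    rw [reverseLinks_reverseLinks] at h2
    obtain ⟨r, hr⟩ := h2
    refine ⟨false, r % loopLength o p.toLoop, Nat.mod_lt _ hpos, ?_⟩
    have : loopLength o p.toLoop = (reverseLinks (o p.toLoop).links).length := by
      simp [loopLength, reverseLinks]
    rw [basedLoop, this, if_neg Bool.false_ne_true, List.rotate_mod, hr]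

/-- Primitivity makes the $|\alpha|$ base points give distinct walks; reducedness separates the two
orientations. Together they give the multiplicity $2|\alpha|$. -/
theorem basedLoop_inj {o : Loop G → OrientedLoop G} (ho : ∀ α, (o α).toLoop = α)
    {α β : Loop G} {b c : Bool} {r s : ℕ} (hα : G.IsReduced (o α).links)
    (hr : r < loopLength o α) (hs : s < loopLength o β)
    (h : basedLoop o α b r = basedLoop o β c s) : α = β ∧ b = c ∧ r = s := by
  have hrot : (if b then (o α).links else reverseLinks (o α).links) ~r
      (if c then (o β).links else reverseLinks (o β).links) := by
    have h1 : (if b then (o α).links else reverseLinks (o α).links) ~r basedLoop o α b r :=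
      (List.IsRotated.forall _ r).symm
    rw [h] at h1
    exact h1.trans (List.IsRotated.forall _ s)
  have hαβ : α = β := by
    rw [← ho α, ← ho β]
    refine Quotient.sound ?_
    cases b <;> cases c <;> simp only [Bool.false_eq_true, if_false, if_true] at hrot
    · left
      have := reverseLinks_isRotated hrot
      rwa [reverseLinks_reverseLinks, reverseLinks_reverseLinks] at this
    · right
      have := reverseLinks_isRotated hrot
      rwa [reverseLinks_reverseLinks] at this
    · exact Or.inr hrot
    · exact Or.inl hrot
  subst hαβ
  have hbc : b = c := by
    have hn := hα.not_isRotated (o α).ne_nil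
    cases b <;> cases c <;> simp only [Bool.false_eq_true, if_false, if_true] at hrot
    · rfl
    · exact absurd hrot.symm hn
    · exact absurd hrot hn
    · rfl
  subst hbc
  refine ⟨rfl, rfl, ?_⟩
  have hp := isPrimitive_basedLoop o α b 0
  have e : ∀ r, basedLoop o α b r = (basedLoop o α b 0).rotate r := by
    intro r
    simp [basedLoop]
  rw [e r, e s] at h
  exact hp.rotate_inj (by rwa [length_basedLoop]) (by rwa [length_basedLoop]) h

variable [Fintype Λ]

/-- Closed walks are powers of based oriented loops. -/
theorem sumLists_wedges {o : Loop G → OrientedLoop G} (ho : ∀ α, (o α).toLoop = α)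
    {h : Multiset (S × S) → ℂ} (hh : IsAdmissible G h) {m n : ℕ} (hm : 0 < m) (hmn : m ≤ n) :
    sumLists m (fun l : List (Λ × Bool) => h (G.wedges l)) =
      ∑ α ∈ loopsOfLengthLE ho n, ∑ k ∈ Finset.Icc 1 n,
        if k * loopLength o α = m then 2 * loopLength o α * h (k • loopWedges o α) else 0 := by
  classical
  rw [sumLists_eq_sum]
  have h1 : ∀ α ∈ loopsOfLengthLE ho n, ∀ k ∈ Finset.Icc 1 n,
      (if k * loopLength o α = m then 2 * loopLength o α * h (k • loopWedges o α) else 0) =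
      ∑ b : Bool, ∑ r ∈ Finset.range n, if k * loopLength o α = m ∧ r < loopLength o α ∧
        G.IsReduced (o α).links then h (k • loopWedges o α) else 0 := by
    intro α hα k hk
    rw [mem_loopsOfLengthLE] at hα
    rw [Finset.mem_Icc] at hk
    by_cases hkm : k * loopLength o α = m
    · by_cases hred : G.IsReduced (o α).links
      · simp only [hkm, hred, true_and, and_true, if_true]
        rw [← Finset.sum_filter, Finset.sum_const, Finset.sum_const]
        have : {r ∈ Finset.range n | r < loopLength o α} = Finset.range (loopLength o α) := by
          ext r; simp; omega
        rw [this]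
        simp [mul_assoc]
      · rw [loopWedges, hh.eq_zero_of_not_isReduced hred (by omega)]
        simp
    · simp [hkm]
  rw [Finset.sum_congr rfl fun α hα => Finset.sum_congr rfl fun k hk => h1 α hα k hk]
  have h2 : ∀ f : Loop G → ℕ → Bool → ℕ → ℂ, ∑ α ∈ loopsOfLengthLE ho n, ∑ k ∈ Finset.Icc 1 n,
      ∑ b : Bool, ∑ r ∈ Finset.range n, f α k b r =
      ∑ x ∈ loopsOfLengthLE ho n ×ˢ Finset.Icc 1 n ×ˢ (Finset.univ : Finset Bool) ×ˢ
        Finset.range n, f x.1 x.2.1 x.2.2.1 x.2.2.2 := by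
    intro f
    simp only [Finset.sum_product]
  rw [h2, ← Finset.sum_filter]
  have h3 : ∑ l ∈ (List.finite_length_eq (Λ × Bool) m).toFinset, h (G.wedges l) =
      -- Walks that backtrack or jump between nodes have $h=0$; the correspondence with based loops
      -- is needed only on reduced walks.
      ∑ l ∈ (List.finite_length_eq (Λ × Bool) m).toFinset with G.IsReduced l, h (G.wedges l) := by
    rw [Finset.sum_filter]
    refine Finset.sum_congr rfl fun l _ => ?_
    split_ifs with hl
    · rfl
    · simpa using hh.eq_zero_of_not_isReduced hl one_pos
  rw [h3]
  symm
  refine Finset.sum_bij (fun x _ => listPow (basedLoop o x.1 x.2.2.1 x.2.2.2) x.2.1) ?_ ?_ ?_ ?_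
  · rintro ⟨α, k, b, r⟩ hx
    simp only [Finset.mem_filter, Finset.mem_product, Finset.mem_Icc] at hx
    obtain ⟨⟨-, hk, -, -⟩, hkm, -, hred⟩ := hx
    obtain ⟨k, rfl⟩ := Nat.exists_eq_add_of_le' hk.1
    simp only [Finset.mem_filter, Set.Finite.mem_toFinset, Set.mem_ofPred_eq, length_listPow,
      length_basedLoop, hkm, isReduced_listPow_succ, isReduced_basedLoop, hred, and_self]
  · rintro ⟨α, k, b, r⟩ hx ⟨β, j, c, s⟩ hy hxy
    simp only [Finset.mem_filter, Finset.mem_product, Finset.mem_Icc] at hx hy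
    obtain ⟨⟨-, hk, -, -⟩, hkm, hr, hred⟩ := hx
    obtain ⟨⟨-, hj, -, -⟩, hjm, hs, -⟩ := hy
    obtain ⟨k, rfl⟩ := Nat.exists_eq_add_of_le' hk.1
    obtain ⟨j, rfl⟩ := Nat.exists_eq_add_of_le' hj.1
    obtain ⟨h4, rfl⟩ := listPow_inj (isPrimitive_basedLoop o α b r)
      (isPrimitive_basedLoop o β c s) hxy
    obtain ⟨rfl, rfl, rfl⟩ := basedLoop_inj ho hred hr hs h4
    rfl
  · intro l hl
    simp only [Finset.mem_filter, Set.Finite.mem_toFinset, Set.mem_ofPred_eq] at hl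
    obtain ⟨hlm, hred⟩ := hl
    obtain ⟨u, k, hu, rfl⟩ := exists_primitive_root (List.length_pos_iff_ne_nil.mp (hlm ▸ hm))
    have hured := isReduced_listPow_succ.mp hred
    -- The primitive root of a reduced closed walk is a non-repeating loop, its wedges being among
    -- those of the walk.
    let p : OrientedLoop G := ⟨u, hu.1, fun w hw => (hured w hw).1, hu.2⟩
    obtain ⟨b, r, hr, hp⟩ := exists_basedLoop ho p
    have hlen : u.length = loopLength o p.toLoop := by
      rw [show u = p.links from rfl, hp, length_basedLoop]
    rw [length_listPow, hlen] at hlm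
    have hpos := loopLength_pos o p.toLoop
    have hle : loopLength o p.toLoop ≤ n := by nlinarith
    have hkn : k + 1 ≤ n := by nlinarith
    have hured2 : G.IsReduced (o p.toLoop).links := by
      rw [← isReduced_basedLoop b r, ← hp]
      exact hured
    refine ⟨(p.toLoop, k + 1, b, r), ?_, ?_⟩
    · simp only [Finset.mem_filter, Finset.mem_product, Finset.mem_Icc, mem_loopsOfLengthLE,
        Finset.mem_range, Finset.mem_univ]
      exact ⟨⟨hle, ⟨by omega, hkn⟩, trivial, hr.trans_le hle⟩, hlm, hr, hured2⟩
    · simp only [← hp]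
      rfl
  · rintro ⟨α, k, b, r⟩ _
    simp only [G.wedges_listPow, coe_listPow, hh.flip.nsmul_wedges_basedLoop]

/-- The pairs $(\alpha,k)$ of `multiloopSum_recursion` are grouped by $k|\alpha|=m+1$. By
`sumLists_wedges` each group is a sum over closed walks of that length, which gives the recursion
satisfied by `wedgeSum`. -/
theorem two_mul_multiloopSum {o : Loop G → OrientedLoop G} (ho : ∀ α, (o α).toLoop = α)
    {g : Multiset (S × S) → ℂ} (hg : IsAdmissible G g) (n : ℕ) :
    (2 * (n + 1)) * multiloopSum ho (n + 1) g =
      ∑ m ∈ Finset.range (n + 1), sumLists (m + 1) fun l : List (Λ × Bool) =>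
        multiloopSum ho (n - m) fun W => g (G.wedges l + W) := by
  have hadm : ∀ j, IsAdmissible G fun V => multiloopSum ho j fun W => g (V + W) := by
    intro j
    refine ⟨fun a b V => ?_, fun i V => ?_, fun a b V h => ?_⟩
    · refine Finset.sum_congr rfl fun Φ _ => ?_
      simp only [Multiset.cons_add, hg.flip a b]
    · refine Finset.sum_eq_zero fun Φ _ => ?_
      simp only [Multiset.cons_add, hg.self i]
    · refine Finset.sum_eq_zero fun Φ _ => ?_
      simp only [Multiset.cons_add, hg.node a b _ h]
  have h1 : ∀ m ∈ Finset.range (n + 1), sumLists (m + 1) (fun l : List (Λ × Bool) =>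
        multiloopSum ho (n - m) fun W => g (G.wedges l + W)) =
      ∑ α ∈ loopsOfLengthLE ho (n + 1), ∑ k ∈ Finset.Icc 1 (n + 1),
        if k * loopLength o α = m + 1 then 2 * loopLength o α *
          multiloopSum ho (n - m) (fun W => g (k • loopWedges o α + W)) else 0 := by
    intro m hm
    rw [Finset.mem_range] at hm
    exact sumLists_wedges ho (hadm (n - m)) (Nat.succ_pos m) hm
  rw [Finset.sum_congr rfl h1, Finset.sum_comm, mul_assoc, ← Nat.cast_add_one,
    multiloopSum_recursion, Finset.mul_sum]
  refine Finset.sum_congr rfl fun α _ => ?_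
  rw [Finset.sum_comm, Finset.mul_sum]
  refine Finset.sum_congr rfl fun k hk => ?_
  rw [Finset.mem_Icc] at hk
  have hpos : 0 < k * loopLength o α := Nat.mul_pos hk.1 (loopLength_pos o α)
  split_ifs with hle
  · rw [Finset.sum_eq_single (k * loopLength o α - 1)]
    · rw [if_pos (by omega), show n - (k * loopLength o α - 1) = n + 1 - k * loopLength o α by omega,
        mul_assoc]
    · intro m _ hm
      rw [if_neg (by omega)]
    · intro h
      rw [Finset.mem_range] at h
      omega
  · rw [mul_zero]
    refine (Finset.sum_eq_zero fun m hm => ?_).symm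
    rw [Finset.mem_range] at hm
    rw [if_neg (by omega)]

/-- Sums over multiloops as sums over sequences of wedges weighted by the number of their
strandings. -/
theorem multiloopSum_eq_wedgeSum [Fintype S] [DecidableEq S] {o : Loop G → OrientedLoop G}
    (ho : ∀ α, (o α).toLoop = α) {g : Multiset (S × S) → ℂ} (hg : IsAdmissible G g) (n : ℕ) :
    multiloopSum ho n g = wedgeSum G n g := by
  induction n using Nat.strong_induction_on generalizing g with
  | _ n ih =>
    rcases n with _ | n
    · rw [multiloopSum_zero, wedgeSum, sumLists_zero]
      simp [seedDegree_zero, strandingCount]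
    · have h : (2 * (n + 1) : ℂ) ≠ 0 := mul_ne_zero two_ne_zero (Nat.cast_add_one_ne_zero n)
      apply mul_left_cancel₀ h
      rw [two_mul_multiloopSum ho hg, wedgeSum_recursion G n hg.flip]
      refine Finset.sum_congr rfl fun m hm => sumLists_congr fun l _ => ?_
      exact ih (n - m) (by omega) (hg.add_left _)

end ClosedWalks

/-! ### Annihilators as shifts; spinor indices of wedges -/

section Normalized

variable {S Λ N : Type*} [Fintype S] [DecidableEq S]

/-- The amplitudes in the unnormalized basis `∏ (a_k†)^{ν_k} / ν_k! |0⟩`, on which annihilation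
operators act as shifts. -/
def normalized (χ : Amp S) : Amp S := fun ν => (∏ k, (Real.sqrt ((ν k).factorial) : ℂ)) * χ ν

theorem normalized_annihilation (k : S × Fin 2) (χ : Amp S) (ν : Occ S) :
    normalized (annihilation k χ) ν = normalized χ (ν + Pi.single k 1) := by
  have : ∀ j, (Real.sqrt (((ν + Pi.single k 1 : Occ S) j).factorial) : ℂ) =
      (if j = k then (Real.sqrt (ν k + 1) : ℂ) else 1) * (Real.sqrt ((ν j).factorial) : ℂ) := by
    intro j
    split_ifs with h
    · subst h
      rw [Pi.add_apply, Pi.single_eq_same, Nat.factorial_succ, Nat.cast_mul,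
        Real.sqrt_mul (by positivity)]
      push_cast
      rfl
    · simp [h]
  rw [normalized, normalized, Finset.prod_congr rfl fun j _ => this j, Finset.prod_mul_distrib,
    Finset.prod_ite_eq', if_pos (Finset.mem_univ _), annihilation_apply]
  ring

theorem normalized_zero (χ : Amp S) : normalized χ 0 = χ 0 := by
  simp [normalized]

theorem normalized_sub (χ χ' : Amp S) : normalized (χ - χ') = normalized χ - normalized χ' := by
  funext ν
  simp [normalized, mul_sub]

theorem normalized_wedgeAnnihilation [DecidableEq N] (G : SeedGraph S Λ N) {w : S × S}
    (hw : G.node w.1 = G.node w.2) (χ : Amp S) (ν : Occ S) :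
    normalized (wedgeAnnihilation G w χ) ν = ∑ a, ∑ b, eps a b *
      normalized χ (ν + (Pi.single (w.1, a) 1 + Pi.single (w.2, b) 1)) := by
  rw [wedgeAnnihilation, if_pos hw, LinearMap.sub_apply, normalized_sub, Module.End.mul_apply,
    Module.End.mul_apply, Pi.sub_apply]
  simp only [normalized_annihilation, Fin.sum_univ_two, eps, add_assoc]
  simp
  ring

/-- The occupation numbers of the spinor indices `A` of a list of wedges. -/
def slotOcc (W : List (S × S)) (A : Slot W → Fin 2) : Occ S :=
  ∑ x, Pi.single (slotSeed W x, A x) 1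

/-- Indices of a nonempty list of wedges. -/
def slotConsEquiv (w : S × S) (W : List (S × S)) :
    (Slot (w :: W) → Fin 2) ≃ (Fin 2 × Fin 2) × (Slot W → Fin 2) where
  toFun A := ((A (0, 0), A (0, 1)), fun x => A (x.1.succ, x.2))
  invFun p x := Fin.cases (motive := fun _ => Fin 2) (if x.2 = 0 then p.1.1 else p.1.2)
    (fun r => p.2 (r, x.2)) x.1
  left_inv A := by
    funext ⟨r, c⟩
    refine Fin.cases ?_ (fun r => ?_) r
    · fin_cases c <;> rfl
    · rfl
  right_inv p := rfl

theorem slotOcc_cons (w : S × S) (W : List (S × S)) (A : Slot (w :: W) → Fin 2) :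
    slotOcc (w :: W) A = Pi.single (w.1, A (0, 0)) 1 + Pi.single (w.2, A (0, 1)) 1 +
      slotOcc W (slotConsEquiv w W A).2 := by
  rw [slotOcc, slotOcc, Fintype.sum_prod_type, Fintype.sum_prod_type]
  erw [Fin.sum_univ_succ]
  simp only [Fin.sum_univ_two]
  rfl

/-- Every wedge contributes one $\epsilon_{AB}$ and shifts the occupation by its two indices, so
iteration produces a sum over all index assignments. -/
theorem normalized_wedgesAnnihilation [DecidableEq N] (G : SeedGraph S Λ N) {W : List (S × S)}
    (hW : ∀ w ∈ W, G.node w.1 = G.node w.2) (χ : Amp S) (ν : Occ S) :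
    normalized (wedgesAnnihilation G W χ) ν = ∑ A : Slot W → Fin 2,
      (∏ r : Fin W.length, eps (A (r, 0)) (A (r, 1))) * normalized χ (ν + slotOcc W A) := by
  induction W generalizing ν with
  | nil =>
    haveI : IsEmpty (Fin ([] : List (S × S)).length) := inferInstanceAs (IsEmpty (Fin 0))
    rw [Fintype.sum_unique]
    simp [wedgesAnnihilation_nil, slotOcc]
  | cons w W ih =>
    rw [wedgesAnnihilation_cons, Module.End.mul_apply,
      normalized_wedgeAnnihilation G (hW w (by simp)),
      ← (slotConsEquiv w W).symm.sum_comp, Fintype.sum_prod_type, Fintype.sum_prod_type]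
    refine Finset.sum_congr rfl fun a _ => Finset.sum_congr rfl fun b _ => ?_
    rw [ih (fun v hv => hW v (by simp [hv])), Finset.mul_sum]
    refine Finset.sum_congr rfl fun A _ => ?_
    rw [slotOcc_cons, Equiv.apply_symm_apply, ← mul_assoc]
    congr 1
    · erw [Fin.prod_univ_succ]
      rfl
    · rw [add_assoc ν]
      rfl

theorem slotOcc_apply (W : List (S × S)) (A : Slot W → Fin 2) (i : S) (c : Fin 2) :
    slotOcc W A (i, c) = Fintype.card {x : {x // slotSeed W x = i} // A x = c} := by
  rw [slotOcc, Finset.sum_apply, Fintype.card_subtype, Finset.card_filter]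
  simp only [Pi.single_apply, Prod.mk.injEq]
  rw [← Finset.sum_subtype {x | slotSeed W x = i} (by simp)
    (f := fun x => if A x = c then 1 else 0), Finset.sum_filter]
  refine Finset.sum_congr rfl fun x _ => ?_
  simp only [eq_comm (a := i), eq_comm (a := c), ite_and]

theorem card_slots (W : List (S × S)) (i : S) :
    Fintype.card {x // slotSeed W x = i} = seedDegree W i := by
  rw [Fintype.card_subtype, Finset.card_filter]
  induction W with
  | nil => simp [seedDegree_zero]
  | cons w W ih =>
    rw [← Multiset.cons_coe, seedDegree_cons, Pi.add_apply, ← ih, Fintype.sum_prod_type,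
      Fintype.sum_prod_type]
    erw [Fin.sum_univ_succ]
    simp only [Fin.sum_univ_two, Pi.add_apply, Pi.single_apply, eq_comm (a := i)]
    rfl

end Normalized

/-! ### Permanents of a two by two matrix with repeated rows and columns -/

section Permanents

open Polynomial

variable {X Y : Type*} [Fintype X] [Fintype Y] [DecidableEq X] [DecidableEq Y]

/-- When the fibres match, the admissible bijections are a torsor under the stabilizer of $A$, a
product of two symmetric groups. -/
theorem card_equiv_comp_eq (hXY : Fintype.card X = Fintype.card Y) (A' : X → Fin 2) (A : Y → Fin 2) :
    Fintype.card {e : X ≃ Y // ∀ x, A (e x) = A' x} =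
      if Fintype.card {x // A' x = 0} = Fintype.card {y // A y = 0} then
        (Fintype.card {y // A y = 0}).factorial * (Fintype.card {y // A y = 1}).factorial
      else 0 := by
  split_ifs with h
  · have h1 : Fintype.card {x // A' x = 1} = Fintype.card {y // A y = 1} := by
      have h2 := Fintype.card_congr (Equiv.sigmaFiberEquiv A')
      have h3 := Fintype.card_congr (Equiv.sigmaFiberEquiv A)
      rw [Fintype.card_sigma, Fin.sum_univ_two] at h2 h3
      omega
    have hfib : ∀ c, Nonempty ({x // A' x = c} ≃ {y // A y = c}) := by
      intro c
      fin_cases c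
      · exact ⟨Fintype.equivOfCardEq h⟩
      · exact ⟨Fintype.equivOfCardEq h1⟩
    let e₀ : X ≃ Y := Equiv.ofFiberEquiv fun c => (hfib c).some
    have he₀ : ∀ x, A (e₀ x) = A' x := fun x => Equiv.ofFiberEquiv_map _ x
    have h4 : Fintype.card {e : X ≃ Y // ∀ x, A (e x) = A' x} =
        Fintype.card {g : Equiv.Perm Y // A ∘ g = A} := by
      refine Fintype.card_congr
        { toFun := fun e => ⟨e₀.symm.trans e.1, ?_⟩
          invFun := fun g => ⟨e₀.trans g.1, ?_⟩
          left_inv := fun e => by ext; simp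
          right_inv := fun g => by ext; simp }
      · funext y
        simp [e.2, ← he₀]
      · intro x
        have := congrFun g.2 (e₀ x)
        simp only [Function.comp_apply] at this
        simp [this, he₀]
    rw [h4, DomMulAct.stabilizer_card, Fin.prod_univ_two]
  · rw [Fintype.card_eq_zero_iff]
    refine ⟨fun e => h (Fintype.card_congr (e.1.subtypeEquiv fun x => ?_))⟩
    rw [e.2]

/-- Bijections are grouped by the labelling $A'=A\circ e$ they induce on $X$. Expanding the product
of linear forms enumerates the same labellings, with the power of the variable counting the label
$0$. This identifies $D^{(j)}(H)$, up to factorials, with a sum over joinings of strands. -/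
theorem sum_equiv_prod (H : Matrix (Fin 2) (Fin 2) ℂ) (hXY : Fintype.card X = Fintype.card Y)
    (B : X → Fin 2) (A : Y → Fin 2) :
    ∑ e : X ≃ Y, ∏ x, H (A (e x)) (B x) =
      (Fintype.card {y // A y = 0}).factorial * (Fintype.card {y // A y = 1}).factorial *
        ((C (H 0 0) * Polynomial.X + C (H 1 0)) ^ Fintype.card {x // B x = 0} *
          (C (H 0 1) * Polynomial.X + C (H 1 1)) ^ Fintype.card {x // B x = 1}).coeff
            (Fintype.card {y // A y = 0}) := by
  have h1 : (C (H 0 0) * Polynomial.X + C (H 1 0)) ^ Fintype.card {x // B x = 0} *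
      (C (H 0 1) * Polynomial.X + C (H 1 1)) ^ Fintype.card {x // B x = 1} =
      ∏ x, (C (H 0 (B x)) * Polynomial.X + C (H 1 (B x))) := by
    rw [← Finset.prod_fiberwise_of_maps_to (g := B) (t := Finset.univ) (by simp), Fin.prod_univ_two,
      Fintype.card_subtype, Fintype.card_subtype]
    congr 1
    · rw [Finset.prod_congr rfl (g := fun _ => C (H 0 0) * Polynomial.X + C (H 1 0)),
        Finset.prod_const]
      intro x hx
      rw [(Finset.mem_filter.mp hx).2]
    · rw [Finset.prod_congr rfl (g := fun _ => C (H 0 1) * Polynomial.X + C (H 1 1)),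
        Finset.prod_const]
      intro x hx
      rw [(Finset.mem_filter.mp hx).2]
  have h2 : ∀ x, C (H 0 (B x)) * Polynomial.X + C (H 1 (B x)) =
      ∑ c : Fin 2, C (H c (B x)) * Polynomial.X ^ (if c = 0 then 1 else 0) := by
    intro x
    simp [Fin.sum_univ_two]
  have h3 : ∀ (k : ℕ), (∏ x, (C (H 0 (B x)) * Polynomial.X + C (H 1 (B x)))).coeff k =
      ∑ A' : X → Fin 2, if Fintype.card {x // A' x = 0} = k then ∏ x, H (A' x) (B x) else 0 := by
    intro k
    rw [Finset.prod_congr rfl fun x _ => h2 x, Finset.prod_univ_sum, Fintype.piFinset_univ,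
      Polynomial.finsetSum_coeff]
    refine Finset.sum_congr rfl fun A' _ => ?_
    rw [Finset.prod_mul_distrib, ← map_prod, Finset.prod_pow_eq_pow_sum, Polynomial.coeff_C_mul,
      Polynomial.coeff_X_pow, ← Finset.card_filter, Fintype.card_subtype]
    simp [eq_comm]
  rw [h1, h3, Finset.mul_sum,
    ← Finset.sum_fiberwise_of_maps_to (g := fun e : X ≃ Y => fun x => A (e x))
      (t := Finset.univ) (by simp)]
  refine Finset.sum_congr rfl fun A' _ => ?_
  rw [Finset.sum_congr rfl (g := fun _ => ∏ x, H (A' x) (B x)), Finset.sum_const, nsmul_eq_mul]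
  · have h4 := card_equiv_comp_eq hXY A' A
    rw [Fintype.card_subtype] at h4
    simp only [funext_iff]
    rw [h4]
    split_ifs <;> push_cast <;> simp
  · intro e he
    rw [Finset.mem_filter] at he
    refine Finset.prod_congr rfl fun x _ => ?_
    rw [← congrFun he.2 x]

end Permanents

/-! ### Strandings as independent bijections on the links -/

section Strandings

variable {S Λ N : Type*} [Fintype Λ] [DecidableEq S]

/-- The bijections between source and target indices of a stranding. -/
def strandingEquiv (G : SeedGraph S Λ N) (W : List (S × S)) (σ : Equiv.Perm (Slot W))
    (hσ : σ ∈ strandings G W) (ℓ : Λ) :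
    {x // slotSeed W x = G.source ℓ} ≃ {x // slotSeed W x = G.target ℓ} where
  toFun x := ⟨σ x, ((Finset.mem_filter.mp hσ).2.2 x ℓ).mp x.2⟩
  invFun y := ⟨σ y, ((Finset.mem_filter.mp hσ).2.2 (σ y) ℓ).mpr (by
    rw [(Finset.mem_filter.mp hσ).2.1]; exact y.2)⟩
  left_inv x := Subtype.ext ((Finset.mem_filter.mp hσ).2.1 x)
  right_inv y := Subtype.ext ((Finset.mem_filter.mp hσ).2.1 y)

theorem exists_stranding (G : SeedGraph S Λ N) (W : List (S × S))
    (e : ∀ ℓ, {x // slotSeed W x = G.source ℓ} ≃ {x // slotSeed W x = G.target ℓ}) :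
    ∃ σ, ∃ hσ : σ ∈ strandings G W, ∀ ℓ, strandingEquiv G W σ hσ ℓ = e ℓ := by
  have hcase : ∀ x, (∃ ℓ, slotSeed W x = G.source ℓ) ∨ ∃ ℓ, slotSeed W x = G.target ℓ := by
    intro x
    obtain ⟨ℓ | ℓ, h⟩ := G.bijective_ends.2 (slotSeed W x)
    · exact Or.inl ⟨ℓ, h.symm⟩
    · exact Or.inr ⟨ℓ, h.symm⟩
  -- The prescriptions never conflict, because each seed is an end of exactly one link, and only on
  -- one side.
  have hex : ∀ x, ∃ y, (∀ ℓ (h : slotSeed W x = G.source ℓ), y = (e ℓ ⟨x, h⟩ : Slot W)) ∧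
      ∀ ℓ (h : slotSeed W x = G.target ℓ), y = ((e ℓ).symm ⟨x, h⟩ : Slot W) := by
    intro x
    rcases hcase x with ⟨ℓ, h⟩ | ⟨ℓ, h⟩
    · refine ⟨e ℓ ⟨x, h⟩, fun m hm => ?_, fun m hm => ?_⟩
      · obtain rfl := G.source_injective (h.symm.trans hm)
        rfl
      · exact absurd (h.symm.trans hm) (G.source_ne_target ℓ m)
    · refine ⟨(e ℓ).symm ⟨x, h⟩, fun m hm => ?_, fun m hm => ?_⟩
      · exact absurd (hm.symm.trans h) (G.source_ne_target m ℓ)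
      · obtain rfl := G.target_injective (h.symm.trans hm)
        rfl
  choose f hfs hft using hex
  have hinv : Function.Involutive f := by
    intro x
    rcases hcase x with ⟨ℓ, h⟩ | ⟨ℓ, h⟩
    · have h2 : slotSeed W (f x) = G.target ℓ := by rw [hfs x ℓ h]; exact (e ℓ ⟨x, h⟩).2
      rw [hft (f x) ℓ h2]
      simp only [hfs x ℓ h, Subtype.coe_eta, Equiv.symm_apply_apply]
    · have h2 : slotSeed W (f x) = G.source ℓ := by rw [hft x ℓ h]; exact ((e ℓ).symm ⟨x, h⟩).2
      rw [hfs (f x) ℓ h2]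
      simp only [hft x ℓ h, Subtype.coe_eta, Equiv.apply_symm_apply]
  have hmem : hinv.toPerm ∈ strandings G W := by
    rw [strandings, Finset.mem_filter]
    refine ⟨Finset.mem_univ _, hinv, fun x ℓ => ⟨fun h => ?_, fun h => ?_⟩⟩
    · change slotSeed W (f x) = _
      rw [hfs x ℓ h]
      exact (e ℓ ⟨x, h⟩).2
    · change slotSeed W (f x) = _ at h
      have h2 := hft (f x) ℓ h
      rw [hinv] at h2
      rw [h2]
      exact ((e ℓ).symm ⟨f x, h⟩).2
  refine ⟨hinv.toPerm, hmem, fun ℓ => Equiv.ext fun x => Subtype.ext ?_⟩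
  exact hfs x ℓ x.2

theorem strandingEquiv_inj (G : SeedGraph S Λ N) (W : List (S × S)) {σ τ : Equiv.Perm (Slot W)}
    (hσ : σ ∈ strandings G W) (hτ : τ ∈ strandings G W)
    (h : ∀ ℓ, strandingEquiv G W σ hσ ℓ = strandingEquiv G W τ hτ ℓ) : σ = τ := by
  refine Equiv.ext fun x => ?_
  obtain ⟨ℓ | ℓ, hx⟩ := G.bijective_ends.2 (slotSeed W x)
  · exact congrArg Subtype.val (Equiv.congr_fun (h ℓ) ⟨x, hx.symm⟩)
  · exact congrArg Subtype.val (Equiv.congr_fun (congrArg Equiv.symm (h ℓ)) ⟨x, hx.symm⟩)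

/-- A stranding is a free choice of one bijection per link, so the sum of products factors over the
links. -/
theorem sum_strandings [DecidableEq Λ] (G : SeedGraph S Λ N) (W : List (S × S))
    (f : Λ → Slot W → Slot W → ℂ) :
    ∑ σ ∈ strandings G W, ∏ ℓ, ∏ x with slotSeed W x = G.source ℓ, f ℓ x (σ x) =
      ∏ ℓ, ∑ e : {x // slotSeed W x = G.source ℓ} ≃ {x // slotSeed W x = G.target ℓ},
        ∏ x : {x // slotSeed W x = G.source ℓ}, f ℓ x (e x) := by
  rw [Finset.prod_univ_sum, Fintype.piFinset_univ]
  refine Finset.sum_bij (fun σ hσ ℓ => strandingEquiv G W σ hσ ℓ) (fun _ _ => Finset.mem_univ _)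
    (fun σ hσ τ hτ h => strandingEquiv_inj G W hσ hτ (congrFun h)) (fun e _ => ?_) ?_
  · obtain ⟨σ, hσ, h⟩ := exists_stranding G W e
    exact ⟨σ, hσ, funext h⟩
  · intro σ hσ
    refine Finset.prod_congr rfl fun ℓ _ => ?_
    exact Finset.prod_subtype _ (by simp) _

end Strandings

/-! ### The contraction with the heat kernel state -/

section HeatKernelContraction

variable {S Λ N : Type*} [Fintype S] [DecidableEq S] [Fintype Λ]

omit [DecidableEq S] in
theorem SeedGraph.prod_seeds (G : SeedGraph S Λ N) (f : S → ℂ) :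
    ∏ i, f i = ∏ ℓ, f (G.target ℓ) * f (G.source ℓ) := by
  rw [← G.bijective_ends.prod_comp, Fintype.prod_sum_type, mul_comm, ← Finset.prod_mul_distrib]
  rfl

/-- The square roots at the source cancel those in the denominator of $D^{(j)}$, and those at the
target complete theirs to factorials: the form in which `sum_equiv_prod` applies. -/
theorem sqrt_mul_linkAmplitude (t : ℝ) (H : Matrix (Fin 2) (Fin 2) ℂ) (p q : Fin 2 → ℕ) :
    ((Real.sqrt (p 0).factorial * Real.sqrt (p 1).factorial : ℂ) *
      (Real.sqrt (q 0).factorial * Real.sqrt (q 1).factorial)) * linkAmplitude t H p q =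
    if p 0 + p 1 = q 0 + q 1 then (heatWeight t (p 0 + p 1) : ℂ) *
      ((p 0).factorial * (p 1).factorial *
        ((Polynomial.C (H 0 0) * Polynomial.X + Polynomial.C (H 1 0)) ^ q 0 *
      (Polynomial.C (H 0 1) * Polynomial.X + Polynomial.C (H 1 1)) ^ q 1).coeff (p 0)) else 0 := by
  rw [linkAmplitude]
  split_ifs with h
  · have h1 : p 0 + p 1 - p 0 = p 1 := by omega
    have h2 : p 0 + p 1 - q 0 = q 1 := by omega
    rw [wignerD, h1, h2]
    have hp : ∀ a b : ℕ, Real.sqrt (a.factorial * b.factorial) =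
        Real.sqrt a.factorial * Real.sqrt b.factorial := fun a b => Real.sqrt_mul (by positivity) _
    rw [hp, hp]
    have hs : ∀ a : ℕ, (Real.sqrt a.factorial : ℂ) ≠ 0 := by
      intro a
      rw [Complex.ofReal_ne_zero]
      exact (Real.sqrt_pos.mpr (by exact_mod_cast a.factorial_pos)).ne'
    have hsq : ∀ a : ℕ, (a.factorial : ℂ) = Real.sqrt a.factorial * Real.sqrt a.factorial := by
      intro a
      rw [← Complex.ofReal_mul, Real.mul_self_sqrt (by positivity)]
      simp
    rw [hsq (p 0), hsq (p 1)]
    push_cast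
    have := hs (q 0)
    have := hs (q 1)
    field_simp
  · simp

/-- For fixed spinor indices each link amplitude is a heat weight times a sum over bijections of its
strands. An unbalanced link gives zero on both sides, having no bijections. The sum over strandings
is not averaged here, so $1/\prod_\ell(2j_\ell)!$ must be supplied by $(\epsilon\cdot H)$. -/
theorem wedgesAnnihilation_heatKernel [DecidableEq Λ] [DecidableEq N] (G : SeedGraph S Λ N)
    (H : Λ → Matrix.SpecialLinearGroup (Fin 2) ℂ) (t : Λ → ℝ) {W : List (S × S)}
    (hW : ∀ w ∈ W, G.node w.1 = G.node w.2) :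
    wedgesAnnihilation G W (heatKernelAmplitude G H t) 0 =
      (∏ ℓ, (heatWeight (t ℓ) (seedDegree W (G.target ℓ)) : ℂ)) *
        ∑ σ ∈ strandings G W, contractAlong G H W σ := by
  simp only [contractAlong]
  rw [Finset.sum_comm, ← normalized_zero (wedgesAnnihilation G W _), normalized_wedgesAnnihilation G hW, Finset.mul_sum]
  refine Finset.sum_congr rfl fun A _ => ?_
  rw [← Finset.mul_sum, sum_strandings G W fun ℓ x y => (H ℓ : Matrix (Fin 2) (Fin 2) ℂ) (A y) (A x),
    mul_left_comm, zero_add]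
  congr 1
  rw [normalized, Fintype.prod_prod_type, G.prod_seeds, heatKernelAmplitude,
    ← Finset.prod_mul_distrib, ← Finset.prod_mul_distrib]
  refine Finset.prod_congr rfl fun ℓ _ => ?_
  simp only [Fin.prod_univ_two]
  refine (sqrt_mul_linkAmplitude (t ℓ) _ (fun c => slotOcc W A (G.target ℓ, c))
    (fun c => slotOcc W A (G.source ℓ, c))).trans ?_
  have hd : ∀ i, slotOcc W A (i, 0) + slotOcc W A (i, 1) = seedDegree W i := by
    intro i
    rw [slotOcc_apply, slotOcc_apply, ← card_slots]
    have := Fintype.card_congr (Equiv.sigmaFiberEquiv fun x : {x // slotSeed W x = i} => A x)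
    rwa [Fintype.card_sigma, Fin.sum_univ_two] at this
  simp only [hd]
  split_ifs with h
  · rw [← card_slots, ← card_slots] at h
    rw [sum_equiv_prod _ h.symm (fun x => A x) (fun y => A y)]
    simp only [slotOcc_apply]
  · rw [Finset.sum_eq_zero, mul_zero]
    intro e _
    rw [← card_slots, ← card_slots] at h
    exact absurd (Fintype.card_congr e).symm h

end HeatKernelContraction

/-! ### Elementary estimates -/

section Summability

open Filter Topology

/-- Ratio test: one step multiplies by a polynomial of degree $6$ in $d$ and by $e^{-c(2d+1)}$. The
cube leaves room for one factorial from $D^{(j)}$, one from $F_W\psi$ and one from the norm of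
$F_W^\dagger|0\rangle$. -/
theorem exists_bound_factorial_pow {c : ℝ} (hc : 0 < c) {B : ℝ} (hB : 0 < B) :
    ∃ K, ∀ d : ℕ, ((2 * d).factorial : ℝ) ^ 3 * B ^ d * Real.exp (-(c * d ^ 2)) ≤ K := by
  set u : ℕ → ℝ := fun d => ((2 * d).factorial : ℝ) ^ 3 * B ^ d * Real.exp (-(c * d ^ 2)) with hu
  have hpos : ∀ d, 0 < u d := by
    intro d
    have : (0 : ℝ) < (2 * d).factorial := by exact_mod_cast Nat.factorial_pos _
    positivity
  have hratio : ∀ d, u (d + 1) / u d =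
      ((2 * d + 1 : ℕ) * (2 * d + 2 : ℕ) : ℝ) ^ 3 * B * Real.exp (-(c * (2 * d + 1 : ℕ))) := by
    intro d
    rw [div_eq_iff (hpos d).ne']
    simp only [hu]
    have h1 : ((2 * (d + 1)).factorial : ℝ) =
        (2 * d + 1 : ℕ) * (2 * d + 2 : ℕ) * (2 * d).factorial := by
      rw [show 2 * (d + 1) = 2 * d + 1 + 1 by ring, Nat.factorial_succ, Nat.factorial_succ]
      push_cast
      ring
    have h2 : Real.exp (-(c * ((d + 1 : ℕ) : ℝ) ^ 2)) =
        Real.exp (-(c * (2 * d + 1 : ℕ))) * Real.exp (-(c * d ^ 2)) := by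
      rw [← Real.exp_add]
      congr 1
      push_cast
      ring
    rw [h1, h2, pow_succ B]
    ring
  have htend : Tendsto (fun d => u (d + 1) / u d) atTop (𝓝 0) := by
    have h1 : Tendsto (fun d : ℕ => c * (2 * d + 1 : ℕ)) atTop atTop := by
      refine Tendsto.const_mul_atTop hc (tendsto_natCast_atTop_atTop.comp ?_)
      exact tendsto_atTop_mono (fun d => by simp only [id]; omega) tendsto_id
    have h2 := (Real.tendsto_pow_mul_exp_neg_atTop_nhds_zero 6).comp h1
    have h3 := h2.const_mul (8 * B / c ^ 6)
    rw [mul_zero] at h3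
    refine squeeze_zero (fun d => (div_pos (hpos _) (hpos _)).le) (fun d => ?_) h3
    rw [hratio]
    simp only [Function.comp_apply]
    have h4 : (((2 * d + 1 : ℕ) : ℝ) * (2 * d + 2 : ℕ)) ^ 3 ≤ 8 * ((2 * d + 1 : ℕ) : ℝ) ^ 6 := by
      have h5 : ((2 * d + 2 : ℕ) : ℝ) ≤ 2 * (2 * d + 1 : ℕ) := by
        push_cast
        have : (0 : ℝ) ≤ d := Nat.cast_nonneg d
        linarith
      calc (((2 * d + 1 : ℕ) : ℝ) * (2 * d + 2 : ℕ)) ^ 3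
          ≤ (((2 * d + 1 : ℕ) : ℝ) * (2 * (2 * d + 1 : ℕ))) ^ 3 := by gcongr
        _ = 8 * ((2 * d + 1 : ℕ) : ℝ) ^ 6 := by ring
    calc _ ≤ 8 * ((2 * d + 1 : ℕ) : ℝ) ^ 6 * B * Real.exp (-(c * (2 * d + 1 : ℕ))) := by gcongr
      _ = _ := by
        rw [mul_pow]
        field_simp
  have hsum : Summable u := by
    refine summable_of_ratio_test_tendsto_lt_one zero_lt_one
      (Eventually.of_forall fun d => (hpos d).ne') ?_
    simpa only [Real.norm_of_nonneg (hpos _).le] using htend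
  obtain ⟨K, hK⟩ := hsum.tendsto_atTop_zero.bddAbove_range
  exact ⟨K, fun d => hK ⟨d, rfl⟩⟩

/-- Grouped by length, the sum is the geometric series of ratio $r|\beta|$. -/
theorem summable_pow_length {β : Type*} [Fintype β] {r : ℝ} (hr : 0 ≤ r)
    (hr1 : r * Fintype.card β < 1) : Summable fun l : List β => r ^ l.length := by
  have hlev : ∀ n, ∑ l ∈ (List.finite_length_eq β n).toFinset, r ^ l.length =
      (r * Fintype.card β) ^ n := by
    intro n
    rw [← sumLists_eq_sum]
    induction n with
    | zero => simp [sumLists_zero]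
    | succ n ih =>
      simp only [sumLists_succ, List.length_cons, pow_succ]
      simp only [mul_comm _ r, ← mul_sumLists, ih]
      simp
      ring
  have h0 : 0 ≤ r * Fintype.card β := by positivity
  refine summable_of_sum_le (c := ∑' n, (r * Fintype.card β) ^ n) (fun l => by positivity)
    fun s => ?_
  obtain ⟨N, hN⟩ : ∃ N, ∀ l ∈ s, l.length < N := by
    refine ⟨s.sup List.length + 1, fun l hl => Nat.lt_succ_of_le (Finset.le_sup hl)⟩
  rw [← Finset.sum_fiberwise_of_maps_to (t := Finset.range N) (g := List.length)
    fun l hl => Finset.mem_range.mpr (hN l hl)]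
  refine le_trans (Finset.sum_le_sum fun n _ => ?_)
    ((summable_geometric_of_lt_one h0 hr1).sum_le_tsum (Finset.range N) fun n _ => by positivity)
  rw [← hlev]
  refine Finset.sum_le_sum_of_subset_of_nonneg (fun l hl => ?_) fun l _ _ => by positivity
  simpa using (Finset.mem_filter.mp hl).2

theorem factorial_sum_le {ι : Type*} (s : Finset ι) (k : ι → ℕ) :
    (∑ i ∈ s, k i).factorial ≤ 2 ^ (s.card * ∑ i ∈ s, k i) * ∏ i ∈ s, (k i).factorial := by
  classical
  induction s using Finset.induction_on with
  | empty => simp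
  | insert a s ha ih =>
    rw [Finset.sum_insert ha, Finset.prod_insert ha, Finset.card_insert_of_notMem ha]
    set T := ∑ i ∈ s, k i
    have h1 : (k a + T).factorial ≤ 2 ^ (k a + T) * ((k a).factorial * T.factorial) := by
      rw [← Nat.add_choose_mul_factorial_mul_factorial, mul_assoc]
      exact Nat.mul_le_mul_right _ (Nat.choose_le_two_pow _ _)
    calc (k a + T).factorial ≤ 2 ^ (k a + T) * ((k a).factorial * T.factorial) := h1
      _ ≤ 2 ^ (k a + T) * ((k a).factorial *
          (2 ^ (s.card * T) * ∏ i ∈ s, (k i).factorial)) := by gcongr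
      _ = 2 ^ (k a + T + s.card * T) * ((k a).factorial * ∏ i ∈ s, (k i).factorial) := by
        rw [pow_add]; ring
      _ ≤ _ := by
        gcongr
        · norm_num
        · nlinarith [Nat.zero_le (s.card * k a)]

end Summability

/-! ### Decay of the heat kernel amplitudes -/

section AmplitudeBounds

open Polynomial in
theorem norm_coeff_linear_mul_le (a b : ℂ) {p : ℂ[X]} {K : ℝ} (hp : ∀ k, ‖p.coeff k‖ ≤ K) (k : ℕ) :
    ‖((C a * X + C b) * p).coeff k‖ ≤ (‖a‖ + ‖b‖) * K := by
  have hK : 0 ≤ K := (norm_nonneg _).trans (hp 0)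
  rw [add_mul, coeff_add, mul_assoc, coeff_C_mul, coeff_C_mul, add_mul]
  refine (norm_add_le _ _).trans (add_le_add ?_ ?_)
  · rw [norm_mul]
    refine mul_le_mul_of_nonneg_left ?_ (norm_nonneg _)
    rcases k with _ | k
    · simpa using hK
    · rw [coeff_X_mul]; exact hp k
  · rw [norm_mul]
    exact mul_le_mul_of_nonneg_left (hp k) (norm_nonneg _)

open Polynomial in
theorem norm_coeff_linear_pow_le {a b c d : ℂ} {h : ℝ} (h1 : ‖a‖ + ‖b‖ ≤ h) (h2 : ‖c‖ + ‖d‖ ≤ h)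
    (l m k : ℕ) : ‖((C a * X + C b) ^ l * (C c * X + C d) ^ m).coeff k‖ ≤ h ^ (l + m) := by
  have hh : 0 ≤ h := le_trans (by positivity) h1
  induction l generalizing k with
  | zero =>
    rw [pow_zero, one_mul, zero_add]
    induction m generalizing k with
    | zero =>
      rw [pow_zero, pow_zero, coeff_one]
      split_ifs <;> simp
    | succ m ih =>
      rw [pow_succ', pow_succ']
      exact (norm_coeff_linear_mul_le c d ih k).trans
        (mul_le_mul_of_nonneg_right h2 (pow_nonneg hh _))
  | succ l ih =>
    rw [pow_succ', mul_assoc, show l + 1 + m = l + m + 1 by ring, pow_succ']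
    exact (norm_coeff_linear_mul_le a b ih k).trans
      (mul_le_mul_of_nonneg_right h1 (pow_nonneg hh _))

theorem norm_wignerD_le {H : Matrix (Fin 2) (Fin 2) ℂ} {h : ℝ} (h1 : ‖H 0 0‖ + ‖H 1 0‖ ≤ h)
    (h2 : ‖H 0 1‖ + ‖H 1 1‖ ≤ h) {d k l : ℕ} (hk : k ≤ d) (hl : l ≤ d) :
    ‖wignerD d H k l‖ ≤ d.factorial * h ^ d := by
  rw [wignerD, norm_mul]
  refine mul_le_mul ?_ ?_ (norm_nonneg _) (by positivity)
  · rw [Complex.norm_real, Real.norm_of_nonneg (by positivity)]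
    have h3 : (1 : ℝ) ≤ Real.sqrt (l.factorial * (d - l).factorial) := by
      rw [Real.one_le_sqrt]
      exact_mod_cast Nat.mul_pos l.factorial_pos (d - l).factorial_pos
    refine (div_le_self (Real.sqrt_nonneg _) h3).trans ?_
    have h4 : (k.factorial * (d - k).factorial : ℝ) ≤ d.factorial := by
      have := Nat.le_of_dvd d.factorial_pos (Nat.factorial_mul_factorial_dvd_factorial hk)
      exact_mod_cast this
    refine (Real.sqrt_le_sqrt h4).trans ?_
    rw [Real.sqrt_le_left (by positivity)]
    have h5 : (1 : ℝ) ≤ d.factorial := by exact_mod_cast d.factorial_pos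
    nlinarith
  · have := norm_coeff_linear_pow_le h1 h2 l (d - l) k
    rwa [Nat.add_sub_cancel' hl] at this

theorem exists_bound_linkAmplitude {t : ℝ} (ht : 0 < t) (H : Matrix (Fin 2) (Fin 2) ℂ) {R : ℝ}
    (hR : 0 < R) : ∃ K, ∀ p q : Fin 2 → ℕ, p 0 + p 1 = q 0 + q 1 →
      ‖linkAmplitude t H p q‖ * (((2 * (p 0 + p 1)).factorial : ℝ) ^ 2 * R ^ (2 * (p 0 + p 1))) ≤ K := by
  set h : ℝ := ‖H 0 0‖ + ‖H 1 0‖ + (‖H 0 1‖ + ‖H 1 1‖) + 1 with hh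
  have hh0 : 0 < h := by positivity
  obtain ⟨K, hK⟩ := exists_bound_factorial_pow (c := t / 4) (by positivity)
    -- The $2$ absorbs $d+1\le2^d$, the $h$ the growth of $D^{(j)}(H)$, and $R^2$ the weight
    -- $R^{2d}$; the rate $t/4$ comes from $j^2=d^2/4$.
    (B := 2 * h * R ^ 2) (by positivity)
  refine ⟨K, fun p q hpq => (le_trans ?_ (hK (p 0 + p 1)))⟩
  have h1 : ‖H 0 0‖ + ‖H 1 0‖ ≤ h := by
    rw [hh]; linarith [norm_nonneg (H 0 1), norm_nonneg (H 1 1)]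
  have h2 : ‖H 0 1‖ + ‖H 1 1‖ ≤ h := by
    rw [hh]; linarith [norm_nonneg (H 0 0), norm_nonneg (H 1 0)]
  have h3 := norm_wignerD_le h1 h2 (d := p 0 + p 1) (k := p 0) (l := q 0) (by omega) (by omega)
  rw [linkAmplitude, if_pos hpq]
  generalize p 0 + p 1 = d at *
  rw [norm_mul, Complex.norm_real, heatWeight, Real.norm_of_nonneg (by positivity)]
  have h4 : Real.exp (-t * ((d / 2 : ℝ) * (d / 2 + 1))) ≤ Real.exp (-(t / 4 * d ^ 2)) := by
    apply Real.exp_le_exp.mpr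
    have : (0 : ℝ) ≤ t * d := by positivity
    nlinarith
  have h5 : (d + 1 : ℝ) ≤ 2 ^ d := by exact_mod_cast Nat.lt_two_pow_self (n := d)
  have h6 : (d.factorial : ℝ) ≤ (2 * d).factorial := by
    exact_mod_cast Nat.factorial_le (by omega)
  calc (d + 1 : ℝ) * Real.exp (-t * ((d / 2 : ℝ) * (d / 2 + 1))) * ‖wignerD d H (p 0) (q 0)‖ *
        (((2 * d).factorial : ℝ) ^ 2 * R ^ (2 * d))
      ≤ 2 ^ d * Real.exp (-(t / 4 * d ^ 2)) * ((2 * d).factorial * h ^ d) *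
        (((2 * d).factorial : ℝ) ^ 2 * R ^ (2 * d)) := by
        gcongr
        exact h3.trans (by gcongr)
    _ = ((2 * d).factorial : ℝ) ^ 3 * (2 * h * R ^ 2) ^ d * Real.exp (-(t / 4 * d ^ 2)) := by
        rw [mul_pow, mul_pow, ← pow_mul]
        ring

theorem exists_bound_heatKernel {S Λ N : Type*} [Fintype S] [Fintype Λ] (G : SeedGraph S Λ N)
    (H : Λ → Matrix.SpecialLinearGroup (Fin 2) ℂ) {t : Λ → ℝ} (ht : ∀ ℓ, 0 < t ℓ) {R : ℝ}
    (hR : 0 < R) : ∃ K, ∀ ν : Occ S,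
      ‖heatKernelAmplitude G H t ν‖ * (((∑ k, ν k).factorial : ℝ) ^ 2 * R ^ ∑ k, ν k) ≤ K := by
  -- The cost of splitting the squared factorial of the total number into factorials of the links,
  -- by `factorial_sum_le`; it is absorbed into $R$.
  set c : ℝ := 4 ^ Fintype.card Λ with hc
  choose K hK using fun ℓ => exists_bound_linkAmplitude (ht ℓ)
    (H ℓ : Matrix (Fin 2) (Fin 2) ℂ) (R := c * R) (by positivity)
  have hK0 : ∀ ℓ, 0 ≤ K ℓ := fun ℓ => le_trans (by positivity) (hK ℓ 0 0 rfl)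
  refine ⟨∏ ℓ, K ℓ, fun ν => ?_⟩
  by_cases hν : ∀ ℓ, ν (G.target ℓ, 0) + ν (G.target ℓ, 1) =
      ν (G.source ℓ, 0) + ν (G.source ℓ, 1)
  · set d : Λ → ℕ := fun ℓ => ν (G.target ℓ, 0) + ν (G.target ℓ, 1) with hd
    have hT : ∑ k, ν k = ∑ ℓ, 2 * d ℓ := by
      rw [Fintype.sum_prod_type, ← (Equiv.ofBijective _ G.bijective_ends).sum_comp,
        Fintype.sum_sum_type, ← Finset.sum_add_distrib]
      refine Finset.sum_congr rfl fun ℓ _ => ?_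
      simp only [Equiv.ofBijective_apply, Sum.elim_inl, Sum.elim_inr, Fin.sum_univ_two]
      rw [← hν ℓ, hd]
      ring
    have h1 : ((∑ ℓ, 2 * d ℓ).factorial : ℝ) ^ 2 ≤
        c ^ (∑ ℓ, 2 * d ℓ) * ∏ ℓ, ((2 * d ℓ).factorial : ℝ) ^ 2 := by
      have h2 : ((∑ ℓ, 2 * d ℓ).factorial : ℝ) ≤
          2 ^ (Fintype.card Λ * ∑ ℓ, 2 * d ℓ) * ∏ ℓ, ((2 * d ℓ).factorial : ℝ) := by
        exact_mod_cast factorial_sum_le Finset.univ fun ℓ => 2 * d ℓ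
      refine (pow_le_pow_left₀ (by positivity) h2 2).trans_eq ?_
      rw [mul_pow, ← Finset.prod_pow, hc, ← pow_mul, ← pow_mul, mul_comm _ 2, pow_mul]
      norm_num
    rw [hT, heatKernelAmplitude, norm_prod]
    calc _ ≤ (∏ ℓ, ‖linkAmplitude (t ℓ) (H ℓ : Matrix (Fin 2) (Fin 2) ℂ)
          (fun A => ν (G.target ℓ, A)) (fun A => ν (G.source ℓ, A))‖) *
          ((c ^ (∑ ℓ, 2 * d ℓ) * ∏ ℓ, ((2 * d ℓ).factorial : ℝ) ^ 2) * R ^ ∑ ℓ, 2 * d ℓ) := by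
          gcongr
      _ = ∏ ℓ, ‖linkAmplitude (t ℓ) (H ℓ : Matrix (Fin 2) (Fin 2) ℂ)
          (fun A => ν (G.target ℓ, A)) (fun A => ν (G.source ℓ, A))‖ *
          (((2 * d ℓ).factorial : ℝ) ^ 2 * (c * R) ^ (2 * d ℓ)) := by
          rw [Finset.prod_mul_distrib, Finset.prod_mul_distrib, Finset.prod_pow_eq_pow_sum, mul_pow]
          ring
      _ ≤ _ := Finset.prod_le_prod (fun ℓ _ => by positivity) fun ℓ _ => hK ℓ _ _ (hν ℓ)
  · push Not at hν
    obtain ⟨ℓ, hℓ⟩ := hν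
    rw [heatKernelAmplitude, Finset.prod_eq_zero (Finset.mem_univ ℓ) (if_neg hℓ), norm_zero,
      zero_mul]
    exact Finset.prod_nonneg fun ℓ _ => hK0 ℓ

theorem summable_pow_sum {ι : Type*} [Fintype ι] {r : ℝ} (hr : 0 ≤ r)
    (hr1 : r * Fintype.card ι < 1) : Summable fun ν : ι → ℕ => r ^ ∑ k, ν k := by
  classical
  set f : (ι → ℕ) → List ι := fun ν => (∑ k, Multiset.replicate (ν k) k).toList with hf
  have hinj : Function.Injective f := by
    intro ν μ h
    have h1 := congrArg (fun l : List ι => (l : Multiset ι)) h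
    simp only [hf, Multiset.coe_toList] at h1
    funext k
    have h2 := congrArg (Multiset.count k) h1
    simpa [Multiset.count_sum', Multiset.count_replicate] using h2
  refine ((summable_pow_length hr hr1).comp_injective hinj).congr fun ν => ?_
  simp [hf]

theorem memℓp_heatKernel {S Λ N : Type*} [Fintype S] [Fintype Λ] (G : SeedGraph S Λ N)
    (H : Λ → Matrix.SpecialLinearGroup (Fin 2) ℂ) {t : Λ → ℝ} (ht : ∀ ℓ, 0 < t ℓ) :
    Memℓp (heatKernelAmplitude G H t) 2 := by
  set R : ℝ := Fintype.card (S × Fin 2) + 1 with hR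
  have hR0 : 0 < R := by positivity
  obtain ⟨K, hK⟩ := exists_bound_heatKernel G H ht hR0
  refine Memℓp.of_exponent_ge (p := 2) (q := 1) (memℓp_gen ?_) one_le_two
  have hs : Summable fun ν : Occ S => K * R⁻¹ ^ ∑ k, ν k := by
    refine (summable_pow_sum (by positivity) ?_).mul_left K
    rw [inv_mul_lt_one₀ hR0, hR]
    linarith
  refine Summable.of_nonneg_of_le (fun ν => by positivity) (fun ν => ?_) hs
  rw [ENNReal.toReal_one, Real.rpow_one, inv_pow, ← div_eq_mul_inv, le_div_iff₀ (by positivity)]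
  refine le_trans ?_ (hK ν)
  have h1 : (1 : ℝ) ≤ ((∑ k, ν k).factorial : ℝ) ^ 2 :=
    one_le_pow₀ (by exact_mod_cast Nat.factorial_pos _)
  gcongr
  exact le_mul_of_one_le_left (by positivity) h1

end AmplitudeBounds

/-! ### Growth of wedge operators, and norms of wedge states -/

section WedgeBounds

variable {S Λ N : Type*} [Fintype S] [DecidableEq S] [DecidableEq N]

theorem sum_add_single {ι : Type*} [Fintype ι] [DecidableEq ι] (ν : ι → ℕ) (k : ι) :
    ∑ l, (ν + Pi.single k 1 : ι → ℕ) l = ∑ l, ν l + 1 := by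
  simp [Finset.sum_add_distrib]

theorem norm_annihilation_le (k : S × Fin 2) {n : ℕ} {χ : Amp S} {b : ℝ}
    (h : ∀ ν : Occ S, ∑ l, ν l = n + 1 → ‖χ ν‖ ≤ b) {ν : Occ S} (hν : ∑ l, ν l = n) :
    ‖annihilation k χ ν‖ ≤ (n + 1) * b := by
  rw [annihilation_apply, norm_mul, Complex.norm_real, Real.norm_of_nonneg (Real.sqrt_nonneg _)]
  refine mul_le_mul ?_ (h _ (by rw [sum_add_single, hν])) (norm_nonneg _) (by positivity)
  have h1 : (ν k : ℝ) ≤ n := by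
    rw [← hν]
    exact_mod_cast Finset.single_le_sum (f := ν) (fun _ _ => Nat.zero_le _) (Finset.mem_univ k)
  have h2 : (0 : ℝ) ≤ ν k := Nat.cast_nonneg _
  rw [Real.sqrt_le_left (by positivity)]
  nlinarith

theorem norm_wedgeAnnihilation_le (G : SeedGraph S Λ N) (w : S × S) {n : ℕ} {χ : Amp S} {b : ℝ}
    (hb : 0 ≤ b) (h : ∀ ν : Occ S, ∑ l, ν l = n + 2 → ‖χ ν‖ ≤ b) {ν : Occ S}
    (hν : ∑ l, ν l = n) : ‖wedgeAnnihilation G w χ ν‖ ≤ 2 * ((n + 1) * ((n + 2) * b)) := by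
  have h2 : ∀ k l, ‖annihilation k (annihilation l χ) ν‖ ≤ (n + 1) * ((n + 2) * b) := by
    intro k l
    refine norm_annihilation_le k (fun μ hμ => ?_) hν
    have := norm_annihilation_le l (n := n + 1) h hμ
    push_cast at this
    rwa [add_assoc, one_add_one_eq_two] at this
  unfold wedgeAnnihilation
  split_ifs
  · rw [LinearMap.sub_apply, Module.End.mul_apply, Module.End.mul_apply, Pi.sub_apply, two_mul]
    exact (norm_sub_le _ _).trans (add_le_add (h2 _ _) (h2 _ _))
  · simpa using by positivity

/-- A wedge arriving at level $n$ costs at most $2(n+1)(n+2)$, and these factors telescope to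
$2^{|W|}(n+2|W|)!/n!$. -/
theorem norm_wedgesAnnihilation_le (G : SeedGraph S Λ N) (W : List (S × S)) {n : ℕ} {χ : Amp S}
    {b : ℝ} (hb : 0 ≤ b) (h : ∀ ν : Occ S, ∑ l, ν l = n + 2 * W.length → ‖χ ν‖ ≤ b) {ν : Occ S}
    (hν : ∑ l, ν l = n) :
    n.factorial * ‖wedgesAnnihilation G W χ ν‖ ≤
      2 ^ W.length * (n + 2 * W.length).factorial * b := by
  induction W generalizing n ν with
  | nil =>
    simp only [List.length_nil, mul_zero, add_zero, pow_zero, one_mul] at h ⊢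
    exact mul_le_mul_of_nonneg_left (h ν hν) (by positivity)
  | cons w W ih =>
    have hf : (0 : ℝ) < (n + 2).factorial := by exact_mod_cast Nat.factorial_pos _
    rw [wedgesAnnihilation_cons, Module.End.mul_apply]
    simp only [List.length_cons] at h ⊢
    have h1 := norm_wedgeAnnihilation_le G w (n := n) (χ := wedgesAnnihilation G W χ)
      (b := 2 ^ W.length * (n + 2 * (W.length + 1)).factorial * b / (n + 2).factorial)
      (by positivity) (fun μ hμ => by
        rw [le_div_iff₀' hf]
        have := ih (n := n + 2) (fun ν' hν' => h ν' (by rw [hν']; ring)) hμ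
        rwa [show n + 2 + 2 * W.length = n + 2 * (W.length + 1) by ring] at this) hν
    refine (mul_le_mul_of_nonneg_left h1 (by positivity)).trans_eq ?_
    have hf2 : ((n + 2).factorial : ℝ) = (n + 2) * ((n + 1) * n.factorial) := by
      rw [Nat.factorial_succ, Nat.factorial_succ]
      push_cast
      ring
    have hf3 : (n.factorial : ℝ) ≠ 0 := by exact_mod_cast n.factorial_ne_zero
    rw [hf2]
    field_simp
    ring

theorem annihilation_star (k : S × Fin 2) (φ : Amp S) :
    annihilation k (star φ) = star (annihilation k φ) := by
  funext ν
  simp [annihilation_apply]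

theorem creation_star (k : S × Fin 2) (φ : Amp S) :
    creation k (star φ) = star (creation k φ) := by
  funext ν
  simp [creation_apply]

/-- The generators $\sum a^{A\dagger}a^B$ have real matrix elements in the occupation basis.
Conjugation is needed because the inner product is antilinear in $\varphi$, while wedges are
transposed across a bilinear pairing. -/
theorem IsInvariant.star {G : SeedGraph S Λ N} {φ : Amp S} (hφ : IsInvariant G φ) :
    IsInvariant G (star φ) := by
  have h : ∀ n A B, nodeGenerator G n A B (Star.star φ) = Star.star (nodeGenerator G n A B φ) := by
    intro n A B
    simp only [nodeGenerator, LinearMap.sum_apply, Module.End.mul_apply, annihilation_star,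
      creation_star, star_sum]
  intro n
  obtain ⟨h1, h2, h3⟩ := hφ n
  simp only [h, h1, h2, h3, star_zero, and_self]

/-- The state created from the vacuum by a list of wedges. -/
def wedgesState (G : SeedGraph S Λ N) (W : List (S × S)) : Fock S :=
  ⟨wedgesCreation G W vacuum,
    (memℓp_zero (finite_support_wedgesCreation G W)).of_exponent_ge zero_le⟩

theorem inner_wedgesState (G : SeedGraph S Λ N) (W : List (S × S)) (φ : Fock S) :
    inner ℂ φ (wedgesState G W) = wedgesAnnihilation G W (star (φ : Amp S)) 0 := by
  rw [lp.inner_eq_tsum, ← tsum_wedgesCreation_mul]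
  rfl

/-- The squared norm is the amplitude at $0$ of $F_W$ applied to the conjugate state, which is at
most $2^{|W|}(2|W|)!$ times the norm itself. -/
theorem norm_wedgesState_le (G : SeedGraph S Λ N) (W : List (S × S)) :
    ‖wedgesState G W‖ ≤ 2 ^ W.length * (2 * W.length).factorial := by
  have h1 : ‖wedgesState G W‖ * ‖wedgesState G W‖ ≤
      2 ^ W.length * (2 * W.length).factorial * ‖wedgesState G W‖ := by
    rw [← inner_self_eq_norm_mul_norm (𝕜 := ℂ)]
    refine (RCLike.re_le_norm _).trans ?_
    rw [inner_wedgesState]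
    have := norm_wedgesAnnihilation_le G W (n := 0) (χ := star (wedgesState G W : Amp S))
      (norm_nonneg (wedgesState G W)) (fun ν _ => by
        rw [Pi.star_apply, norm_star]
        exact lp.norm_apply_le_norm (by norm_num) _ ν) (ν := 0) (by simp)
    simpa using this
  rcases (norm_nonneg (wedgesState G W)).eq_or_lt with h0 | h0
  · rw [← h0]
    positivity
  · exact le_of_mul_le_mul_right h1 h0

end WedgeBounds

/-! ### Spins of a multiloop in terms of its wedges -/

section MultiloopDegrees

variable {S Λ N : Type*} {G : SeedGraph S Λ N}

theorem coe_multiloopWedges (o : Loop G → OrientedLoop G) (Φ : Multiloop G) :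
    (multiloopWedges G (Φ.map o) : Multiset (S × S)) = (Φ.map (loopWedges o)).sum := by
  have h : ∀ l : List (OrientedLoop G),
      (((l.map fun p => G.wedges p.links).flatten : List (S × S)) : Multiset (S × S)) =
        ((l : Multiset (OrientedLoop G)).map fun p => (G.wedges p.links : Multiset (S × S))).sum := by
    intro l
    induction l with
    | nil => simp
    | cons p l ih =>
      rw [List.map_cons, List.flatten_cons, ← Multiset.coe_add, ih, ← Multiset.cons_coe,
        Multiset.map_cons, Multiset.sum_cons]
  rw [multiloopWedges, h, Multiset.coe_toList, Multiset.map_map]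
  rfl

theorem node_multiloopWedges (Φ : OrientedMultiloop G) :
    ∀ w ∈ multiloopWedges G Φ, G.node w.1 = G.node w.2 := by
  intro w hw
  simp only [multiloopWedges, List.mem_flatten, List.mem_map] at hw
  obtain ⟨_, ⟨p, -, rfl⟩, hw⟩ := hw
  exact p.closed w hw

theorem length_multiloopWedges (o : Loop G → OrientedLoop G) (Φ : Multiloop G) :
    (multiloopWedges G (Φ.map o)).length = (Φ.map (loopLength o)).sum := by
  rw [← Multiset.coe_card, coe_multiloopWedges]
  induction Φ using Multiset.induction_on with
  | empty => simp
  | cons α Φ ih =>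
    rw [Multiset.map_cons, Multiset.sum_cons, Multiset.card_add, ih, Multiset.map_cons,
      Multiset.sum_cons, loopWedges, Multiset.coe_card, SeedGraph.length_wedges, loopLength]

variable [DecidableEq S]

theorem seedDegree_add (V W : Multiset (S × S)) :
    seedDegree (V + W) = seedDegree V + seedDegree W := by
  simp [seedDegree]

theorem seedDegree_wedges (G : SeedGraph S Λ N) (l : List (Λ × Bool)) :
    seedDegree (G.wedges l : Multiset (S × S)) =
      (l.map fun x => (Pi.single (G.source x.1) 1 + Pi.single (G.target x.1) 1 : S → ℕ)).sum := by
  have h : ∀ l l' : List (Λ × Bool), l.length = l'.length →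
      seedDegree ((List.zipWith (fun x y => (G.finish x, G.start y)) l l' : List (S × S)) :
        Multiset (S × S)) = (l'.map fun x => (Pi.single (G.start x) 1 : S → ℕ)).sum +
          (l.map fun x => (Pi.single (G.finish x) 1 : S → ℕ)).sum := by
    intro l
    induction l with
    | nil =>
      intro l' h
      rw [List.length_nil, eq_comm, List.length_eq_zero_iff] at h
      simp [h, seedDegree_zero]
    | cons x l ih =>
      rintro (_ | ⟨y, l'⟩) h
      · simp at h
      · rw [List.zipWith_cons_cons, ← Multiset.cons_coe, seedDegree_cons, ih l' (by simpa using h)]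
        simp only [List.map_cons, List.sum_cons]
        abel
  rw [SeedGraph.wedges, h _ _ (by simp), ((l.rotate_perm 1).map _).sum_eq, ← List.sum_map_add]
  congr 1
  refine List.map_congr_left fun x _ => ?_
  obtain ⟨ℓ, b⟩ := x
  cases b
  · exact add_comm _ _
  · rfl

theorem seedDegree_wedges_ends [DecidableEq Λ] (G : SeedGraph S Λ N) (l : List (Λ × Bool)) (ℓ : Λ) :
    seedDegree (G.wedges l : Multiset (S × S)) (G.source ℓ) = (l.map Prod.fst).count ℓ ∧
      seedDegree (G.wedges l : Multiset (S × S)) (G.target ℓ) = (l.map Prod.fst).count ℓ := by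
  rw [seedDegree_wedges]
  induction l with
  | nil => simp
  | cons x l ih =>
    simp only [List.map_cons, List.sum_cons, Pi.add_apply, ih.1, ih.2, Pi.single_apply,
      G.source_injective.eq_iff, G.target_injective.eq_iff, List.count_cons, G.source_ne_target,
      (G.source_ne_target _ _).symm, if_false, beq_iff_eq, eq_comm (a := ℓ)]
    constructor <;> ring

theorem seedDegree_multiloopWedges [DecidableEq Λ] (o : Loop G → OrientedLoop G) (Φ : Multiloop G)
    (ℓ : Λ) :
    seedDegree (multiloopWedges G (Φ.map o) : Multiset (S × S)) (G.source ℓ) =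
        twiceSpin (Φ.map o) ℓ ∧
      seedDegree (multiloopWedges G (Φ.map o) : Multiset (S × S)) (G.target ℓ) =
        twiceSpin (Φ.map o) ℓ := by
  rw [coe_multiloopWedges, twiceSpin, Multiset.map_map]
  induction Φ using Multiset.induction_on with
  | empty => simp [seedDegree_zero]
  | cons α Φ ih =>
    have := seedDegree_wedges_ends G (o α).links ℓ
    simp only [Multiset.map_cons, Multiset.sum_cons, seedDegree_add, Pi.add_apply, ih.1, ih.2,
      loopWedges, this.1, this.2, Function.comp_apply, and_self]

theorem sum_seedDegree [Fintype S] [DecidableEq N] (G : SeedGraph S Λ N) {W : List (S × S)}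
    (hW : ∀ w ∈ W, G.node w.1 = G.node w.2) (n : N) :
    ∑ i with G.node i = n, seedDegree W i = 2 * nodeWedgeCount G W n := by
  induction W with
  | nil => simp [seedDegree_zero, nodeWedgeCount]
  | cons w W ih =>
    have hw := hW w (by simp)
    rw [← Multiset.cons_coe, seedDegree_cons, nodeWedgeCount_cons, mul_add,
      ← ih fun v hv => hW v (by simp [hv])]
    simp only [Pi.add_apply, Finset.sum_add_distrib, Finset.sum_pi_single', Finset.mem_filter,
      Finset.mem_univ, true_and, ← hw, eq_comm (a := n)]
    split_ifs <;> ring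

/-- Wedge ends at a node are counted twice: seed by seed they give $\sum_{i\in n}2j_i$, and wedge by
wedge they give twice the number of wedges. -/
theorem nodeSpin_eq_nodeWedgeCount [Fintype S] [Fintype Λ] [DecidableEq Λ] [DecidableEq N]
    (o : Loop G → OrientedLoop G) (Φ : Multiloop G) (n : N) :
    nodeSpin G (Φ.map o) n =
      nodeWedgeCount G (multiloopWedges G (Φ.map o) : Multiset (S × S)) n := by
  have h := sum_seedDegree G (node_multiloopWedges (Φ.map o)) n
  rw [Finset.sum_filter, ← G.bijective_ends.sum_comp, Fintype.sum_sum_type,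
    ← Finset.sum_add_distrib] at h
  simp only [Sum.elim_inl, Sum.elim_inr, (seedDegree_multiloopWedges o Φ _).1,
    (seedDegree_multiloopWedges o Φ _).2] at h
  have h2 := two_mul_nodeSpin G (Φ.map o) n
  rw [twiceNodeSpin, h] at h2
  exact Nat.eq_of_mul_eq_mul_left two_pos h2

end MultiloopDegrees

/-! ### The pairing of invariant and balanced amplitudes over multiloops -/

section Pairing

theorem hasSum_levels {α : Type*} {deg : α → ℕ} {F : ℕ → Finset α}
    (hF : ∀ n a, a ∈ F n ↔ deg a = n) {f : α → ℂ} {x : ℂ} (hf : HasSum f x) :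
    HasSum (fun n => ∑ a ∈ F n, f a) x := by
  refine ((Equiv.sigmaFiberEquiv deg).hasSum_iff.mpr hf).sigma fun n => ?_
  have h := (F n).hasSum f
  exact (Equiv.subtypeEquivRight fun a => hF n a).symm.hasSum_iff.mpr h

variable {S Λ N : Type*} [Fintype S] [DecidableEq S] [Fintype Λ] [Fintype N] [DecidableEq N]
  {G : SeedGraph S Λ N}

/-- The contribution of a collection of wedges to the pairing of two amplitudes. -/
def wedgePairing (G : SeedGraph S Λ N) (φ ψ : Amp S) (W : Multiset (S × S)) : ℂ :=
  (∏ ℓ, ((seedDegree W (G.source ℓ)).factorial : ℂ))⁻¹ *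
    (∏ n, ((nodeWedgeCount G W n + 1).factorial : ℂ))⁻¹ *
      (wedgesAnnihilation G W.toList φ 0 * wedgesAnnihilation G W.toList ψ 0)

theorem wedgePairing_coe (G : SeedGraph S Λ N) (φ ψ : Amp S) (W : List (S × S)) :
    wedgePairing G φ ψ (W : Multiset (S × S)) =
      (∏ ℓ, ((seedDegree W (G.source ℓ)).factorial : ℂ))⁻¹ *
        (∏ n, ((nodeWedgeCount G W n + 1).factorial : ℂ))⁻¹ *
          (wedgesAnnihilation G W φ 0 * wedgesAnnihilation G W ψ 0) := by
  have h : (W : Multiset (S × S)).toList.Perm W := by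
    rw [← Multiset.coe_eq_coe, Multiset.coe_toList]
  rw [wedgePairing, wedgesAnnihilation_perm G h]

/-- Flipping a wedge changes the sign of both annihilation factors, so their product is unchanged.
Antisymmetry kills a wedge from a seed to itself. -/
theorem isAdmissible_wedgePairing (G : SeedGraph S Λ N) (φ ψ : Amp S) :
    IsAdmissible G (wedgePairing G φ ψ) where
  flip i j W := by
    induction W using Quotient.inductionOn with
    | _ W =>
    simp only [Multiset.quot_mk_to_coe, Multiset.cons_coe, wedgePairing_coe]
    rw [← Multiset.cons_coe, ← Multiset.cons_coe, seedDegree_cons, seedDegree_cons,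
      wedgesAnnihilation_cons, wedgesAnnihilation_cons, wedgeAnnihilation_swap G j i]
    simp only [nodeWedgeCount_cons]
    by_cases h : G.node i = G.node j
    · rw [h, add_comm (Pi.single i 1 : S → ℕ)]
      simp
    · simp [wedgeAnnihilation, h, Ne.symm h]
  self i W := by
    induction W using Quotient.inductionOn with
    | _ W =>
    simp only [Multiset.quot_mk_to_coe, Multiset.cons_coe, wedgePairing_coe]
    simp [wedgesAnnihilation_cons, wedgeAnnihilation_self]
  node i j W h := by
    induction W using Quotient.inductionOn with
    | _ W =>
    simp only [Multiset.quot_mk_to_coe, Multiset.cons_coe, wedgePairing_coe]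
    simp [wedgesAnnihilation_cons, wedgeAnnihilation, h]

/-- Amplitudes supported on the solutions of the link constraints. -/
def IsBalanced (G : SeedGraph S Λ N) (ψ : Amp S) : Prop :=
  ∀ ν, ψ ν ≠ 0 → ∀ ℓ, ν (G.source ℓ, 0) + ν (G.source ℓ, 1) =
    ν (G.target ℓ, 0) + ν (G.target ℓ, 1)

theorem isBalanced_heatKernel (G : SeedGraph S Λ N)
    (H : Λ → Matrix.SpecialLinearGroup (Fin 2) ℂ) (t : Λ → ℝ) :
    IsBalanced G (heatKernelAmplitude G H t) := by
  intro ν hν ℓ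
  by_contra h
  exact hν (Finset.prod_eq_zero (Finset.mem_univ ℓ) (if_neg fun h' => h h'.symm))

/-- The left side pairs $\psi$ with a state whose number of quanta at each seed is the degree of $W$
there; an unbalanced degree lies outside the support of $\psi$. -/
theorem IsBalanced.wedgesAnnihilation_eq_zero {ψ : Amp S} (hψ : IsBalanced G ψ)
    {W : List (S × S)} (hW : ¬ ∀ ℓ, seedDegree W (G.source ℓ) = seedDegree W (G.target ℓ)) :
    wedgesAnnihilation G W ψ 0 = 0 := by
  rw [← tsum_wedgesCreation_mul]
  refine (tsum_congr fun ν => ?_).trans tsum_zero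
  by_contra h
  refine hW fun ℓ => ?_
  have h1 := seedDegree_of_wedgesCreation_ne_zero (left_ne_zero_of_mul h)
  rw [← h1, ← h1]
  exact hψ ν (right_ne_zero_of_mul h) ℓ

theorem IsBalanced.eq_zero_of_odd {ψ : Amp S} (hψ : IsBalanced G ψ) {ν : Occ S}
    (hν : Odd (∑ k, ν k)) : ψ ν = 0 := by
  by_contra h
  rw [Fintype.sum_prod_type, ← G.bijective_ends.sum_comp, Fintype.sum_sum_type,
    ← Finset.sum_add_distrib] at hν
  refine (Nat.not_even_iff_odd.mpr hν) (Finset.even_sum _ fun ℓ _ => ?_)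
  simp only [Sum.elim_inl, Sum.elim_inr, Fin.sum_univ_two]
  rw [hψ ν h ℓ]
  exact Even.add_self _

theorem sum_of_wedgesCreation_ne_zero {W : List (S × S)} {ν : Occ S}
    (h : wedgesCreation G W vacuum ν ≠ 0) : ∑ k, ν k = 2 * W.length := by
  rw [← sum_nodeNumber G]
  simp only [nodeNumber_of_wedgesCreation_ne_zero h]
  rw [← Finset.mul_sum]
  congr 1
  simp only [nodeWedgeCount]
  rw [Multiset.sum_count_eq_card fun _ _ => Finset.mem_univ _]
  simp

theorem sum_wedgesCreation_mul {W : List (S × S)} {M : ℕ} (hW : W.length = M) (ψ : Amp S) :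
    ∑ ν ∈ Finset.piAntidiag Finset.univ (2 * M), wedgesCreation G W vacuum ν * ψ ν =
      wedgesAnnihilation G W ψ 0 := by
  rw [← tsum_wedgesCreation_mul, tsum_eq_sum]
  intro ν hν
  by_contra h
  refine hν ?_
  rw [Finset.mem_piAntidiag]
  exact ⟨by rw [← hW]; exact sum_of_wedgesCreation_ne_zero (left_ne_zero_of_mul h), by simp⟩

/-- The pairing of an invariant and a balanced amplitude as a sum over multiloops. -/
theorem multiloopSum_wedgePairing {o : Loop G → OrientedLoop G} (ho : ∀ α, (o α).toLoop = α)
    {φ ψ : Amp S} (hφ : IsInvariant G φ) (hψ : IsBalanced G ψ) (M : ℕ) :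
    multiloopSum ho M (wedgePairing G φ ψ) =
      ∑ ν ∈ Finset.piAntidiag Finset.univ (2 * M), φ ν * ψ ν := by
  have hR : ∀ ν ∈ Finset.piAntidiag Finset.univ (2 * M), φ ν * ψ ν =
      (2 ^ M * M.factorial : ℂ)⁻¹ * sumLists M fun W : List (S × S) =>
        wedgesAnnihilation G W φ 0 / (∏ n, ((nodeWedgeCount G W n + 1).factorial : ℂ)) *
          (wedgesCreation G W vacuum ν * ψ ν) := by
    intro ν hν
    rw [eq_sumLists_of_isInvariant M hφ (Finset.mem_piAntidiag.mp hν).1, Pi.smul_apply,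
      sumLists_apply, smul_eq_mul, mul_assoc, mul_comm _ (ψ ν), mul_sumLists]
    congr 1
    refine sumLists_congr fun W _ => ?_
    rw [Pi.smul_apply, smul_eq_mul]
    ring
  rw [multiloopSum_eq_wedgeSum ho (isAdmissible_wedgePairing G φ ψ), wedgeSum,
    Finset.sum_congr rfl hR, ← Finset.mul_sum, ← sumLists_sum]
  congr 1
  refine sumLists_congr fun W hW => ?_
  rw [← Finset.mul_sum, sum_wedgesCreation_mul hW, wedgePairing_coe]
  -- For balanced wedges the number of strandings cancels the inverse factorials in `wedgePairing`;
  -- for the others $F_W\psi$ vanishes at the vacuum.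
  by_cases hb : ∀ ℓ, seedDegree W (G.source ℓ) = seedDegree W (G.target ℓ)
  · rw [strandingCount_of_balanced G hb]
    have h0 : ∏ ℓ, ((seedDegree W (G.source ℓ)).factorial : ℂ) ≠ 0 :=
      Finset.prod_ne_zero_iff.mpr fun ℓ _ => Nat.cast_ne_zero.mpr (Nat.factorial_ne_zero _)
    rw [mul_assoc (∏ ℓ, _)⁻¹, mul_inv_cancel_left₀ h0]
    ring
  · rw [hψ.wedgesAnnihilation_eq_zero hb]
    simp

end Pairing

/-! ### Convergence and identification of the projection -/

section Expansion

variable {S Λ N : Type*} [Fintype S] [DecidableEq S] [Fintype Λ] [DecidableEq Λ] [Fintype N]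
  [DecidableEq N] {G : SeedGraph S Λ N}

/-- The term of a multiloop in the loop expansion of the heat kernel state. -/
def expansionTerm (G : SeedGraph S Λ N) (H : Λ → Matrix.SpecialLinearGroup (Fin 2) ℂ) (t : Λ → ℝ)
    (Φ : OrientedMultiloop G) : Fock S :=
  (((∏ ℓ, (heatWeight (t ℓ) (twiceSpin Φ ℓ) : ℂ)) * epsDotH G H Φ) /
    ∏ n, ((nodeSpin G Φ n + 1).factorial : ℂ)) • multiloopState G Φ

/-- The heat weights and the contraction are recombined into $F_W\psi$ at the vacuum, so that both
the pairing and the norm estimates see only wedge operators. -/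
theorem expansionTerm_eq (H : Λ → Matrix.SpecialLinearGroup (Fin 2) ℂ) (t : Λ → ℝ)
    (o : Loop G → OrientedLoop G) (Φ : Multiloop G) :
    expansionTerm G H t (Φ.map o) =
      ((∏ ℓ, ((twiceSpin (Φ.map o) ℓ).factorial : ℂ))⁻¹ *
        (∏ n, ((nodeSpin G (Φ.map o) n + 1).factorial : ℂ))⁻¹ *
          wedgesAnnihilation G (multiloopWedges G (Φ.map o)) (heatKernelAmplitude G H t) 0) •
        wedgesState G (multiloopWedges G (Φ.map o)) := by
  rw [wedgesAnnihilation_heatKernel G H t (node_multiloopWedges _)]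
  simp only [(seedDegree_multiloopWedges o Φ _).2]
  rw [expansionTerm, epsDotH]
  refine congrArg₂ _ ?_ rfl
  ring

theorem inner_expansionTerm (H : Λ → Matrix.SpecialLinearGroup (Fin 2) ℂ) (t : Λ → ℝ)
    (o : Loop G → OrientedLoop G) (Φ : Multiloop G) (φ : Fock S) :
    inner ℂ φ (expansionTerm G H t (Φ.map o)) =
      wedgePairing G (star (φ : Amp S)) (heatKernelAmplitude G H t) (Φ.map (loopWedges o)).sum := by
  rw [expansionTerm_eq, inner_smul_right, inner_wedgesState, ← coe_multiloopWedges,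
    wedgePairing_coe]
  simp only [(seedDegree_multiloopWedges o Φ _).1, nodeSpin_eq_nodeWedgeCount]
  ring

theorem seedSpin_apply (i : S) (ψ : Amp S) (ν : Occ S) :
    seedSpin i ψ ν = 1 / 2 * ((ν (i, 0) + ν (i, 1) : ℕ) * ψ ν) := by
  have h := fun k => creation_mul_annihilation_apply k ψ ν
  simp only [Module.End.mul_apply] at h
  simp only [seedSpin, Fin.sum_univ_two, LinearMap.smul_apply, LinearMap.add_apply,
    LinearMap.comp_apply, Pi.smul_apply, Pi.add_apply, smul_eq_mul, h]
  push_cast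
  ring

theorem wedgesState_mem_physicalSpace {W : List (S × S)}
    (hW : ∀ ℓ, seedDegree W (G.source ℓ) = seedDegree W (G.target ℓ)) :
    wedgesState G W ∈ physicalSpace G := by
  refine ⟨fun ℓ => ?_, (isInvariant_iff G _).mp (isInvariant_wedgesCreation G W)⟩
  funext ν
  rw [linkConstraint, LinearMap.sub_apply, Pi.sub_apply, seedSpin_apply, seedSpin_apply]
  by_cases h : wedgesCreation G W vacuum ν = 0
  · simp [wedgesState, h]
  · rw [seedDegree_of_wedgesCreation_ne_zero h, seedDegree_of_wedgesCreation_ne_zero h, hW]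
    simp

theorem expansionTerm_mem_physicalSpace (H : Λ → Matrix.SpecialLinearGroup (Fin 2) ℂ) (t : Λ → ℝ)
    (o : Loop G → OrientedLoop G) (Φ : Multiloop G) :
    expansionTerm G H t (Φ.map o) ∈ physicalSpace G := by
  refine Submodule.smul_mem _ _ (wedgesState_mem_physicalSpace fun ℓ => ?_)
  rw [(seedDegree_multiloopWedges o Φ ℓ).1, (seedDegree_multiloopWedges o Φ ℓ).2]

theorem norm_inv_prod_factorial_le {ι : Type*} [Fintype ι] (f : ι → ℕ) :
    ‖(∏ i, ((f i).factorial : ℂ))⁻¹‖ ≤ 1 := by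
  rw [norm_inv, ← Nat.cast_prod, Complex.norm_natCast]
  exact inv_le_one_of_one_le₀ (by exact_mod_cast Finset.prod_pos fun i _ => (f i).factorial_pos)

theorem norm_expansionTerm_le (H : Λ → Matrix.SpecialLinearGroup (Fin 2) ℂ) (t : Λ → ℝ)
    (o : Loop G → OrientedLoop G) (Φ : Multiloop G) :
    ‖expansionTerm G H t (Φ.map o)‖ ≤
      ‖wedgesAnnihilation G (multiloopWedges G (Φ.map o)) (heatKernelAmplitude G H t) 0‖ *
        ‖wedgesState G (multiloopWedges G (Φ.map o))‖ := by
  rw [expansionTerm_eq, norm_smul]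
  refine mul_le_mul_of_nonneg_right ?_ (norm_nonneg _)
  rw [norm_mul, norm_mul]
  exact mul_le_of_le_one_left (norm_nonneg _)
    (mul_le_one₀ (norm_inv_prod_factorial_le _) (norm_nonneg _)
      (norm_inv_prod_factorial_le fun n => nodeSpin G (Φ.map o) n + 1))

theorem summable_expansionTerm (H : Λ → Matrix.SpecialLinearGroup (Fin 2) ℂ) {t : Λ → ℝ}
    (ht : ∀ ℓ, 0 < t ℓ) {o : Loop G → OrientedLoop G} (ho : ∀ α, (o α).toLoop = α) :
    Summable fun Φ : Multiloop G => expansionTerm G H t (Φ.map o) := by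
  set m : ℝ := (Fintype.card ((Λ × Bool) × Bool) : ℝ) with hm
  -- With this $R$ a term is at most $K(m+1)^{-2L}$, while at most $m^L$ multiloops have length $L$.
  set R : ℝ := 2 * (m + 1) with hR
  have hR0 : 0 < R := by positivity
  obtain ⟨K, hK⟩ := exists_bound_heatKernel G H ht hR0
  have hK0 : 0 ≤ K := le_trans (by positivity) (hK 0)
  have hs : Summable fun Φ : Multiloop G =>
      K * (4 / R ^ 2) ^ (multiloopCode o Φ).length := by
    refine ((summable_pow_length (by positivity) ?_).comp_injective
      (multiloopCode_injective ho)).mul_left K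
    rw [← hm, hR, div_mul_eq_mul_div, div_lt_one (by positivity)]
    have : 0 ≤ m := by positivity
    nlinarith
  refine Summable.of_norm_bounded hs fun Φ => ?_
  rw [length_multiloopCode, ← length_multiloopWedges]
  set W := multiloopWedges G (Φ.map o) with hW
  set L := W.length
  have hF : (0 : ℝ) < (2 * L).factorial := by exact_mod_cast Nat.factorial_pos _
  have h1 := norm_wedgesAnnihilation_le G W (n := 0) (χ := heatKernelAmplitude G H t)
    (b := K / (((2 * L).factorial : ℝ) ^ 2 * R ^ (2 * L))) (by positivity) (fun ν hν => by
      rw [le_div_iff₀ (by positivity)]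
      rw [zero_add] at hν
      simpa only [hν] using hK ν) (ν := 0) (by simp)
  rw [zero_add, Nat.factorial_zero, Nat.cast_one, one_mul] at h1
  calc _ ≤ _ := norm_expansionTerm_le H t o Φ
    _ ≤ 2 ^ L * (2 * L).factorial * (K / (((2 * L).factorial : ℝ) ^ 2 * R ^ (2 * L))) *
        (2 ^ L * (2 * L).factorial) :=
      mul_le_mul h1 (norm_wedgesState_le G W) (norm_nonneg _) (by positivity)
    _ = K * (4 / R ^ 2) ^ L := by
      rw [div_pow, ← pow_mul, show (4 : ℝ) ^ L = 2 ^ L * 2 ^ L by rw [← mul_pow]; norm_num]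
      field_simp

theorem inner_tsum_expansionTerm (H : Λ → Matrix.SpecialLinearGroup (Fin 2) ℂ) {t : Λ → ℝ}
    (ht : ∀ ℓ, 0 < t ℓ) {o : Loop G → OrientedLoop G} (ho : ∀ α, (o α).toLoop = α) {φ : Fock S}
    (hφ : φ ∈ physicalSpace G) :
    inner ℂ φ (∑' Φ : Multiloop G, expansionTerm G H t (Φ.map o)) =
      inner ℂ φ (⟨heatKernelAmplitude G H t, memℓp_heatKernel G H ht⟩ : Fock S) := by
  have h1 : HasSum (fun Φ : Multiloop G => inner ℂ φ (expansionTerm G H t (Φ.map o)))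
      (inner ℂ φ (∑' Φ : Multiloop G, expansionTerm G H t (Φ.map o))) :=
    (innerSL ℂ φ).hasSum (summable_expansionTerm H ht ho).hasSum
  have h2 := lp.hasSum_inner (𝕜 := ℂ) φ (⟨heatKernelAmplitude G H t, memℓp_heatKernel G H ht⟩ : Fock S)
  have h3 := hasSum_levels (F := multiloopsOfLength ho) (fun n Φ => mem_multiloopsOfLength) h1
  -- Occupations are grouped by half their total number, rounded down. The odd levels swept in this
  -- way contribute nothing, since a balanced state has an even number of quanta.
  have h4 := hasSum_levels (deg := fun ν : Occ S => (∑ k, ν k) / 2)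
    (F := fun M => Finset.piAntidiag Finset.univ (2 * M) ∪
      Finset.piAntidiag Finset.univ (2 * M + 1)) (fun M ν => by
        simp only [Finset.mem_union, Finset.mem_piAntidiag, Finset.mem_univ, implies_true,
          and_true]
        change (∑ k, ν k = 2 * M ∨ ∑ k, ν k = 2 * M + 1) ↔ (∑ k, ν k) / 2 = M
        omega) h2
  refine h3.unique ?_
  convert h4 using 2 with M
  have hφ' : IsInvariant G (star (φ : Amp S)) := ((isInvariant_iff G _).mpr hφ.2).star
  have hψ := isBalanced_heatKernel G H t
  have hodd : ∀ ν ∈ Finset.piAntidiag Finset.univ (2 * M + 1),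
      inner ℂ ((φ : Amp S) ν) (heatKernelAmplitude G H t ν) = 0 := by
    intro ν hν
    rw [hψ.eq_zero_of_odd, inner_zero_right]
    exact ⟨M, (Finset.mem_piAntidiag.mp hν).1⟩
  rw [Finset.sum_union, Finset.sum_eq_zero hodd, add_zero]
  · refine ((Finset.sum_congr rfl fun Φ _ => inner_expansionTerm H t o Φ φ).trans
      (multiloopSum_wedgePairing ho hφ' hψ M)).trans (Finset.sum_congr rfl fun ν _ => ?_)
    exact mul_comm _ _
  · rw [Finset.disjoint_left]
    intro ν h h'
    have := (Finset.mem_piAntidiag.mp h).1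
    have := (Finset.mem_piAntidiag.mp h').1
    omega

/-- The sum lies in the closed subspace $\mathcal H_\Gamma$, and its difference from the heat kernel
state is orthogonal to that subspace. -/
theorem projector_heatKernel (H : Λ → Matrix.SpecialLinearGroup (Fin 2) ℂ) {t : Λ → ℝ}
    (ht : ∀ ℓ, 0 < t ℓ) {o : Loop G → OrientedLoop G} (ho : ∀ α, (o α).toLoop = α) :
    projector G ⟨heatKernelAmplitude G H t, memℓp_heatKernel G H ht⟩ =
      ∑' Φ : Multiloop G, expansionTerm G H t (Φ.map o) := by
  refine Submodule.eq_starProjection_of_mem_of_inner_eq_zero ?_ fun φ hφ => ?_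
  · exact (isClosed_physicalSpace G).mem_of_tendsto (summable_expansionTerm H ht ho).hasSum
      (Filter.Eventually.of_forall fun s =>
        Submodule.sum_mem _ fun Φ _ => expansionTerm_mem_physicalSpace H t o Φ)
  · rw [← inner_conj_symm, inner_sub_right, inner_tsum_expansionTerm H ht ho hφ, sub_self, map_zero]

end Expansion

end LoopExpansion

end

open LoopExpansion in
theorem mainTheorem9 {S Λ N : Type*} [Fintype S] [DecidableEq S] [Fintype Λ] [DecidableEq Λ]
    [Fintype N] [DecidableEq N] (G : SeedGraph S Λ N)
    (H : Λ → Matrix.SpecialLinearGroup (Fin 2) ℂ) (t : Λ → ℝ) (ht : ∀ ℓ, 0 < t ℓ)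
    (o : Loop G → OrientedLoop G) (ho : ∀ α, (o α).toLoop = α) :
    ∃ hmem : Memℓp (heatKernelAmplitude G H t) 2,
      HasSum
        (fun Φ : Multiloop G =>
          (((∏ ℓ, (heatWeight (t ℓ) (twiceSpin (Φ.map o) ℓ) : ℂ)) * epsDotH G H (Φ.map o)) /
              ∏ n, ((nodeSpin G (Φ.map o) n + 1).factorial : ℂ)) •
            multiloopState G (Φ.map o))
        (projector G ⟨heatKernelAmplitude G H t, hmem⟩) := by
  refine ⟨memℓp_heatKernel G H ht, ?_⟩
  rw [projector_heatKernel H ht ho]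
  exact (summable_expansionTerm H ht ho).hasSum
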